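/- Let $\mathbb K$ be a field of characteristic zero and $\delta\in\mathbb K$. **Conventions.** A *tensor category* is a $\mathbb K$-linear strict symmetric monoidal category $(\mathcal T,\otimes,\mathbf 1,c)$ with $\mathbb K$-bilinear $\otimes$, with $\operatorname{End}(\mathbf 1)=\mathbb K$, in which every object $X$ has a dual $(X^*,\mathrm{ev}_X:X^*\otimes X\to\mathbf 1,\mathrm{coev}_X:\mathbf 1\to X\otimes X^*)$ satisfying the triangle identities. The dimension of $X$ is $\dim X=\mathrm{ev}_X\circ c_{X,X^*}\circ\mathrm{coev}_X\in\operatorname{End}(\mathbf 1)=\mathbb K$. A *tensor functor* is a $\mathbb K$-linear (strong) symmetric monoidal functor; it is *strict* if $F(X\otimes Y)=FX\otimes FY$ and $F\mathbf 1=\mathbf 1$, and its structure isomorphisms are identities. Morphisms between tensor functors are monoidal natural transformations. **The category $\underline{\mathrm{Re}}\mathrm p_0(GL_\delta)$.** Its objects are the finite (possibly empty) words in two letters $\bullet,\circ$. A $(w,w')$-diagram is a graph whose vertices are the letters of $w$ (bottom row) and of $w'$ (top row), in which each vertex lies on exactly one edge, and in which an edge joins a $\bullet$ and a $\circ$ if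 and only if its two ends lie in the same row. $\operatorname{Hom}(w,w')$ is the $\mathbb K$-vector space with basis the $(w,w')$-diagrams. Composition is bilinear, with $Y\circ X=\delta^{\ell(X,Y)}\,Y\cdot X$ for a $(w,w')$-diagram $X$ and a $(w',w'')$-diagram $Y$: stack $Y$ atop $X$, let $Y\cdot X$ be the $(w,w'')$-diagram recording which vertices of the bottom and top rows are connected, and let $\ell(X,Y)$ be the number of cycles (connected components not meeting the bottom or top row). The tensor product is concatenation of words and juxtaposition of diagrams, the unit is the empty word, and the braiding $w_1w_2\to w_2w_1$ is the diagram joining each letter to its copy. **The category $\underline{\mathrm{Re}}\mathrm p(GL_\delta)$** is the Karoubi envelope of the additive envelope of $\underline{\mathrm{Re}}\mathrm p_0(GL_\delta)$, with the induced $\mathbb K$-linear symmetric monoidal structure; it contains $\underline{\mathrm{Re}}\mathrm p_0(GL_\delta)$ through the canonical monoidal embedding. **Proposition.** Let $\mathcal T$ be a tensor category and let $\mathcal T_\delta$ be the category of $\delta$-dimensional objects of $\mathcal T$ and their isomorphisms. 1. The assignment $F\mapsto F(\bullet)$, $(\eta:F\Rightarrow F')\mapsto\eta_\bullet$ is a well-defined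 functor to $\mathcal T_\delta$ from the category of strict tensor functors $\underline{\mathrm{Re}}\mathrm p_0(GL_\delta)\to\mathcal T$ and monoidal natural transformations, and it is an equivalence of categories. 2. Let $\mathcal Hom'(\underline{\mathrm{Re}}\mathrm p(GL_\delta),\mathcal T)$ be the category of tensor functors $\underline{\mathrm{Re}}\mathrm p(GL_\delta)\to\mathcal T$ whose restriction to $\underline{\mathrm{Re}}\mathrm p_0(GL_\delta)$ is strict, with all monoidal natural transformations as morphisms. The assignment $F\mapsto F(\bullet)$, $\eta\mapsto\eta_\bullet$ is a well-defined, full and faithful functor $\mathcal Hom'(\underline{\mathrm{Re}}\mathrm p(GL_\delta),\mathcal T)\to\mathcal T_\delta$. If $\mathcal T$ has finite biproducts and all idempotents of $\mathcal T$ split, it is an equivalence of categories. -/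

import Mathlib

open CategoryTheory MonoidalCategory

universe u u₁ v₁ u₂ v₂ u₃ v₃

section Flow

theorem eqvGen_saturated {V : Type*} {R : V → V → Prop} (P : V → Prop)
    (hP : ∀ a b, R a b → (P a ↔ P b)) {a b : V} (h : Relation.EqvGen R a b) : P a ↔ P b := by
  induction h with
  | rel x y h => exact hP x y h
  | refl x => exact Iff.rfl
  | symm x y _ ih => exact ih.symm
  | trans x y z _ _ h1 h2 => exact h1.trans h2

theorem eqvGen_source_unique {V : Type*} {R : V → V → Prop}
    (hinj : ∀ a b c, R a c → R b c → a = b) {s s' : V}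
    (hs : ∀ a, ¬ R a s) (hs' : ∀ a, ¬ R a s') (h : Relation.EqvGen R s s') : s = s' := by
  have key : Relation.ReflTransGen R s s' := by
    refine (eqvGen_saturated (fun v => Relation.ReflTransGen R s v) ?_ h).1 .refl
    intro a b hab
    refine ⟨fun h => h.tail hab, fun h => ?_⟩
    rcases Relation.ReflTransGen.cases_tail h with rfl | ⟨c, hc, hcb⟩
    · exact (hs a hab).elim
    · rw [hinj a c b hab hcb]; exact hc
  rcases Relation.ReflTransGen.cases_tail key with h | ⟨c, _, hc⟩
  · exact h.symm
  · exact (hs' c hc).elim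

theorem exists_target {V : Type*} [Finite V] {R : V → V → Prop}
    (hinj : ∀ a b c, R a c → R b c → a = b) {s : V} (hs : ∀ a, ¬ R a s) :
    ∃ t, Relation.EqvGen R s t ∧ ∀ b, ¬ R t b := by
  by_contra hcon
  push Not at hcon
  have hto : ∀ v, Relation.ReflTransGen R s v → Relation.EqvGen R s v := by
    intro v hv
    induction hv with
    | refl => exact .refl _
    | tail _ h ih => exact .trans _ _ _ ih (.rel _ _ h)
  have hex : ∀ v : {v // Relation.ReflTransGen R s v}, ∃ b, R v.1 b :=
    fun v => hcon v.1 (hto v.1 v.2)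
  let f : {v // Relation.ReflTransGen R s v} → V := fun v => (hex v).choose
  have hf : ∀ v : {v // Relation.ReflTransGen R s v}, R v.1 (f v) := fun v => (hex v).choose_spec
  let F : {v // Relation.ReflTransGen R s v} → {v // Relation.ReflTransGen R s v} :=
    fun v => ⟨f v, Relation.ReflTransGen.tail v.property (hf v)⟩
  have hF : Function.Injective F := by
    intro a b hab
    have h1 : f a = f b := congrArg Subtype.val hab
    exact Subtype.ext (hinj _ _ _ (hf a) (h1 ▸ hf b))
  obtain ⟨v, hv⟩ := Finite.surjective_of_injective hF ⟨s, .refl⟩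
  have h1 : f v = s := congrArg Subtype.val hv
  have h2 := hf v
  rw [h1] at h2
  exact hs v.1 h2

end Flow

/-- The two letters: `black` is `•` and `white` is `∘`. -/
inductive Letter : Type
  | black : Letter
  | white : Letter

/-- Finite (possibly empty) words in the two letters. -/
abbrev Word : Type := List Letter

/-- The vertices of a `(w, w')`-diagram: the letters of `w` form the bottom row (`Sum.inl`),
the letters of `w'` form the top row (`Sum.inr`). -/
abbrev DiagramVertex (w w' : Word) : Type := Fin w.length ⊕ Fin w'.length

/-- The letter with which a vertex is drawn. -/
def vertexLetter (w w' : Word) : DiagramVertex w w' → Letter :=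
  Sum.elim (fun i => w.get i) (fun j => w'.get j)

/-- A `(w, w')`-diagram: a graph on the letters of `w` (bottom row) and of `w'` (top row) in which
each vertex is adjacent to exactly one edge; the other end of the edge at `v` is `mate v`.
An edge joins a black and a white vertex if and only if both its ends lie in the same row. -/
@[ext]
structure WordDiagram (w w' : Word) where
  mate : DiagramVertex w w' → DiagramVertex w w'
  mate_mate : ∀ v, mate (mate v) = v
  letter_iff : ∀ v, vertexLetter w w' v ≠ vertexLetter w w' (mate v) ↔
    v.isLeft = (mate v).isLeft

namespace WordDiagram

variable {w w' w'' w₁ w₂ w₃ w₁' w₂' w₃' : Word}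

theorem mate_ne (X : WordDiagram w w') (v : DiagramVertex w w') : X.mate v ≠ v := by
  intro h
  have := X.letter_iff v
  rw [h] at this
  simp at this

/-- Orientation: black vertices of the bottom row and white vertices of the top row. -/
def IsSrc (w w' : Word) (v : DiagramVertex w w') : Prop :=
  (vertexLetter w w' v = .black ↔ v.isLeft = true)

theorem letter_iff_of_isSrc (v u : DiagramVertex w w') (h : IsSrc w w' u ↔ ¬ IsSrc w w' v) :
    vertexLetter w w' v ≠ vertexLetter w w' u ↔ v.isLeft = u.isLeft := by
  unfold IsSrc at h
  cases hv : vertexLetter w w' v <;> cases hu : vertexLetter w w' u <;>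
    cases hv' : v.isLeft <;> cases hu' : u.isLeft <;> simp_all

theorem isSrc_mate (X : WordDiagram w w') (v : DiagramVertex w w') :
    IsSrc w w' (X.mate v) ↔ ¬ IsSrc w w' v := by
  have h := X.letter_iff v
  unfold IsSrc
  cases hv : vertexLetter w w' v <;> cases hu : vertexLetter w w' (X.mate v) <;>
    cases hv' : v.isLeft <;> cases hu' : (X.mate v).isLeft <;> simp_all

theorem mate_injective (X : WordDiagram w w') : Function.Injective X.mate :=
  Function.Involutive.injective X.mate_mate

/-! ### Stacking -/

/-- The vertices of the stacked graph: bottom, middle and top row. -/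
abbrev StackVertex (w w' w'' : Word) : Type :=
  Fin w.length ⊕ Fin w'.length ⊕ Fin w''.length

/-- The bottom and middle row of the stacked graph. -/
def lower : DiagramVertex w w' → StackVertex w w' w'' := Sum.elim .inl (fun j => .inr (.inl j))

/-- The middle and top row of the stacked graph. -/
def upper : DiagramVertex w' w'' → StackVertex w w' w'' := .inr

/-- The bottom and top row of the stacked graph. -/
def outer : DiagramVertex w w'' → StackVertex w w' w'' := Sum.elim .inl (fun k => .inr (.inr k))

/-- The edges of the graph obtained by stacking `Y` atop `X`. -/
inductive StackEdge (X : WordDiagram w w') (Y : WordDiagram w' w'') :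
    StackVertex w w' w'' → StackVertex w w' w'' → Prop
  | lower (v : DiagramVertex w w') : StackEdge X Y (lower v) (lower (X.mate v))
  | upper (v : DiagramVertex w' w'') : StackEdge X Y (upper v) (upper (Y.mate v))

/-- Two vertices of the stacked graph are connected if a path of edges joins them. -/
def stackSetoid (X : WordDiagram w w') (Y : WordDiagram w' w'') : Setoid (StackVertex w w' w'') :=
  Relation.EqvGen.setoid (StackEdge X Y)

/-- The connected components of the stacked graph. -/
abbrev StackComponent (X : WordDiagram w w') (Y : WordDiagram w' w'') : Type :=
  Quotient (stackSetoid X Y)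

/-- The number of cycles of the stacked graph, that is, the number of its connected components
that contain no vertex of the bottom or top row. -/
noncomputable def loops (X : WordDiagram w w') (Y : WordDiagram w' w'') : ℕ :=
  Nat.card {c : StackComponent X Y // ∀ v : DiagramVertex w w'', Quotient.mk _ (outer v) ≠ c}

/-- Oriented edges of the stacked graph. -/
inductive Step (X : WordDiagram w w') (Y : WordDiagram w' w'') :
    StackVertex w w' w'' → StackVertex w w' w'' → Prop
  | lower (v : DiagramVertex w w') (h : IsSrc w w' v) : Step X Y (lower v) (lower (X.mate v))
  | upper (v : DiagramVertex w' w'') (h : IsSrc w' w'' v) : Step X Y (upper v) (upper (Y.mate v))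

theorem lower_injective : Function.Injective (lower (w := w) (w' := w') (w'' := w'')) := by
  rintro (a | a) (b | b) h <;> simp_all [lower]

theorem upper_injective : Function.Injective (upper (w := w) (w' := w') (w'' := w'')) :=
  Sum.inr_injective

theorem lower_eq_upper {v : DiagramVertex w w'} {u : DiagramVertex w' w''}
    (h : (lower v : StackVertex w w' w'') = upper u) : IsSrc w w' v ↔ ¬ IsSrc w' w'' u := by
  rcases v with v | v <;> rcases u with u | u <;> simp [lower, upper] at h
  subst h
  simp [IsSrc, vertexLetter]

theorem lower_eq_outer {v : DiagramVertex w w'} {u : DiagramVertex w w''}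
    (h : (lower v : StackVertex w w' w'') = outer u) : IsSrc w w' v ↔ IsSrc w w'' u := by
  rcases v with v | v <;> rcases u with u | u <;> simp [lower, outer] at h
  subst h
  simp [IsSrc, vertexLetter]

theorem upper_eq_outer {v : DiagramVertex w' w''} {u : DiagramVertex w w''}
    (h : (upper v : StackVertex w w' w'') = outer u) : IsSrc w' w'' v ↔ IsSrc w w'' u := by
  rcases v with v | v <;> rcases u with u | u <;> simp [upper, outer] at h
  subst h
  simp [IsSrc, vertexLetter]

theorem outer_injective : Function.Injective (outer (w := w) (w' := w') (w'' := w'')) := by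
  rintro (a | a) (b | b) h <;> simp_all [outer]

section Stack

variable (X : WordDiagram w w') (Y : WordDiagram w' w'')

theorem stackEdge_iff (a b) : StackEdge X Y a b ↔ Step X Y a b ∨ Step X Y b a := by
  constructor
  · rintro (v | v)
    · by_cases h : IsSrc w w' v
      · exact .inl (.lower v h)
      · have := Step.lower (X := X) (Y := Y) (X.mate v) ((X.isSrc_mate v).2 h)
        rw [X.mate_mate] at this
        exact .inr this
    · by_cases h : IsSrc w' w'' v
      · exact .inl (.upper v h)
      · have := Step.upper (X := X) (Y := Y) (Y.mate v) ((Y.isSrc_mate v).2 h)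
        rw [Y.mate_mate] at this
        exact .inr this
  · rintro ((⟨v, h⟩ | ⟨v, h⟩) | (⟨v, h⟩ | ⟨v, h⟩))
    · exact .lower v
    · exact .upper v
    · have := StackEdge.lower (X := X) (Y := Y) (X.mate v)
      rwa [X.mate_mate] at this
    · have := StackEdge.upper (X := X) (Y := Y) (Y.mate v)
      rwa [Y.mate_mate] at this

theorem eqvGen_step (a b) : Relation.EqvGen (StackEdge X Y) a b ↔ Relation.EqvGen (Step X Y) a b := by
  constructor
  · intro h
    induction h with
    | rel x y h =>
      rcases (stackEdge_iff X Y x y).1 h with h | h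
      · exact .rel _ _ h
      · exact .symm _ _ (.rel _ _ h)
    | refl x => exact .refl _
    | symm x y _ ih => exact .symm _ _ ih
    | trans x y z _ _ h1 h2 => exact .trans _ _ _ h1 h2
  · intro h
    induction h with
    | rel x y h => exact .rel _ _ ((stackEdge_iff X Y x y).2 (.inl h))
    | refl x => exact .refl _
    | symm x y _ ih => exact .symm _ _ ih
    | trans x y z _ _ h1 h2 => exact .trans _ _ _ h1 h2

theorem eqvGen_step' (a b) :
    Relation.EqvGen (StackEdge X Y) a b ↔ Relation.EqvGen (fun a b => Step X Y b a) a b := by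
  rw [eqvGen_step]
  constructor <;>
  · intro h
    induction h with
    | rel x y h => exact .symm _ _ (.rel _ _ h)
    | refl x => exact .refl _
    | symm x y _ ih => exact .symm _ _ ih
    | trans x y z _ _ h1 h2 => exact .trans _ _ _ h1 h2

theorem step_inj (a b c) (h : Step X Y a c) (h' : Step X Y b c) : a = b := by
  generalize hc : c = c' at h'
  rcases h with ⟨v, hv⟩ | ⟨v, hv⟩ <;> rcases h' with ⟨u, hu⟩ | ⟨u, hu⟩
  · rw [X.mate_injective (lower_injective hc)]
  · have := lower_eq_upper hc
    rw [isSrc_mate, isSrc_mate] at this; tauto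
  · have := lower_eq_upper hc.symm
    rw [isSrc_mate, isSrc_mate] at this; tauto
  · rw [Y.mate_injective (upper_injective hc)]

theorem step_fun (a b c) (h : Step X Y c a) (h' : Step X Y c b) : a = b := by
  generalize hc : c = c' at h'
  rcases h with ⟨v, hv⟩ | ⟨v, hv⟩ <;> rcases h' with ⟨u, hu⟩ | ⟨u, hu⟩
  · rw [lower_injective hc]
  · have := lower_eq_upper hc; tauto
  · have := lower_eq_upper hc.symm; tauto
  · rw [upper_injective hc]

theorem not_step_src {v : DiagramVertex w w''} (hv : IsSrc w w'' v) (a) :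
    ¬ Step X Y a (outer v) := by
  intro h
  generalize hc : outer v = c' at h
  rcases h with ⟨u, hu⟩ | ⟨u, hu⟩
  · have := lower_eq_outer hc.symm
    rw [isSrc_mate] at this; tauto
  · have := upper_eq_outer hc.symm
    rw [isSrc_mate] at this; tauto

theorem not_step_tgt {v : DiagramVertex w w''} (hv : ¬ IsSrc w w'' v) (a) :
    ¬ Step X Y (outer v) a := by
  intro h
  generalize hc : outer v = c' at h
  rcases h with ⟨u, hu⟩ | ⟨u, hu⟩
  · have := lower_eq_outer hc.symm; tauto
  · have := upper_eq_outer hc.symm; tauto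

theorem exists_outer_of_tgt {t : StackVertex w w' w''} (ht : ∀ b, ¬ Step X Y t b) :
    ∃ u : DiagramVertex w w'', ¬ IsSrc w w'' u ∧ outer u = t := by
  rcases t with i | j | k
  · refine ⟨.inl i, fun h => ht _ (Step.lower (.inl i) ?_), rfl⟩
    exact (lower_eq_outer (w' := w') (w'' := w'') (v := .inl i) (u := .inl i) rfl).2 h
  · exfalso
    by_cases h : IsSrc w w' (.inr j)
    · exact ht _ (Step.lower (.inr j) h)
    · refine ht _ (Step.upper (.inl j) ?_)
      have := lower_eq_upper (w := w) (w'' := w'') (v := .inr j) (u := .inl j) rfl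
      tauto
  · refine ⟨.inr k, fun h => ht _ (Step.upper (.inr k) ?_), rfl⟩
    exact (upper_eq_outer (w := w) (w' := w') (v := .inr k) (u := .inr k) rfl).2 h

theorem exists_outer_of_src {t : StackVertex w w' w''} (ht : ∀ b, ¬ Step X Y b t) :
    ∃ u : DiagramVertex w w'', IsSrc w w'' u ∧ outer u = t := by
  have hl : ∀ v, ¬ IsSrc w w' v → lower v ≠ t := by
    rintro v hv rfl
    have := Step.lower (X := X) (Y := Y) (X.mate v) ((X.isSrc_mate v).2 hv)
    rw [X.mate_mate] at this
    exact ht _ this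
  have hu : ∀ v, ¬ IsSrc w' w'' v → upper v ≠ t := by
    rintro v hv rfl
    have := Step.upper (X := X) (Y := Y) (Y.mate v) ((Y.isSrc_mate v).2 hv)
    rw [Y.mate_mate] at this
    exact ht _ this
  rcases t with i | j | k
  · refine ⟨.inl i, ?_, rfl⟩
    by_contra h
    refine hl (.inl i) (fun h' => h ?_) rfl
    exact (lower_eq_outer (w' := w') (w'' := w'') (v := .inl i) (u := .inl i) rfl).1 h'
  · exfalso
    by_cases h : IsSrc w w' (.inr j)
    · refine hu (.inl j) ?_ rfl
      have := lower_eq_upper (w := w) (w'' := w'') (v := .inr j) (u := .inl j) rfl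
      tauto
    · exact hl (.inr j) h rfl
  · refine ⟨.inr k, ?_, rfl⟩
    by_contra h
    refine hu (.inr k) (fun h' => h ?_) rfl
    exact (upper_eq_outer (w := w) (w' := w') (v := .inr k) (u := .inr k) rfl).1 h'

/-- In the stacked graph each vertex `v` of the bottom or top row is connected to exactly one
other vertex of these two rows. -/
theorem exists_mate (v : DiagramVertex w w'') : ∃ u : DiagramVertex w w'',
    (IsSrc w w'' u ↔ ¬ IsSrc w w'' v) ∧
    ∀ u' : DiagramVertex w w'', Relation.EqvGen (StackEdge X Y) (outer v) (outer u') ↔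
      u' = v ∨ u' = u := by
  by_cases hv : IsSrc w w'' v
  · obtain ⟨t, h1, h2⟩ := exists_target (step_inj X Y) (not_step_src X Y hv)
    obtain ⟨u, hu, rfl⟩ := exists_outer_of_tgt X Y h2
    refine ⟨u, by tauto, fun u' => ⟨fun h => ?_, ?_⟩⟩
    · by_cases hu' : IsSrc w w'' u'
      · left
        exact (outer_injective (eqvGen_source_unique (step_inj X Y) (not_step_src X Y hv)
          (not_step_src X Y hu') ((eqvGen_step X Y _ _).1 h))).symm
      · right
        refine outer_injective (eqvGen_source_unique (R := fun a b => Step X Y b a)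
          (step_fun X Y) (not_step_tgt X Y hu') (not_step_tgt X Y hu)
          ((eqvGen_step' X Y _ _).1 ?_))
        exact .trans _ _ _ (.symm _ _ h) ((eqvGen_step X Y _ _).2 h1)
    · rintro (rfl | rfl)
      · exact .refl _
      · exact (eqvGen_step X Y _ _).2 h1
  · obtain ⟨t, h1, h2⟩ := exists_target (R := fun a b => Step X Y b a)
      (step_fun X Y) (not_step_tgt X Y hv)
    obtain ⟨u, hu, rfl⟩ := exists_outer_of_src X Y h2
    refine ⟨u, by tauto, fun u' => ⟨fun h => ?_, ?_⟩⟩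
    · by_cases hu' : IsSrc w w'' u'
      · right
        refine outer_injective (eqvGen_source_unique (step_inj X Y) (not_step_src X Y hu')
          (not_step_src X Y hu) ((eqvGen_step X Y _ _).1 ?_))
        exact .trans _ _ _ (.symm _ _ h) ((eqvGen_step' X Y _ _).2 h1)
      · left
        exact (outer_injective (eqvGen_source_unique (R := fun a b => Step X Y b a)
          (step_fun X Y) (not_step_tgt X Y hv) (not_step_tgt X Y hu')
          ((eqvGen_step' X Y _ _).1 h))).symm
    · rintro (rfl | rfl)
      · exact .refl _
      · exact (eqvGen_step' X Y _ _).2 h1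

/-- The diagram `Y · X` (first `X`, then `Y` atop): two vertices of the bottom and top rows are
joined if they are connected in the graph obtained by stacking `Y` atop `X`. -/
noncomputable def comp (X : WordDiagram w w') (Y : WordDiagram w' w'') : WordDiagram w w'' where
  mate v := (exists_mate X Y v).choose
  mate_mate v := by
    have hv := (exists_mate X Y v).choose_spec
    set u := (exists_mate X Y v).choose
    have hu := (exists_mate X Y u).choose_spec
    rcases (hu.2 v).1 (.symm _ _ ((hv.2 u).2 (.inr rfl))) with h | h
    · have := hv.1
      rw [← h] at this
      tauto
    · exact h.symm
  letter_iff v := letter_iff_of_isSrc _ _ (exists_mate X Y v).choose_spec.1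

theorem connected_outer_iff (v u : DiagramVertex w w'') :
    Relation.EqvGen (StackEdge X Y) (outer v) (outer u) ↔ u = v ∨ u = (comp X Y).mate v :=
  (exists_mate X Y v).choose_spec.2 u

/-! ### Matrices of diagrams, used to prove the axioms -/

/-- A labelling of both rows is compatible with a diagram if it is constant on edges. -/
def Compat (X : WordDiagram w w') (f : Fin w.length → Bool) (g : Fin w'.length → Bool) : Prop :=
  ∀ v, Sum.elim f g (X.mate v) = Sum.elim f g v

open scoped Classical in
/-- The zero-one matrix of compatible labellings. -/
noncomputable def mat (X : WordDiagram w w') :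
    Matrix (Fin w.length → Bool) (Fin w'.length → Bool) ℕ :=
  Matrix.of fun f g => if X.Compat f g then 1 else 0

theorem compat_stack {f : Fin w.length → Bool} {h : Fin w'.length → Bool}
    {k : Fin w''.length → Bool} (h1 : X.Compat f h) (h2 : Y.Compat h k)
    {a b : StackVertex w w' w''} (hab : Relation.EqvGen (StackEdge X Y) a b) :
    Sum.elim f (Sum.elim h k) a = Sum.elim f (Sum.elim h k) b := by
  have hl : ∀ v : DiagramVertex w w', Sum.elim f (Sum.elim h k) (lower v : StackVertex w w' w'') =
    Sum.elim f h v := by rintro (v | v) <;> rfl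
  have hu : ∀ v : DiagramVertex w' w'', Sum.elim f (Sum.elim h k) (upper v : StackVertex w w' w'') =
    Sum.elim h k v := by rintro (v | v) <;> rfl
  induction hab with
  | rel x y hxy =>
    rcases hxy with v | v
    · rw [hl, hl, h1 v]
    · rw [hu, hu, h2 v]
  | refl x => rfl
  | symm x y _ ih => exact ih.symm
  | trans x y z _ _ h1 h2 => exact h1.trans h2

theorem elim_outer (f : Fin w.length → Bool) (h : Fin w'.length → Bool)
    (k : Fin w''.length → Bool) (v : DiagramVertex w w'') :
    Sum.elim f (Sum.elim h k) (outer v : StackVertex w w' w'') = Sum.elim f k v := by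
  rcases v with v | v <;> rfl

theorem compat_comp {f : Fin w.length → Bool} {h : Fin w'.length → Bool}
    {k : Fin w''.length → Bool} (h1 : X.Compat f h) (h2 : Y.Compat h k) :
    (comp X Y).Compat f k := by
  intro v
  have := compat_stack X Y h1 h2 ((connected_outer_iff X Y v _).2 (.inr rfl))
  rw [elim_outer, elim_outer] at this
  exact this.symm

open scoped Classical in
theorem card_compat {f : Fin w.length → Bool} {k : Fin w''.length → Bool}
    (hc : (comp X Y).Compat f k) :
    Nat.card {h : Fin w'.length → Bool // X.Compat f h ∧ Y.Compat h k} = 2 ^ loops X Y := by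
  have hbool : Nat.card Bool = 2 := by simp
  rw [loops, ← hbool, ← Nat.card_fun]
  let Φ : {h : Fin w'.length → Bool // X.Compat f h ∧ Y.Compat h k} →
      ({c : StackComponent X Y // ∀ v : DiagramVertex w w'', Quotient.mk _ (outer v) ≠ c} → Bool) :=
    fun h c => Quotient.lift (Sum.elim f (Sum.elim h.1 k))
      (fun _ _ hab => compat_stack X Y h.2.1 h.2.2 hab) c.1
  refine Nat.card_congr (Equiv.ofBijective Φ ⟨?_, ?_⟩)
  · rintro ⟨h, h1, h2⟩ ⟨h', h1', h2'⟩ hΦ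
    ext j : 2
    by_cases hj : ∀ v : DiagramVertex w w'',
        (Quotient.mk _ (outer v) : StackComponent X Y) ≠ Quotient.mk _ (.inr (.inl j))
    · exact congrFun hΦ ⟨_, hj⟩
    · push Not at hj
      obtain ⟨v, hv⟩ := hj
      have hv' : Relation.EqvGen (StackEdge X Y) (outer v) (.inr (.inl j)) := Quotient.exact hv
      have e1 := compat_stack X Y h1 h2 hv'
      have e2 := compat_stack X Y h1' h2' hv'
      rw [elim_outer] at e1 e2
      exact e1.symm.trans e2
  · intro φ
    let L : StackComponent X Y → Bool := fun c =>
      if hc : ∃ v : DiagramVertex w w'', Quotient.mk _ (outer v) = c then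
        Sum.elim f k hc.choose else φ ⟨c, fun v hv => hc ⟨v, hv⟩⟩
    have hL : ∀ v : DiagramVertex w w'', L (Quotient.mk _ (outer v)) = Sum.elim f k v := by
      intro v
      have hex : ∃ u : DiagramVertex w w'',
        (Quotient.mk _ (outer u) : StackComponent X Y) = Quotient.mk _ (outer v) := ⟨v, rfl⟩
      have h1 : L (Quotient.mk _ (outer v)) = Sum.elim f k hex.choose := dif_pos hex
      rw [h1]
      have h2 := hex.choose_spec
      rcases (connected_outer_iff X Y _ _).1 (Quotient.exact h2) with h | h
      · rw [← h]
      · have := hc hex.choose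
        rw [← h] at this
        exact this.symm
    let h : Fin w'.length → Bool := fun j => L (Quotient.mk _ (.inr (.inl j)))
    have hall : ∀ a : StackVertex w w' w'', Sum.elim f (Sum.elim h k) a = L (Quotient.mk _ a) := by
      rintro (i | j | l)
      · exact (hL (.inl i)).symm
      · rfl
      · exact (hL (.inr l)).symm
    have hl : ∀ v : DiagramVertex w w', Sum.elim f h v = L (Quotient.mk _ (lower v)) := by
      rintro (v | v)
      · exact hall (.inl v)
      · rfl
    have hu : ∀ v : DiagramVertex w' w'', Sum.elim h k v = L (Quotient.mk _ (upper v)) := by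
      rintro (v | v)
      · rfl
      · exact hall (.inr (.inr v))
    refine ⟨⟨h, ?_, ?_⟩, ?_⟩
    · intro v
      rw [hl, hl]
      exact congrArg L (Quotient.sound (.symm _ _ (.rel _ _ (.lower v))))
    · intro v
      rw [hu, hu]
      exact congrArg L (Quotient.sound (.symm _ _ (.rel _ _ (.upper v))))
    · ext ⟨c, hc⟩
      induction c using Quotient.inductionOn with
      | h a =>
        have h1 : L (Quotient.mk _ a) = φ ⟨_, hc⟩ := dif_neg (fun ⟨v, hv⟩ => hc v hv)
        rw [← h1]
        exact hall a

theorem mat_mul : mat X * mat Y = 2 ^ loops X Y • mat (comp X Y) := by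
  classical
  ext f k
  rw [Matrix.mul_apply, Matrix.smul_apply]
  simp only [mat, Matrix.of_apply, ← ite_and, ite_mul, one_mul, zero_mul, smul_eq_mul]
  rw [Finset.sum_boole, ← Fintype.card_subtype, ← Nat.card_eq_fintype_card]
  split_ifs with hc
  · rw [mul_one, Nat.cast_id]
    exact card_compat X Y hc
  · rw [mul_zero, Nat.cast_id, Nat.card_eq_zero]
    left
    exact ⟨fun h => hc (compat_comp X Y h.2.1 h.2.2)⟩

end Stack

theorem mat_injective {X X' : WordDiagram w w'} {a b : ℕ} (h : 2 ^ a • mat X = 2 ^ b • mat X') :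
    X = X' ∧ a = b := by
  classical
  have hab : a = b := by
    have := congrFun (congrFun h (fun _ => true)) (fun _ => true)
    have hc : ∀ Z : WordDiagram w w', Z.Compat (fun _ => true) (fun _ => true) := by
      intro Z v
      have : ∀ u : DiagramVertex w w', Sum.elim (fun _ => true) (fun _ => true) u = true := by
        rintro (u | u) <;> rfl
      rw [this, this]
    simp only [mat, Matrix.smul_apply, Matrix.of_apply, hc, if_true, smul_eq_mul, mul_one] at this
    exact Nat.pow_right_injective le_rfl this
  refine ⟨?_, hab⟩
  subst hab
  ext1
  funext v
  let l : DiagramVertex w w' → Bool := fun u => decide (u = v ∨ u = X.mate v)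
  have hl : Sum.elim (l ∘ Sum.inl) (l ∘ Sum.inr) = l := by
    funext u; rcases u with u | u <;> rfl
  have hX : X.Compat (l ∘ Sum.inl) (l ∘ Sum.inr) := by
    intro u
    rw [hl]
    have h1 : X.mate u = v ↔ u = X.mate v :=
      ⟨fun h => by rw [← h, X.mate_mate], fun h => by rw [h, X.mate_mate]⟩
    have h2 : X.mate u = X.mate v ↔ u = v := X.mate_injective.eq_iff
    simp only [l, h1, h2]
    exact decide_eq_decide.2 or_comm
  have hX' : X'.Compat (l ∘ Sum.inl) (l ∘ Sum.inr) := by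
    have := congrFun (congrFun h (l ∘ Sum.inl)) (l ∘ Sum.inr)
    simp only [mat, Matrix.smul_apply, Matrix.of_apply, hX, if_true, smul_eq_mul, mul_one] at this
    by_contra hn
    rw [if_neg hn] at this
    simp at this
  have := hX' v
  rw [hl] at this
  have hv : l v = true := by simp [l]
  rw [hv] at this
  rcases of_decide_eq_true this with h | h
  · exact (X'.mate_ne v h).elim
  · exact h.symm

/-- Associativity of the composition of diagrams, together with the count of cycles. -/
theorem comp_assoc {w''' : Word} (X : WordDiagram w w') (Y : WordDiagram w' w'')
    (Z : WordDiagram w'' w''') :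
    comp (comp X Y) Z = comp X (comp Y Z) ∧
      loops X Y + loops (comp X Y) Z = loops Y Z + loops X (comp Y Z) := by
  apply mat_injective
  rw [pow_add, mul_smul, ← mat_mul, ← Matrix.smul_mul, ← mat_mul, pow_add, mul_smul, ← mat_mul,
    ← Matrix.mul_smul, ← mat_mul, Matrix.mul_assoc]

/-! ### Diagrams of letter-preserving bijections -/

/-- A bijection between the letters of two words that preserves their colours. -/
structure WordEquiv (w w' : Word) where
  toEquiv : Fin w.length ≃ Fin w'.length
  get_eq : ∀ i, w'.get (toEquiv i) = w.get i

/-- The diagram with only propagating edges, in which the letter `i` of the bottom row is adjacent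
to the letter `p i` of the top row. -/
def ofEquiv (p : WordEquiv w w') : WordDiagram w w' where
  mate := Sum.elim (fun i => .inr (p.toEquiv i)) (fun j => .inl (p.toEquiv.symm j))
  mate_mate := by rintro (v | v) <;> simp
  letter_iff := by
    rintro (v | v)
    · simpa [vertexLetter] using (p.get_eq v).symm
    · have := p.get_eq (p.toEquiv.symm v)
      rw [Equiv.apply_symm_apply] at this
      simpa [vertexLetter] using this

theorem compat_ofEquiv (p : WordEquiv w w') (f : Fin w.length → Bool) (g : Fin w'.length → Bool) :
    (ofEquiv p).Compat f g ↔ g ∘ p.toEquiv = f := by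
  constructor
  · intro h
    funext i
    exact h (.inl i)
  · rintro rfl
    rintro (v | v)
    · rfl
    · simp [ofEquiv]

theorem mat_mul_ofEquiv (X : WordDiagram w w') (p : WordEquiv w' w'') (f g) :
    (mat X * mat (ofEquiv p)) f g = mat X f (g ∘ p.toEquiv) := by
  classical
  rw [Matrix.mul_apply, Finset.sum_eq_single (g ∘ p.toEquiv)]
  · simp [mat, compat_ofEquiv]
  · intro b _ hb
    simp [mat, compat_ofEquiv, hb.symm]
  · simp

theorem ofEquiv_mul_mat (p : WordEquiv w w') (X : WordDiagram w' w'') (f g) :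
    (mat (ofEquiv p) * mat X) f g = mat X (f ∘ p.toEquiv.symm) g := by
  classical
  rw [Matrix.mul_apply, Finset.sum_eq_single (f ∘ p.toEquiv.symm)]
  · have : (f ∘ p.toEquiv.symm) ∘ p.toEquiv = f := by funext; simp
    simp [mat, compat_ofEquiv, this]
  · intro b _ hb
    have : b ∘ p.toEquiv ≠ f := by
      rintro rfl
      apply hb
      funext; simp
    simp [mat, compat_ofEquiv, this]
  · simp

theorem comp_ofEquiv_aux (Z : WordDiagram w w'') (Y : WordDiagram w w') (p : WordEquiv w' w'')
    (h : ∀ f g, mat Y f (g ∘ p.toEquiv) = mat Z f g) :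
    comp Y (ofEquiv p) = Z ∧ loops Y (ofEquiv p) = 0 := by
  apply mat_injective
  rw [← mat_mul, pow_zero, one_smul]
  ext f g
  rw [mat_mul_ofEquiv, h]

theorem ofEquiv_comp_aux (Z : WordDiagram w w'') (p : WordEquiv w w') (Y : WordDiagram w' w'')
    (h : ∀ f g, mat Y (f ∘ p.toEquiv.symm) g = mat Z f g) :
    comp (ofEquiv p) Y = Z ∧ loops (ofEquiv p) Y = 0 := by
  apply mat_injective
  rw [← mat_mul, pow_zero, one_smul]
  ext f g
  rw [ofEquiv_mul_mat, h]

theorem ofEquiv_comm_aux {w₁ w₂ w₁' w₂' : Word} (p : WordEquiv w₁ w₂) (q : WordEquiv w₁' w₂')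
    (Y : WordDiagram w₁ w₁') (Z : WordDiagram w₂ w₂')
    (h : ∀ f g, mat Y f (g ∘ q.toEquiv) = mat Z (f ∘ p.toEquiv.symm) g) :
    comp Y (ofEquiv q) = comp (ofEquiv p) Z ∧ loops Y (ofEquiv q) = loops (ofEquiv p) Z := by
  apply mat_injective
  rw [← mat_mul, ← mat_mul]
  ext f g
  rw [ofEquiv_mul_mat, mat_mul_ofEquiv, h]

/-- Every word is in bijection with an equal word. -/
def WordEquiv.ofEq (h : w = w') : WordEquiv w w' where
  toEquiv := finCongr (congrArg List.length h)
  get_eq i := by subst h; rfl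

def WordEquiv.trans (p : WordEquiv w w') (q : WordEquiv w' w'') : WordEquiv w w'' where
  toEquiv := p.toEquiv.trans q.toEquiv
  get_eq i := (q.get_eq _).trans (p.get_eq i)

theorem WordEquiv.ext' {p q : WordEquiv w w'} (h : ∀ i, (p.toEquiv i).val = (q.toEquiv i).val) :
    p = q := by
  rcases p with ⟨p, hp⟩
  rcases q with ⟨q, hq⟩
  have : p = q := Equiv.ext fun i => Fin.ext (h i)
  subst this
  rfl

/-- The identity diagram: each vertex of the bottom row is adjacent to the vertex above it. -/
def id (w : Word) : WordDiagram w w := ofEquiv (.ofEq rfl)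

theorem comp_id (X : WordDiagram w w') : comp X (id w') = X ∧ loops X (id w') = 0 :=
  comp_ofEquiv_aux X X _ fun _ _ => rfl

theorem id_comp (X : WordDiagram w w') : comp (id w) X = X ∧ loops (id w) X = 0 :=
  ofEquiv_comp_aux X _ X fun _ _ => rfl

theorem ofEquiv_comp_ofEquiv (p : WordEquiv w w') (q : WordEquiv w' w'') :
    comp (ofEquiv p) (ofEquiv q) = ofEquiv (p.trans q) ∧ loops (ofEquiv p) (ofEquiv q) = 0 := by
  refine ofEquiv_comp_aux _ _ _ fun f g => ?_
  have : g ∘ q.toEquiv = f ∘ p.toEquiv.symm ↔ g ∘ (p.trans q).toEquiv = f := by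
    rw [Equiv.eq_comp_symm]; rfl
  simp only [mat, Matrix.of_apply, compat_ofEquiv, this]

/-! ### Juxtaposition -/

/-- The letters of a concatenation are the letters of the first word followed by those of the
second. -/
def splitEquiv (w₁ w₂ : Word) : Fin w₁.length ⊕ Fin w₂.length ≃ Fin (w₁ ++ w₂).length :=
  finSumFinEquiv.trans (finCongr List.length_append.symm)

@[simp]
theorem splitEquiv_inl_val (i : Fin w₁.length) : (splitEquiv w₁ w₂ (.inl i)).val = i.val := by
  simp [splitEquiv]

@[simp]
theorem splitEquiv_inr_val (i : Fin w₂.length) :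
    (splitEquiv w₁ w₂ (.inr i)).val = w₁.length + i.val := by
  simp [splitEquiv]

theorem get_splitEquiv (x : Fin w₁.length ⊕ Fin w₂.length) :
    (w₁ ++ w₂).get (splitEquiv w₁ w₂ x) = Sum.elim (fun i => w₁.get i) (fun i => w₂.get i) x := by
  rcases x with i | i
  · simp [List.getElem_append_left]
  · simp [List.getElem_append_right]

/-- The vertices of two diagrams placed next to each other. -/
def vertexEquiv (w₁ w₁' w₂ w₂' : Word) :
    DiagramVertex w₁ w₁' ⊕ DiagramVertex w₂ w₂' ≃ DiagramVertex (w₁ ++ w₂) (w₁' ++ w₂') :=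
  (Equiv.sumSumSumComm _ _ _ _).trans
    (Equiv.sumCongr (splitEquiv w₁ w₂) (splitEquiv w₁' w₂'))

theorem vertexLetter_vertexEquiv (x : DiagramVertex w₁ w₁' ⊕ DiagramVertex w₂ w₂') :
    vertexLetter _ _ (vertexEquiv w₁ w₁' w₂ w₂' x) =
      Sum.elim (vertexLetter w₁ w₁') (vertexLetter w₂ w₂') x := by
  rcases x with (x | x) | (x | x)
  · exact get_splitEquiv (w₁ := w₁) (w₂ := w₂) (.inl x)
  · exact get_splitEquiv (w₁ := w₁') (w₂ := w₂') (.inl x)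
  · exact get_splitEquiv (w₁ := w₁) (w₂ := w₂) (.inr x)
  · exact get_splitEquiv (w₁ := w₁') (w₂ := w₂') (.inr x)

theorem isLeft_vertexEquiv (x : DiagramVertex w₁ w₁' ⊕ DiagramVertex w₂ w₂') :
    (vertexEquiv w₁ w₁' w₂ w₂' x).isLeft = Sum.elim Sum.isLeft Sum.isLeft x := by
  rcases x with (x | x) | (x | x) <;> rfl

/-- The diagram obtained by placing `X₁` directly to the left of `X₂`. -/
def tensor (X₁ : WordDiagram w₁ w₁') (X₂ : WordDiagram w₂ w₂') :
    WordDiagram (w₁ ++ w₂) (w₁' ++ w₂') where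
  mate v := vertexEquiv w₁ w₁' w₂ w₂'
    (Sum.map X₁.mate X₂.mate ((vertexEquiv w₁ w₁' w₂ w₂').symm v))
  mate_mate v := by
    obtain ⟨x, rfl⟩ := (vertexEquiv w₁ w₁' w₂ w₂').surjective v
    rcases x with x | x <;> simp [mate_mate]
  letter_iff v := by
    obtain ⟨x, rfl⟩ := (vertexEquiv w₁ w₁' w₂ w₂').surjective v
    rw [Equiv.symm_apply_apply, vertexLetter_vertexEquiv, vertexLetter_vertexEquiv,
      isLeft_vertexEquiv, isLeft_vertexEquiv]
    rcases x with x | x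
    · exact X₁.letter_iff x
    · exact X₂.letter_iff x

theorem compat_tensor (X₁ : WordDiagram w₁ w₁') (X₂ : WordDiagram w₂ w₂')
    (f : Fin (w₁ ++ w₂).length → Bool) (g : Fin (w₁' ++ w₂').length → Bool) :
    (tensor X₁ X₂).Compat f g ↔
      X₁.Compat (fun i => f (splitEquiv w₁ w₂ (.inl i)))
        (fun i => g (splitEquiv w₁' w₂' (.inl i))) ∧
      X₂.Compat (fun i => f (splitEquiv w₁ w₂ (.inr i)))
        (fun i => g (splitEquiv w₁' w₂' (.inr i))) := by
  have hl : ∀ x : DiagramVertex w₁ w₁', Sum.elim f g (vertexEquiv w₁ w₁' w₂ w₂' (.inl x)) =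
      Sum.elim (fun i => f (splitEquiv w₁ w₂ (.inl i)))
        (fun i => g (splitEquiv w₁' w₂' (.inl i))) x := by rintro (x | x) <;> rfl
  have hr : ∀ x : DiagramVertex w₂ w₂', Sum.elim f g (vertexEquiv w₁ w₁' w₂ w₂' (.inr x)) =
      Sum.elim (fun i => f (splitEquiv w₁ w₂ (.inr i)))
        (fun i => g (splitEquiv w₁' w₂' (.inr i))) x := by rintro (x | x) <;> rfl
  constructor
  · intro h
    constructor
    · intro v
      have := h (vertexEquiv w₁ w₁' w₂ w₂' (.inl v))
      simp only [tensor, Equiv.symm_apply_apply, Sum.map_inl] at this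
      rw [hl, hl] at this
      exact this
    · intro v
      have := h (vertexEquiv w₁ w₁' w₂ w₂' (.inr v))
      simp only [tensor, Equiv.symm_apply_apply, Sum.map_inr] at this
      rw [hr, hr] at this
      exact this
  · rintro ⟨h1, h2⟩ v
    obtain ⟨x, rfl⟩ := (vertexEquiv w₁ w₁' w₂ w₂').surjective v
    simp only [tensor, Equiv.symm_apply_apply]
    rcases x with x | x
    · rw [Sum.map_inl, hl, hl]; exact h1 x
    · rw [Sum.map_inr, hr, hr]; exact h2 x

theorem mat_tensor (X₁ : WordDiagram w₁ w₁') (X₂ : WordDiagram w₂ w₂') (f g) :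
    mat (tensor X₁ X₂) f g =
      mat X₁ (fun i => f (splitEquiv w₁ w₂ (.inl i))) (fun i => g (splitEquiv w₁' w₂' (.inl i))) *
      mat X₂ (fun i => f (splitEquiv w₁ w₂ (.inr i))) (fun i => g (splitEquiv w₁' w₂' (.inr i))) := by
  classical
  simp only [mat, Matrix.of_apply]
  rw [if_congr (compat_tensor X₁ X₂ f g) rfl rfl, ite_and]
  split_ifs <;> rfl

/-- Labellings of a concatenation are pairs of labellings. -/
def labelEquiv (w₁ w₂ : Word) :
    (Fin w₁.length → Bool) × (Fin w₂.length → Bool) ≃ (Fin (w₁ ++ w₂).length → Bool) :=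
  (Equiv.sumArrowEquivProdArrow _ _ _).symm.trans
    (Equiv.arrowCongr (splitEquiv w₁ w₂) (Equiv.refl _))

theorem tensor_comp_tensor {w₁'' w₂'' : Word} (X₁ : WordDiagram w₁ w₁') (X₂ : WordDiagram w₂ w₂')
    (Y₁ : WordDiagram w₁' w₁'') (Y₂ : WordDiagram w₂' w₂'') :
    comp (tensor X₁ X₂) (tensor Y₁ Y₂) = tensor (comp X₁ Y₁) (comp X₂ Y₂) ∧
      loops (tensor X₁ X₂) (tensor Y₁ Y₂) = loops X₁ Y₁ + loops X₂ Y₂ := by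
  apply mat_injective
  rw [← mat_mul]
  ext f g
  rw [Matrix.mul_apply, Matrix.smul_apply, mat_tensor]
  have h1 := congrFun (congrFun (mat_mul X₁ Y₁) (fun i => f (splitEquiv w₁ w₂ (.inl i))))
    (fun i => g (splitEquiv w₁'' w₂'' (.inl i)))
  have h2 := congrFun (congrFun (mat_mul X₂ Y₂) (fun i => f (splitEquiv w₁ w₂ (.inr i))))
    (fun i => g (splitEquiv w₁'' w₂'' (.inr i)))
  rw [Matrix.mul_apply, Matrix.smul_apply, smul_eq_mul] at h1 h2
  rw [smul_eq_mul, pow_add, mul_mul_mul_comm, ← h1, ← h2, Finset.sum_mul_sum,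
    ← Finset.sum_product', Finset.univ_product_univ, ← (labelEquiv w₁' w₂').sum_comp]
  refine Finset.sum_congr rfl fun x _ => ?_
  have hx1 : (fun i => labelEquiv w₁' w₂' x (splitEquiv w₁' w₂' (.inl i))) = x.1 := by
    funext i
    simp [labelEquiv, Equiv.sumArrowEquivProdArrow]
  have hx2 : (fun i => labelEquiv w₁' w₂' x (splitEquiv w₁' w₂' (.inr i))) = x.2 := by
    funext i
    simp [labelEquiv, Equiv.sumArrowEquivProdArrow]
  rw [mat_tensor, mat_tensor, hx1, hx2, mul_mul_mul_comm]

/-- Bijections placed next to each other. -/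
def WordEquiv.append (p : WordEquiv w₁ w₁') (q : WordEquiv w₂ w₂') :
    WordEquiv (w₁ ++ w₂) (w₁' ++ w₂') where
  toEquiv := (splitEquiv w₁ w₂).symm.trans
    ((Equiv.sumCongr p.toEquiv q.toEquiv).trans (splitEquiv w₁' w₂'))
  get_eq i := by
    obtain ⟨x, rfl⟩ := (splitEquiv w₁ w₂).surjective i
    simp only [Equiv.trans_apply, Equiv.symm_apply_apply]
    rw [get_splitEquiv, get_splitEquiv]
    rcases x with x | x
    · exact p.get_eq x
    · exact q.get_eq x

theorem tensor_ofEquiv (p : WordEquiv w₁ w₁') (q : WordEquiv w₂ w₂') :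
    tensor (ofEquiv p) (ofEquiv q) = ofEquiv (p.append q) := by
  ext1
  funext v
  obtain ⟨x, rfl⟩ := (vertexEquiv w₁ w₁' w₂ w₂').surjective v
  rcases x with (x | x) | (x | x) <;>
    simp [tensor, ofEquiv, vertexEquiv, WordEquiv.append]

/-- The bijection from the letters of `w₁w₂` to those of `w₂w₁` that matches the `i`-th letter of
`w₁` (of `w₂`) with the `i`-th letter of `w₁` (of `w₂`). -/
def WordEquiv.swap (w₁ w₂ : Word) : WordEquiv (w₁ ++ w₂) (w₂ ++ w₁) where
  toEquiv := (splitEquiv w₁ w₂).symm.trans ((Equiv.sumComm _ _).trans (splitEquiv w₂ w₁))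
  get_eq i := by
    obtain ⟨x, rfl⟩ := (splitEquiv w₁ w₂).surjective i
    simp only [Equiv.trans_apply, Equiv.symm_apply_apply]
    rw [get_splitEquiv, get_splitEquiv]
    rcases x with x | x <;> rfl

theorem WordEquiv.swap_val (i) : ((WordEquiv.swap w₁ w₂).toEquiv i).val =
    if i.val < w₁.length then w₂.length + i.val else i.val - w₁.length := by
  obtain ⟨x, rfl⟩ := (splitEquiv w₁ w₂).surjective i
  rcases x with x | x <;> simp [WordEquiv.swap]

theorem WordEquiv.ofEq_val (h : w = w') (i) : ((WordEquiv.ofEq h).toEquiv i).val = i.val := rfl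

theorem WordEquiv.append_ofEq_val (p : WordEquiv w₁ w₁') (i) :
    ((p.append (.ofEq (rfl : w₂ = w₂))).toEquiv i).val =
      if h : i.val < w₁.length then (p.toEquiv ⟨i.val, h⟩).val
        else w₁'.length + (i.val - w₁.length) := by
  obtain ⟨x, rfl⟩ := (splitEquiv w₁ w₂).surjective i
  rcases x with x | x <;> simp [WordEquiv.append, WordEquiv.ofEq]

theorem WordEquiv.ofEq_append_val (p : WordEquiv w₁ w₁') (i) :
    (((WordEquiv.ofEq (rfl : w₂ = w₂)).append p).toEquiv i).val =
      if h : w₂.length ≤ i.val then w₂.length + (p.toEquiv ⟨i.val - w₂.length, by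
        have := i.isLt.trans_eq List.length_append; omega⟩).val else i.val := by
  obtain ⟨x, rfl⟩ := (splitEquiv w₂ w₁).surjective i
  rcases x with x | x
  · simp [WordEquiv.append, WordEquiv.ofEq]
  · simp [WordEquiv.append, WordEquiv.ofEq]

theorem WordEquiv.hexagon₁ (w₁ w₂ w₃ : Word) :
    (WordEquiv.ofEq (List.append_assoc w₁ w₂ w₃)).trans ((WordEquiv.swap w₁ (w₂ ++ w₃)).trans
      (.ofEq (List.append_assoc w₂ w₃ w₁))) =
    ((WordEquiv.swap w₁ w₂).append (.ofEq rfl)).trans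
      ((WordEquiv.ofEq (List.append_assoc w₂ w₁ w₃)).trans
        ((WordEquiv.ofEq rfl).append (WordEquiv.swap w₁ w₃))) := by
  apply WordEquiv.ext'
  intro i
  have hi := i.isLt
  simp only [WordEquiv.trans, Equiv.trans_apply, WordEquiv.ofEq_val, WordEquiv.swap_val,
    WordEquiv.ofEq_append_val, WordEquiv.append_ofEq_val, List.length_append] at hi ⊢
  split_ifs <;> omega

theorem WordEquiv.hexagon₂ (w₁ w₂ w₃ : Word) :
    (WordEquiv.ofEq (List.append_assoc w₁ w₂ w₃).symm).trans ((WordEquiv.swap (w₁ ++ w₂) w₃).trans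
      (.ofEq (List.append_assoc w₃ w₁ w₂).symm)) =
    ((WordEquiv.ofEq rfl).append (WordEquiv.swap w₂ w₃)).trans
      ((WordEquiv.ofEq (List.append_assoc w₁ w₃ w₂).symm).trans
        ((WordEquiv.swap w₁ w₃).append (.ofEq rfl))) := by
  apply WordEquiv.ext'
  intro i
  have hi := i.isLt
  simp only [WordEquiv.trans, Equiv.trans_apply, WordEquiv.ofEq_val, WordEquiv.swap_val,
    WordEquiv.ofEq_append_val, WordEquiv.append_ofEq_val, List.length_append] at hi ⊢
  split_ifs <;> omega

theorem tensor_swap (X₁ : WordDiagram w₁ w₁') (X₂ : WordDiagram w₂ w₂') :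
    comp (tensor X₁ X₂) (ofEquiv (.swap w₁' w₂')) = comp (ofEquiv (.swap w₁ w₂)) (tensor X₂ X₁) ∧
    loops (tensor X₁ X₂) (ofEquiv (.swap w₁' w₂')) =
      loops (ofEquiv (.swap w₁ w₂)) (tensor X₂ X₁) := by
  refine ofEquiv_comm_aux _ _ _ _ fun f g => ?_
  rw [mat_tensor, mat_tensor, mul_comm]
  congr 2 <;> funext i <;> simp [WordEquiv.swap]

theorem tensor_assoc (X₁ : WordDiagram w₁ w₁') (X₂ : WordDiagram w₂ w₂')
    (X₃ : WordDiagram w₃ w₃') :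
    comp (tensor (tensor X₁ X₂) X₃) (ofEquiv (.ofEq (List.append_assoc w₁' w₂' w₃'))) =
      comp (ofEquiv (.ofEq (List.append_assoc w₁ w₂ w₃))) (tensor X₁ (tensor X₂ X₃)) ∧
    loops (tensor (tensor X₁ X₂) X₃) (ofEquiv (.ofEq (List.append_assoc w₁' w₂' w₃'))) =
      loops (ofEquiv (.ofEq (List.append_assoc w₁ w₂ w₃))) (tensor X₁ (tensor X₂ X₃)) := by
  refine ofEquiv_comm_aux _ _ _ _ fun f g => ?_
  rw [mat_tensor, mat_tensor, mat_tensor, mat_tensor, mul_assoc]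
  congr 2
  all_goals try congr 1
  all_goals
    funext i
    simp only [Function.comp]
    congr 1
    apply Fin.ext
    simp [WordEquiv.ofEq, add_assoc]

theorem nil_tensor (X : WordDiagram w w') :
    comp (tensor (id []) X) (ofEquiv (.ofEq (List.nil_append w'))) =
      comp (ofEquiv (.ofEq (List.nil_append w))) X ∧
    loops (tensor (id []) X) (ofEquiv (.ofEq (List.nil_append w'))) =
      loops (ofEquiv (.ofEq (List.nil_append w))) X := by
  refine ofEquiv_comm_aux _ _ _ _ fun f g => ?_
  have h : ∀ a b, mat (id []) a b = 1 := by
    intro a b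
    have : (id []).Compat a b := (compat_ofEquiv _ _ _).2 (funext fun i => i.elim0)
    simp [mat, this]
  rw [mat_tensor, h, one_mul]
  congr 1 <;> funext i <;> simp only [Function.comp] <;> congr 1 <;>
      apply Fin.ext <;> simp [WordEquiv.ofEq, splitEquiv]

theorem tensor_nil (X : WordDiagram w w') :
    comp (tensor X (id [])) (ofEquiv (.ofEq (List.append_nil w'))) =
      comp (ofEquiv (.ofEq (List.append_nil w))) X ∧
    loops (tensor X (id [])) (ofEquiv (.ofEq (List.append_nil w'))) =
      loops (ofEquiv (.ofEq (List.append_nil w))) X := by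
  refine ofEquiv_comm_aux _ _ _ _ fun f g => ?_
  have h : ∀ a b, mat (id []) a b = 1 := by
    intro a b
    have : (id []).Compat a b := (compat_ofEquiv _ _ _).2 (funext fun i => i.elim0)
    simp [mat, this]
  rw [mat_tensor, h, mul_one]
  rfl

end WordDiagram

/-! ### The skeleton category -/

/-- The objects of the skeleton category `Rep₀(GL_δ)`: finite words in `•` and `∘`. -/
structure SkeletonCat {K : Type u} (δ : K) : Type where
  word : Word

namespace SkeletonCat

open WordDiagram

section Hom

variable {K : Type u} [Field K]

/-- The vector space with basis the `(w, w')`-diagrams. -/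
abbrev DiagramSpace (K : Type u) [Field K] (w w' : Word) : Type u := WordDiagram w w' →₀ K

variable {w w' w'' w₁ w₂ w₁' w₂' : Word}

/-- Bilinear extension of a product of basis diagrams that takes values in scalar multiples of
basis diagrams. -/
noncomputable def bilin {A B C : Type*} (op : A → B → C) (c : A → B → K)
    (f : A →₀ K) (g : B →₀ K) : C →₀ K :=
  f.sum fun X a => g.sum fun Y b => Finsupp.single (op X Y) (a * b * c X Y)

section bilin

variable {A B C : Type*} (op : A → B → C) (c : A → B → K)

@[simp]
theorem bilin_single (X : A) (Y : B) (a b : K) :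
    bilin op c (.single X a) (.single Y b) = .single (op X Y) (a * b * c X Y) := by
  rw [bilin, Finsupp.sum_single_index, Finsupp.sum_single_index] <;> simp

@[simp]
theorem bilin_zero_left (g : B →₀ K) : bilin op c 0 g = 0 := by simp [bilin]

@[simp]
theorem bilin_zero_right (f : A →₀ K) : bilin op c f 0 = 0 := by simp [bilin]

@[simp]
theorem bilin_add_left (f f' : A →₀ K) (g : B →₀ K) :
    bilin op c (f + f') g = bilin op c f g + bilin op c f' g := by
  classical
  rw [bilin, Finsupp.sum_add_index']
  · rfl
  · simp
  · intro X a b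
    rw [← Finsupp.sum_add]
    refine Finsupp.sum_congr fun Y _ => ?_
    rw [← Finsupp.single_add]; congr 1; ring

@[simp]
theorem bilin_add_right (f : A →₀ K) (g g' : B →₀ K) :
    bilin op c f (g + g') = bilin op c f g + bilin op c f g' := by
  classical
  simp only [bilin]
  rw [← Finsupp.sum_add]
  refine Finsupp.sum_congr fun X _ => ?_
  rw [Finsupp.sum_add_index']
  · simp
  · intro Y b b'
    rw [← Finsupp.single_add]; congr 1; ring

@[simp]
theorem bilin_smul_left (r : K) (f : A →₀ K) (g : B →₀ K) :
    bilin op c (r • f) g = r • bilin op c f g := by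
  induction f using Finsupp.induction_linear with
  | zero => simp
  | add f f' h h' => rw [smul_add, bilin_add_left, h, h', bilin_add_left, smul_add]
  | single X a =>
    induction g using Finsupp.induction_linear with
    | zero => simp
    | add g g' h h' => rw [bilin_add_right, h, h', bilin_add_right, smul_add]
    | single Y b =>
      rw [Finsupp.smul_single, bilin_single, bilin_single, Finsupp.smul_single]
      congr 1; simp only [smul_eq_mul]; ring

@[simp]
theorem bilin_smul_right (r : K) (f : A →₀ K) (g : B →₀ K) :
    bilin op c f (r • g) = r • bilin op c f g := by
  induction f using Finsupp.induction_linear with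
  | zero => simp
  | add f f' h h' => rw [bilin_add_left, h, h', bilin_add_left, smul_add]
  | single X a =>
    induction g using Finsupp.induction_linear with
    | zero => simp
    | add g g' h h' => rw [smul_add, bilin_add_right, h, h', bilin_add_right, smul_add]
    | single Y b =>
      rw [Finsupp.smul_single, bilin_single, bilin_single, Finsupp.smul_single]
      congr 1; simp only [smul_eq_mul]; ring

end bilin

end Hom

variable {K : Type u} [Field K] {δ : K}

/-- Morphisms are linear combinations of diagrams; the composite of the diagrams `X` and `Y` is
`δ ^ ℓ` times `Y · X`, where `ℓ` is the number of cycles of the graph obtained by stacking. -/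
noncomputable instance : Category.{u} (SkeletonCat δ) where
  Hom a b := DiagramSpace K a.word b.word
  id a := Finsupp.single (WordDiagram.id a.word) 1
  comp f g := bilin WordDiagram.comp (fun X Y => δ ^ loops X Y) f g
  id_comp f := by
    induction f using Finsupp.induction_linear with
    | zero => simp
    | add f g hf hg => rw [bilin_add_right, hf, hg]
    | single X a => simp [(id_comp X).1, (id_comp X).2]
  comp_id f := by
    induction f using Finsupp.induction_linear with
    | zero => simp
    | add f g hf hg => rw [bilin_add_left, hf, hg]
    | single X a => simp [(comp_id X).1, (comp_id X).2]
  assoc f g h := by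
    induction f using Finsupp.induction_linear with
    | zero => simp
    | add f f' hf hf' => simp only [bilin_add_left, hf, hf']
    | single X a =>
      induction g using Finsupp.induction_linear with
      | zero => simp
      | add g g' hg hg' => simp only [bilin_add_left, bilin_add_right, hg, hg']
      | single Y b =>
        induction h using Finsupp.induction_linear with
        | zero => simp
        | add h h' hh hh' => simp only [bilin_add_right, hh, hh']
        | single Z c =>
          obtain ⟨h1, h2⟩ := WordDiagram.comp_assoc X Y Z
          simp only [bilin_single, h1]
          congr 1
          calc a * b * δ ^ loops X Y * c * δ ^ loops (comp X Y) Z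
              = a * b * c * δ ^ (loops X Y + loops (comp X Y) Z) := by rw [pow_add]; ring
            _ = _ := by rw [h2, pow_add]; ring

noncomputable instance : Preadditive (SkeletonCat δ) where
  homGroup a b := inferInstanceAs (AddCommGroup (DiagramSpace K a.word b.word))
  add_comp _ _ _ f f' g := bilin_add_left _ _ f f' g
  comp_add _ _ _ f g g' := bilin_add_right _ _ f g g'

noncomputable instance : Linear K (SkeletonCat δ) where
  homModule a b := inferInstanceAs (Module K (DiagramSpace K a.word b.word))
  smul_comp _ _ _ r f g := bilin_smul_left _ _ r f g
  comp_smul _ _ _ f r g := bilin_smul_right _ _ r f g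

/-- A diagram as a morphism of the skeleton category. -/
noncomputable def ofDiagram {a b : SkeletonCat δ} (X : WordDiagram a.word b.word) : a ⟶ b :=
  Finsupp.single X (1 : K)

@[elab_as_elim]
theorem hom_induction {a b : SkeletonCat δ} {P : (a ⟶ b) → Prop}
    (h0 : P 0) (hadd : ∀ f g, P f → P g → P (f + g))
    (hX : ∀ (r : K) (X : WordDiagram a.word b.word), P (r • ofDiagram X)) (f : a ⟶ b) : P f := by
  refine Finsupp.induction_linear (motive := P) f h0 hadd fun X r => ?_
  have := hX r X
  have h2 : r • (ofDiagram X : a ⟶ b) = Finsupp.single X r := by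
    change r • Finsupp.single X (1 : K) = _
    rw [Finsupp.smul_single, smul_eq_mul, mul_one]
  rw [h2] at this
  exact this

theorem ofDiagram_comp {a b c : SkeletonCat δ} (X : WordDiagram a.word b.word)
    (Y : WordDiagram b.word c.word) :
    (ofDiagram X : a ⟶ b) ≫ (ofDiagram Y : b ⟶ c) =
      δ ^ loops X Y • ofDiagram (WordDiagram.comp X Y) := by
  change bilin _ _ (Finsupp.single X (1 : K)) (Finsupp.single Y (1 : K)) =
    δ ^ loops X Y • Finsupp.single _ (1 : K)
  rw [bilin_single, Finsupp.smul_single]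
  simp

theorem ofDiagram_id (a : SkeletonCat δ) : ofDiagram (WordDiagram.id a.word) = 𝟙 a := rfl

theorem eqToHom_eq {a b : SkeletonCat δ} (h : a = b) :
    eqToHom h = ofDiagram (ofEquiv (.ofEq (congrArg word h))) := by
  subst h; rfl

/-- Juxtaposition of diagrams, extended bilinearly. -/
noncomputable def tensorHom' {a b a' b' : SkeletonCat δ} (f : a ⟶ b) (g : a' ⟶ b') :
    (⟨a.word ++ a'.word⟩ : SkeletonCat δ) ⟶ ⟨b.word ++ b'.word⟩ :=
  bilin (K := K) WordDiagram.tensor (fun _ _ => 1) f g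

/-- The tensor product of words is concatenation, that of diagrams is juxtaposition; the
associativity and unit constraints are identities. -/
noncomputable instance : MonoidalCategoryStruct (SkeletonCat δ) where
  tensorObj a b := ⟨a.word ++ b.word⟩
  tensorUnit := ⟨[]⟩
  tensorHom f g := tensorHom' f g
  whiskerLeft a _ _ f := tensorHom' (𝟙 a) f
  whiskerRight f b := tensorHom' f (𝟙 b)
  associator a b c := eqToIso (congrArg mk (List.append_assoc a.word b.word c.word))
  leftUnitor a := eqToIso (congrArg mk (List.nil_append a.word))
  rightUnitor a := eqToIso (congrArg mk (List.append_nil a.word))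

theorem associator_hom_eq (a b c : SkeletonCat δ) :
    (α_ a b c).hom = eqToHom (congrArg mk (List.append_assoc a.word b.word c.word)) := rfl

theorem leftUnitor_hom_eq (a : SkeletonCat δ) :
    (λ_ a).hom = eqToHom (congrArg mk (List.nil_append a.word)) := rfl

theorem rightUnitor_hom_eq (a : SkeletonCat δ) :
    (ρ_ a).hom = eqToHom (congrArg mk (List.append_nil a.word)) := rfl

section tensor

variable {a b c d e k : SkeletonCat δ}

theorem zero_tensor (g : c ⟶ d) : (0 : a ⟶ b) ⊗ₘ g = 0 := bilin_zero_left (A := WordDiagram a.word b.word) WordDiagram.tensor (fun _ _ => 1) g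
theorem tensor_zero (f : a ⟶ b) : f ⊗ₘ (0 : c ⟶ d) = 0 := bilin_zero_right (B := WordDiagram c.word d.word) WordDiagram.tensor (fun _ _ => 1) f
theorem add_tensor (f f' : a ⟶ b) (g : c ⟶ d) : (f + f') ⊗ₘ g = f ⊗ₘ g + f' ⊗ₘ g :=
  bilin_add_left _ _ f f' g
theorem tensor_add (f : a ⟶ b) (g g' : c ⟶ d) : f ⊗ₘ (g + g') = f ⊗ₘ g + f ⊗ₘ g' :=
  bilin_add_right _ _ f g g'
theorem smul_tensor (r : K) (f : a ⟶ b) (g : c ⟶ d) : (r • f) ⊗ₘ g = r • (f ⊗ₘ g) :=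
  bilin_smul_left _ _ r f g
theorem tensor_smul (r : K) (f : a ⟶ b) (g : c ⟶ d) : f ⊗ₘ (r • g) = r • (f ⊗ₘ g) :=
  bilin_smul_right _ _ r f g

theorem ofDiagram_tensor (X : WordDiagram a.word b.word) (Y : WordDiagram c.word d.word) :
    (ofDiagram X : a ⟶ b) ⊗ₘ (ofDiagram Y : c ⟶ d) =
      (ofDiagram (WordDiagram.tensor X Y) : a ⊗ c ⟶ b ⊗ d) := by
  change bilin _ _ (Finsupp.single X (1 : K)) (Finsupp.single Y (1 : K)) = Finsupp.single _ (1 : K)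
  rw [bilin_single]
  simp

theorem tensor_comp' {a' c' : SkeletonCat δ} (f : a ⟶ b) (g : c ⟶ d) (f' : b ⟶ a') (g' : d ⟶ c') :
    (f ⊗ₘ g) ≫ (f' ⊗ₘ g') = (f ≫ f') ⊗ₘ (g ≫ g') := by
  refine hom_induction ?_ (fun f₁ f₂ h₁ h₂ => ?_) (fun r X => ?_) f
  · simp only [zero_tensor, Limits.zero_comp, Limits.comp_zero]
  · simp only [add_tensor, Preadditive.add_comp, h₁, h₂]
  refine hom_induction ?_ (fun f₁ f₂ h₁ h₂ => ?_) (fun r' X' => ?_) f'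
  · simp only [zero_tensor, Limits.zero_comp, Limits.comp_zero]
  · simp only [add_tensor, Preadditive.comp_add, h₁, h₂]
  refine hom_induction ?_ (fun f₁ f₂ h₁ h₂ => ?_) (fun s Y => ?_) g
  · simp only [tensor_zero, Limits.zero_comp, Limits.comp_zero]
  · simp only [tensor_add, Preadditive.add_comp, h₁, h₂]
  refine hom_induction ?_ (fun f₁ f₂ h₁ h₂ => ?_) (fun s' Y' => ?_) g'
  · simp only [tensor_zero, Limits.zero_comp, Limits.comp_zero]
  · simp only [tensor_add, Preadditive.comp_add, h₁, h₂]
  obtain ⟨h1, h2⟩ := WordDiagram.tensor_comp_tensor X Y X' Y'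
  simp only [smul_tensor, tensor_smul, Linear.smul_comp, Linear.comp_smul, ofDiagram_comp,
    ofDiagram_tensor]
  rw [h1, h2]
  simp only [smul_smul]
  congr 1
  rw [pow_add]
  ring

theorem id_tensor_id (a b : SkeletonCat δ) : 𝟙 a ⊗ₘ 𝟙 b = 𝟙 (a ⊗ b) := by
  rw [← ofDiagram_id, ← ofDiagram_id, ofDiagram_tensor, ← ofDiagram_id]
  unfold WordDiagram.id
  rw [tensor_ofEquiv]
  congr 2
  apply WordEquiv.ext'
  intro i
  obtain ⟨x, rfl⟩ := (splitEquiv a.word b.word).surjective i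
  rcases x with x | x <;> simp [WordEquiv.append, WordEquiv.ofEq] <;> rfl

theorem tensor_assoc' {a' b' c' : SkeletonCat δ} (f : a ⟶ a') (g : b ⟶ b') (h : c ⟶ c') :
    ((f ⊗ₘ g) ⊗ₘ h) ≫ (α_ a' b' c').hom = (α_ a b c).hom ≫ (f ⊗ₘ (g ⊗ₘ h)) := by
  refine hom_induction ?_ (fun f₁ f₂ h₁ h₂ => ?_) (fun r X => ?_) f
  · simp only [zero_tensor, Limits.zero_comp, Limits.comp_zero]
  · simp only [add_tensor, Preadditive.add_comp, Preadditive.comp_add, h₁, h₂]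
  refine hom_induction ?_ (fun f₁ f₂ h₁ h₂ => ?_) (fun s Y => ?_) g
  · simp only [zero_tensor, tensor_zero, Limits.zero_comp, Limits.comp_zero]
  · simp only [add_tensor, tensor_add, Preadditive.add_comp, Preadditive.comp_add, h₁, h₂]
  refine hom_induction ?_ (fun f₁ f₂ h₁ h₂ => ?_) (fun t Z => ?_) h
  · simp only [tensor_zero, Limits.zero_comp, Limits.comp_zero]
  · simp only [tensor_add, Preadditive.add_comp, Preadditive.comp_add, h₁, h₂]
  simp only [smul_tensor, tensor_smul, Linear.smul_comp, Linear.comp_smul, ofDiagram_tensor]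
  congr 3
  obtain ⟨h1, h2⟩ := WordDiagram.tensor_assoc X Y Z
  rw [associator_hom_eq, associator_hom_eq, eqToHom_eq, eqToHom_eq]
  refine (ofDiagram_comp (a := (a ⊗ b) ⊗ c) (b := (a' ⊗ b') ⊗ c') (c := a' ⊗ (b' ⊗ c')) _ _).trans
    (Eq.trans ?_ (ofDiagram_comp (a := (a ⊗ b) ⊗ c) (b := a ⊗ (b ⊗ c))
      (c := a' ⊗ (b' ⊗ c')) _ _).symm)
  exact congrArg₂ (fun (n : ℕ) x => δ ^ n • (ofDiagram x : (a ⊗ b) ⊗ c ⟶ a' ⊗ (b' ⊗ c'))) h2 h1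

theorem left_unit_nat (f : a ⟶ b) :
    (𝟙 (𝟙_ (SkeletonCat δ)) ⊗ₘ f) ≫ (λ_ b).hom = (λ_ a).hom ≫ f := by
  refine hom_induction ?_ (fun f₁ f₂ h₁ h₂ => ?_) (fun r X => ?_) f
  · simp only [tensor_zero, Limits.zero_comp, Limits.comp_zero]
  · simp only [tensor_add, Preadditive.add_comp, Preadditive.comp_add, h₁, h₂]
  rw [← ofDiagram_id]
  simp only [tensor_smul, Linear.smul_comp, Linear.comp_smul, ofDiagram_tensor]
  congr 1
  obtain ⟨h1, h2⟩ := WordDiagram.nil_tensor X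
  rw [leftUnitor_hom_eq, leftUnitor_hom_eq, eqToHom_eq, eqToHom_eq]
  refine (ofDiagram_comp (a := 𝟙_ _ ⊗ a) (b := 𝟙_ _ ⊗ b) (c := b) _ _).trans
    (Eq.trans ?_ (ofDiagram_comp (a := 𝟙_ _ ⊗ a) (b := a) (c := b) _ _).symm)
  exact congrArg₂ (fun (n : ℕ) x => δ ^ n • (ofDiagram x : 𝟙_ _ ⊗ a ⟶ b)) h2 h1

theorem right_unit_nat (f : a ⟶ b) :
    (f ⊗ₘ 𝟙 (𝟙_ (SkeletonCat δ))) ≫ (ρ_ b).hom = (ρ_ a).hom ≫ f := by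
  refine hom_induction ?_ (fun f₁ f₂ h₁ h₂ => ?_) (fun r X => ?_) f
  · simp only [zero_tensor, Limits.zero_comp, Limits.comp_zero]
  · simp only [add_tensor, Preadditive.add_comp, Preadditive.comp_add, h₁, h₂]
  rw [← ofDiagram_id]
  simp only [smul_tensor, Linear.smul_comp, Linear.comp_smul, ofDiagram_tensor]
  congr 1
  obtain ⟨h1, h2⟩ := WordDiagram.tensor_nil X
  rw [rightUnitor_hom_eq, rightUnitor_hom_eq, eqToHom_eq, eqToHom_eq]
  refine (ofDiagram_comp (a := a ⊗ 𝟙_ _) (b := b ⊗ 𝟙_ _) (c := b) _ _).trans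
    (Eq.trans ?_ (ofDiagram_comp (a := a ⊗ 𝟙_ _) (b := a) (c := b) _ _).symm)
  exact congrArg₂ (fun (n : ℕ) x => δ ^ n • (ofDiagram x : a ⊗ 𝟙_ _ ⟶ b)) h2 h1

theorem eqToHom_tensor_id (h : a = b) (c : SkeletonCat δ) :
    eqToHom h ⊗ₘ 𝟙 c = eqToHom (by rw [h] : a ⊗ c = b ⊗ c) := by
  subst h; exact id_tensor_id _ _

theorem id_tensor_eqToHom (h : a = b) (c : SkeletonCat δ) :
    𝟙 c ⊗ₘ eqToHom h = eqToHom (by rw [h] : c ⊗ a = c ⊗ b) := by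
  subst h; exact id_tensor_id _ _

end tensor

noncomputable instance : MonoidalCategory (SkeletonCat δ) :=
  MonoidalCategory.ofTensorHom
    (id_tensorHom_id := id_tensor_id)
    (id_tensorHom := fun _ _ _ _ => rfl)
    (tensorHom_id := fun _ _ => rfl)
    (tensorHom_comp_tensorHom := tensor_comp')
    (associator_naturality := tensor_assoc')
    (leftUnitor_naturality := left_unit_nat)
    (rightUnitor_naturality := right_unit_nat)
    (pentagon := fun W X Y Z => by
      simp only [associator_hom_eq]
      erw [eqToHom_tensor_id, id_tensor_eqToHom, eqToHom_trans, eqToHom_trans, eqToHom_trans])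
    (triangle := fun X Y => by
      simp only [associator_hom_eq, leftUnitor_hom_eq, rightUnitor_hom_eq]
      exact (congrArg (_ ≫ ·) (id_tensor_eqToHom _ _)).trans
        ((eqToHom_trans _ _).trans (eqToHom_tensor_id _ _).symm))

section braiding

variable {a b c d e k : SkeletonCat δ}

/-- The braiding `c_{w₁, w₂}` as a morphism. -/
noncomputable def swapHom (a b : SkeletonCat δ) : a ⊗ b ⟶ b ⊗ a :=
  ofDiagram (ofEquiv (.swap a.word b.word))

theorem ofEquiv_comp_hom {a b c : SkeletonCat δ} (p : WordEquiv a.word b.word)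
    (q : WordEquiv b.word c.word) :
    (ofDiagram (ofEquiv p) : a ⟶ b) ≫ (ofDiagram (ofEquiv q) : b ⟶ c) =
      ofDiagram (ofEquiv (p.trans q)) := by
  rw [ofDiagram_comp, (ofEquiv_comp_ofEquiv p q).1, (ofEquiv_comp_ofEquiv p q).2, pow_zero,
    one_smul]

theorem ofEquiv_comp₃ {a b c d b' c' : SkeletonCat δ} {p : WordEquiv a.word b.word}
    {q : WordEquiv b.word c.word} {r : WordEquiv c.word d.word} {p' : WordEquiv a.word b'.word}
    {q' : WordEquiv b'.word c'.word} {r' : WordEquiv c'.word d.word}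
    (h : p.trans (q.trans r) = p'.trans (q'.trans r')) :
    (ofDiagram (ofEquiv p) : a ⟶ b) ≫ (ofDiagram (ofEquiv q) : b ⟶ c) ≫
      (ofDiagram (ofEquiv r) : c ⟶ d) =
    (ofDiagram (ofEquiv p') : a ⟶ b') ≫ (ofDiagram (ofEquiv q') : b' ⟶ c') ≫
      (ofDiagram (ofEquiv r') : c' ⟶ d) := by
  rw [ofEquiv_comp_hom, ofEquiv_comp_hom, ofEquiv_comp_hom, ofEquiv_comp_hom, h]

theorem swap_swap (a b : SkeletonCat δ) : swapHom a b ≫ swapHom b a = 𝟙 _ := by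
  rw [swapHom, swapHom, ofEquiv_comp_hom, ← ofDiagram_id]
  unfold WordDiagram.id
  congr 2
  apply WordEquiv.ext'
  intro i
  simp [WordEquiv.trans, WordEquiv.swap, WordEquiv.ofEq]

theorem swap_nat (f : a ⟶ b) (g : c ⟶ d) :
    (f ⊗ₘ g) ≫ swapHom b d = swapHom a c ≫ (g ⊗ₘ f) := by
  refine hom_induction ?_ (fun f₁ f₂ h₁ h₂ => ?_) (fun r X => ?_) f
  · simp only [zero_tensor, tensor_zero, Limits.zero_comp, Limits.comp_zero]
  · simp only [add_tensor, tensor_add, Preadditive.add_comp, Preadditive.comp_add, h₁, h₂]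
  refine hom_induction ?_ (fun f₁ f₂ h₁ h₂ => ?_) (fun s Y => ?_) g
  · simp only [zero_tensor, tensor_zero, Limits.zero_comp, Limits.comp_zero]
  · simp only [add_tensor, tensor_add, Preadditive.add_comp, Preadditive.comp_add, h₁, h₂]
  simp only [smul_tensor, tensor_smul, Linear.smul_comp, Linear.comp_smul, ofDiagram_tensor]
  rw [smul_comm]
  congr 2
  obtain ⟨h1, h2⟩ := WordDiagram.tensor_swap X Y
  refine (ofDiagram_comp (a := a ⊗ c) (b := b ⊗ d) (c := d ⊗ b) _ _).trans
    (Eq.trans ?_ (ofDiagram_comp (a := a ⊗ c) (b := c ⊗ a) (c := d ⊗ b) _ _).symm)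
  exact congrArg₂ (fun (n : ℕ) x => δ ^ n • (ofDiagram x : a ⊗ c ⟶ d ⊗ b)) h2 h1

theorem swapHom_tensor_id (a b c : SkeletonCat δ) : swapHom a b ⊗ₘ 𝟙 c =
    (ofDiagram (ofEquiv ((WordEquiv.swap a.word b.word).append (.ofEq rfl))) :
      (a ⊗ b) ⊗ c ⟶ (b ⊗ a) ⊗ c) := by
  rw [← tensor_ofEquiv, ← ofDiagram_id]
  exact ofDiagram_tensor _ _

theorem id_tensor_swapHom (a b c : SkeletonCat δ) : 𝟙 c ⊗ₘ swapHom a b =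
    (ofDiagram (ofEquiv (WordEquiv.append (.ofEq rfl) (WordEquiv.swap a.word b.word))) :
      c ⊗ (a ⊗ b) ⟶ c ⊗ (b ⊗ a)) := by
  rw [← tensor_ofEquiv, ← ofDiagram_id]
  exact ofDiagram_tensor _ _

theorem associator_eq (a b c : SkeletonCat δ) :
    (α_ a b c).hom = (ofDiagram (ofEquiv (.ofEq (List.append_assoc a.word b.word c.word))) :
      (a ⊗ b) ⊗ c ⟶ a ⊗ (b ⊗ c)) :=
  eqToHom_eq (congrArg mk (List.append_assoc a.word b.word c.word))

theorem associator_inv_eq (a b c : SkeletonCat δ) :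
    (α_ a b c).inv = (ofDiagram (ofEquiv (.ofEq (List.append_assoc a.word b.word c.word).symm)) :
      a ⊗ (b ⊗ c) ⟶ (a ⊗ b) ⊗ c) :=
  eqToHom_eq (congrArg mk (List.append_assoc a.word b.word c.word).symm)

theorem hexagon₁ (a b c : SkeletonCat δ) :
    (α_ a b c).hom ≫ swapHom a (b ⊗ c) ≫ (α_ b c a).hom =
      (swapHom a b ⊗ₘ 𝟙 c) ≫ (α_ b a c).hom ≫ (𝟙 b ⊗ₘ swapHom a c) := by
  rw [associator_eq, associator_eq, associator_eq, swapHom_tensor_id, id_tensor_swapHom]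
  exact ofEquiv_comp₃ (a := (a ⊗ b) ⊗ c) (b := a ⊗ (b ⊗ c)) (c := (b ⊗ c) ⊗ a)
    (d := b ⊗ (c ⊗ a)) (b' := (b ⊗ a) ⊗ c) (c' := b ⊗ (a ⊗ c)) (WordEquiv.hexagon₁ _ _ _)

theorem hexagon₂ (a b c : SkeletonCat δ) :
    (α_ a b c).inv ≫ swapHom (a ⊗ b) c ≫ (α_ c a b).inv =
      (𝟙 a ⊗ₘ swapHom b c) ≫ (α_ a c b).inv ≫ (swapHom a c ⊗ₘ 𝟙 b) := by
  rw [associator_inv_eq, associator_inv_eq, associator_inv_eq, swapHom_tensor_id,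
    id_tensor_swapHom]
  exact ofEquiv_comp₃ (a := a ⊗ (b ⊗ c)) (b := (a ⊗ b) ⊗ c) (c := c ⊗ (a ⊗ b))
    (d := (c ⊗ a) ⊗ b) (b' := a ⊗ (c ⊗ b)) (c' := (a ⊗ c) ⊗ b) (WordEquiv.hexagon₂ _ _ _)

end braiding

/-- The symmetric braiding matches the `i`-th letter of `w₁` (of `w₂`) in the bottom row with
the `i`-th letter of `w₁` (of `w₂`) in the top row. -/
noncomputable instance : SymmetricCategory (SkeletonCat δ) where
  braiding a b := ⟨swapHom a b, swapHom b a, swap_swap a b, swap_swap b a⟩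
  braiding_naturality_right a _ _ f := swap_nat (𝟙 a) f
  braiding_naturality_left f c := swap_nat f (𝟙 c)
  hexagon_forward a b c := hexagon₁ a b c
  hexagon_reverse a b c := hexagon₂ a b c
  symmetry a b := swap_swap a b

end SkeletonCat

/-! ### The additive envelope as a symmetric monoidal category -/

section AdditiveEnvelope

open CategoryTheory.Limits

namespace MatMonoidal

section Relabel

variable {C : Type u₁} [Category.{v₁} C] [Preadditive C]

open scoped Classical in
/-- The matrix whose only nonzero entries are the `φ i`, in position `(i, e i)`. -/
noncomputable def relabel {M N : Mat_ C} (e : M.ι → N.ι) (φ : ∀ i, M.X i ⟶ N.X (e i)) : M ⟶ N :=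
  fun i j => if h : e i = j then φ i ≫ eqToHom (congrArg N.X h) else 0

/-- The only nonzero entries of `f` are the `φ i`, in position `(i, e i)`. -/
def IsRelabel {M N : Mat_ C} (e : M.ι → N.ι) (φ : ∀ i, M.X i ⟶ N.X (e i)) (f : M ⟶ N) : Prop :=
  (∀ i, f i (e i) = φ i) ∧ ∀ i j, e i ≠ j → f i j = 0

theorem isRelabel {M N : Mat_ C} (e : M.ι → N.ι) (φ : ∀ i, M.X i ⟶ N.X (e i)) :
    IsRelabel e φ (relabel e φ) :=
  ⟨fun i => by simp [relabel], fun i j h => by simp [relabel, h]⟩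

theorem isRelabel_id (M : Mat_ C) : IsRelabel (fun i => i) (fun i => 𝟙 (M.X i)) (𝟙 M) :=
  ⟨fun i => Mat_.id_apply_self M i, fun i j h => Mat_.id_apply_of_ne M i j h⟩

theorem IsRelabel.left {L M N : Mat_ C} {e : L.ι → M.ι} {φ : ∀ i, L.X i ⟶ M.X (e i)} {f : L ⟶ M}
    (hf : IsRelabel e φ f) (g : M ⟶ N) (i : L.ι) (k : N.ι) : (f ≫ g) i k = φ i ≫ g (e i) k := by
  classical
  rw [Mat_.comp_apply, Finset.sum_eq_single (e i)]
  · rw [hf.1]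
  · intro b _ hb
    rw [hf.2 _ _ hb.symm, zero_comp]
  · simp

theorem IsRelabel.right {L M N : Mat_ C} {e : M.ι → N.ι} {φ : ∀ i, M.X i ⟶ N.X (e i)} {g : M ⟶ N}
    (hg : IsRelabel e φ g) (he : Function.Injective e) (f : L ⟶ M) (i : L.ι) (j : M.ι) :
    (f ≫ g) i (e j) = f i j ≫ φ j := by
  classical
  rw [Mat_.comp_apply, Finset.sum_eq_single j]
  · rw [hg.1]
  · intro b _ hb
    rw [hg.2 _ _ (fun h => hb (he h)), comp_zero]
  · simp

theorem IsRelabel.comp {L M N : Mat_ C} {e : L.ι → M.ι} {φ : ∀ i, L.X i ⟶ M.X (e i)} {f : L ⟶ M}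
    {e' : M.ι → N.ι} {φ' : ∀ i, M.X i ⟶ N.X (e' i)} {g : M ⟶ N}
    (hf : IsRelabel e φ f) (hg : IsRelabel e' φ' g) :
    IsRelabel (N := N) (fun i => e' (e i)) (fun i => φ i ≫ φ' (e i)) (f ≫ g) :=
  ⟨fun i => by rw [hf.left, hg.1], fun i k h => by rw [hf.left, hg.2 _ _ h, comp_zero]⟩

theorem IsRelabel.unique {M N : Mat_ C} {e : M.ι → N.ι} {φ φ' : ∀ i, M.X i ⟶ N.X (e i)}
    {f g : M ⟶ N} (hf : IsRelabel e φ f) (hg : IsRelabel e φ' g) (h : ∀ i, φ i = φ' i) : f = g := by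
  ext i j
  by_cases hj : e i = j
  · subst hj; rw [hf.1, hg.1, h]
  · rw [hf.2 _ _ hj, hg.2 _ _ hj]

/-- Naturality of a family of reindexings. -/
theorem IsRelabel.natural {L M L' M' : Mat_ C} {e : L.ι → M.ι} {φ : ∀ i, L.X i ⟶ M.X (e i)}
    {f : L ⟶ M} {e' : L'.ι → M'.ι} {φ' : ∀ i, L'.X i ⟶ M'.X (e' i)} {f' : L' ⟶ M'}
    (hf : IsRelabel e φ f) (hf' : IsRelabel e' φ' f') (he' : Function.Bijective e')
    (g : L ⟶ L') (g' : M ⟶ M') (h : ∀ i j, g i j ≫ φ' j = φ i ≫ g' (e i) (e' j)) :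
    g ≫ f' = f ≫ g' := by
  ext i k
  obtain ⟨j, rfl⟩ := he'.2 k
  rw [hf.left, hf'.right he'.1, h]

/-- Reindexing along isomorphisms. -/
noncomputable def relabelIso {M N : Mat_ C} (e : M.ι → N.ι) (e' : N.ι → M.ι)
    (φ : ∀ i, M.X i ⟶ N.X (e i)) (φ' : ∀ j, N.X j ⟶ M.X (e' j))
    (h₁ : IsRelabel (fun i => i) (fun i => 𝟙 (M.X i)) (relabel e φ ≫ relabel e' φ'))
    (h₂ : IsRelabel (fun i => i) (fun i => 𝟙 (N.X i)) (relabel e' φ' ≫ relabel e φ)) : M ≅ N where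
  hom := relabel e φ
  inv := relabel e' φ'
  hom_inv_id := h₁.unique (isRelabel_id M) fun _ => rfl
  inv_hom_id := h₂.unique (isRelabel_id N) fun _ => rfl

theorem IsRelabel.congr {M N : Mat_ C} {e : M.ι → N.ι} {φ φ' : ∀ i, M.X i ⟶ N.X (e i)}
    {f : M ⟶ N} (hf : IsRelabel e φ f) (h : ∀ i, φ i = φ' i) : IsRelabel e φ' f :=
  ⟨fun i => (hf.1 i).trans (h i), hf.2⟩

end Relabel

section Structure

variable {C : Type u₁} [Category.{v₁} C] [Preadditive C] [MonoidalCategory C]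

/-- The tensor product of two tuples is the tuple of all tensor products, that of two matrices is
the Kronecker product. -/
noncomputable instance : MonoidalCategoryStruct (Mat_ C) where
  tensorObj M N := ⟨M.ι × N.ι, fun p => M.X p.1 ⊗ N.X p.2⟩
  tensorUnit := ⟨PUnit, fun _ => 𝟙_ C⟩
  tensorHom f g := fun p q => f p.1 q.1 ⊗ₘ g p.2 q.2
  whiskerLeft M _ _ f := fun p q => (𝟙 M : M ⟶ M) p.1 q.1 ⊗ₘ f p.2 q.2
  whiskerRight f N := fun p q => f p.1 q.1 ⊗ₘ (𝟙 N : N ⟶ N) p.2 q.2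
  associator L M N := relabelIso (fun p => ⟨p.1.1, p.1.2, p.2⟩) (fun p => ⟨⟨p.1, p.2.1⟩, p.2.2⟩)
    (fun p => (α_ (L.X p.1.1) (M.X p.1.2) (N.X p.2)).hom)
    (fun p => (α_ (L.X p.1) (M.X p.2.1) (N.X p.2.2)).inv)
    (((isRelabel _ _).comp (isRelabel _ _)).congr fun _ => Iso.hom_inv_id _)
    (((isRelabel _ _).comp (isRelabel _ _)).congr fun _ => Iso.inv_hom_id _)
  leftUnitor M := relabelIso (fun p => p.2) (fun i => ⟨PUnit.unit, i⟩)
    (fun p => (λ_ (M.X p.2)).hom) (fun i => (λ_ (M.X i)).inv)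
    (((isRelabel _ _).comp (isRelabel _ _)).congr fun _ => Iso.hom_inv_id _)
    (((isRelabel _ _).comp (isRelabel _ _)).congr fun _ => Iso.inv_hom_id _)
  rightUnitor M := relabelIso (fun p => p.1) (fun i => ⟨i, PUnit.unit⟩)
    (fun p => (ρ_ (M.X p.1)).hom) (fun i => (ρ_ (M.X i)).inv)
    (((isRelabel _ _).comp (isRelabel _ _)).congr fun _ => Iso.hom_inv_id _)
    (((isRelabel _ _).comp (isRelabel _ _)).congr fun _ => Iso.inv_hom_id _)

theorem isRelabel_associator (L M N : Mat_ C) : IsRelabel (M := (L ⊗ M) ⊗ N) (N := L ⊗ (M ⊗ N))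
    (fun p => ⟨p.1.1, p.1.2, p.2⟩)
    (fun p => (α_ (L.X p.1.1) (M.X p.1.2) (N.X p.2)).hom) (α_ L M N).hom :=
  isRelabel (M := (L ⊗ M) ⊗ N) (N := L ⊗ (M ⊗ N)) _ _

theorem isRelabel_associator_inv (L M N : Mat_ C) :
    IsRelabel (M := L ⊗ (M ⊗ N)) (N := (L ⊗ M) ⊗ N)
    (fun p => ⟨⟨p.1, p.2.1⟩, p.2.2⟩)
    (fun p => (α_ (L.X p.1) (M.X p.2.1) (N.X p.2.2)).inv) (α_ L M N).inv :=
  isRelabel (M := L ⊗ (M ⊗ N)) (N := (L ⊗ M) ⊗ N) _ _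

theorem isRelabel_leftUnitor (M : Mat_ C) : IsRelabel (M := 𝟙_ _ ⊗ M) (N := M)
    (fun p => p.2) (fun p => (λ_ (M.X p.2)).hom) (λ_ M).hom :=
  isRelabel (M := 𝟙_ _ ⊗ M) (N := M) _ _

theorem isRelabel_rightUnitor (M : Mat_ C) : IsRelabel (M := M ⊗ 𝟙_ _) (N := M)
    (fun p => p.1) (fun p => (ρ_ (M.X p.1)).hom) (ρ_ M).hom :=
  isRelabel (M := M ⊗ 𝟙_ _) (N := M) _ _

end Structure

section Monoidal

variable {C : Type u₁} [Category.{v₁} C] [Preadditive C] [MonoidalCategory C]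
  [MonoidalPreadditive C]

theorem IsRelabel.tensor {M N M' N' : Mat_ C} {e : M.ι → N.ι} {φ : ∀ i, M.X i ⟶ N.X (e i)}
    {f : M ⟶ N} {e' : M'.ι → N'.ι} {φ' : ∀ i, M'.X i ⟶ N'.X (e' i)} {f' : M' ⟶ N'}
    (hf : IsRelabel e φ f) (hf' : IsRelabel e' φ' f') :
    IsRelabel (M := M ⊗ M') (N := N ⊗ N') (fun p => ⟨e p.1, e' p.2⟩)
      (fun p => φ p.1 ⊗ₘ φ' p.2) (f ⊗ₘ f') := by
  refine ⟨fun i => congrArg₂ (fun a b => a ⊗ₘ b) (hf.1 i.1) (hf'.1 i.2), fun i j h => ?_⟩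
  by_cases h₁ : e i.1 = j.1
  · have h₂ : e' i.2 ≠ j.2 := fun h₂ => h (Prod.ext h₁ h₂)
    exact (congrArg (fun a => f i.1 j.1 ⊗ₘ a) (hf'.2 _ _ h₂)).trans
      (MonoidalPreadditive.tensor_zero _)
  · exact (congrArg (fun a => a ⊗ₘ f' i.2 j.2) (hf.2 _ _ h₁)).trans
      (MonoidalPreadditive.zero_tensor _)

theorem tensor_comp' {L M N L' M' N' : Mat_ C} (f : L ⟶ M) (f' : L' ⟶ M') (g : M ⟶ N)
    (g' : M' ⟶ N') : (f ⊗ₘ f') ≫ (g ⊗ₘ g') = (f ≫ g) ⊗ₘ (f' ≫ g') := by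
  ext i k
  refine (Fintype.sum_prod_type _).trans ?_
  refine Eq.trans ?_ (sum_tensor _ _ _).symm
  refine Finset.sum_congr rfl fun j _ => ?_
  refine Eq.trans ?_ (tensor_sum _ _ _).symm
  exact Finset.sum_congr rfl fun j' _ => MonoidalCategory.tensorHom_comp_tensorHom _ _ _ _

noncomputable instance : MonoidalCategory (Mat_ C) :=
  MonoidalCategory.ofTensorHom
    (id_tensorHom_id := fun M N =>
      ((isRelabel_id M).tensor (isRelabel_id N)).unique (isRelabel_id (M ⊗ N))
        fun _ => id_tensorHom_id _ _)
    (id_tensorHom := fun _ _ _ _ => rfl)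
    (tensorHom_id := fun _ _ => rfl)
    (tensorHom_comp_tensorHom := tensor_comp')
    (associator_naturality := fun {X₁ X₂ X₃ Y₁ Y₂ Y₃} f g h =>
      (isRelabel_associator X₁ X₂ X₃).natural (isRelabel_associator Y₁ Y₂ Y₃)
        (Equiv.prodAssoc Y₁.ι Y₂.ι Y₃.ι).bijective _ _
        fun i j => associator_naturality _ _ _)
    (leftUnitor_naturality := fun {X Y} f =>
      (isRelabel_leftUnitor X).natural (isRelabel_leftUnitor Y)
        (Equiv.punitProd Y.ι).bijective _ _ fun i j =>
          (congrArg (fun a => (a ⊗ₘ f i.2 j.2) ≫ (λ_ (Y.X j.2)).hom)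
            (Mat_.id_apply_self (𝟙_ (Mat_ C)) i.1)).trans
          ((congrArg (fun a => a ≫ (λ_ (Y.X j.2)).hom) (id_tensorHom _ _)).trans
            (leftUnitor_naturality _)))
    (rightUnitor_naturality := fun {X Y} f =>
      (isRelabel_rightUnitor X).natural (isRelabel_rightUnitor Y)
        (Equiv.prodPUnit Y.ι).bijective _ _ fun i j =>
          (congrArg (fun a => (f i.1 j.1 ⊗ₘ a) ≫ (ρ_ (Y.X j.1)).hom)
            (Mat_.id_apply_self (𝟙_ (Mat_ C)) i.2)).trans
          ((congrArg (fun a => a ≫ (ρ_ (Y.X j.1)).hom) (tensorHom_id _ _)).trans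
            (rightUnitor_naturality _)))
    (pentagon := fun W X Y Z =>
      (((isRelabel_associator W X Y).tensor (isRelabel_id Z)).comp
        ((isRelabel_associator W (X ⊗ Y) Z).comp
          ((isRelabel_id W).tensor (isRelabel_associator X Y Z)))).unique
        ((isRelabel_associator (W ⊗ X) Y Z).comp (isRelabel_associator W X (Y ⊗ Z)))
        fun i => by
          have := MonoidalCategory.pentagon (W.X i.1.1.1) (X.X i.1.1.2) (Y.X i.1.2) (Z.X i.2)
          rw [← id_tensorHom, ← tensorHom_id] at this
          exact this)
    (triangle := fun X Y =>
      ((isRelabel_associator X (𝟙_ _) Y).comp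
        ((isRelabel_id X).tensor (isRelabel_leftUnitor Y))).unique
        ((isRelabel_rightUnitor X).tensor (isRelabel_id Y))
        fun i => by
          have := MonoidalCategory.triangle (X.X i.1.1) (Y.X i.2)
          rw [← id_tensorHom, ← tensorHom_id] at this
          exact this)

instance : MonoidalPreadditive (Mat_ C) where
  whiskerLeft_zero := by
    intros; ext i j; exact MonoidalPreadditive.tensor_zero _
  zero_whiskerRight := by
    intros; ext i j; exact MonoidalPreadditive.zero_tensor _
  whiskerLeft_add := by
    intros; ext i j; exact MonoidalPreadditive.tensor_add _ _ _
  add_whiskerRight := by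
    intros; ext i j; exact MonoidalPreadditive.add_tensor _ _ _

end Monoidal

section Symmetric

variable {C : Type u₁} [Category.{v₁} C] [Preadditive C] [MonoidalCategory C]
  [MonoidalPreadditive C] [SymmetricCategory C]

/-- The symmetric braiding, entry by entry. -/
noncomputable def braidIso (M N : Mat_ C) : M ⊗ N ≅ N ⊗ M :=
  relabelIso (M := M ⊗ N) (N := N ⊗ M) (fun p => ⟨p.2, p.1⟩) (fun p => ⟨p.2, p.1⟩)
    (fun p => (β_ (M.X p.1) (N.X p.2)).hom) (fun p => (β_ (N.X p.1) (M.X p.2)).hom)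
    (((isRelabel (M := M ⊗ N) (N := N ⊗ M) _ _).comp (isRelabel (M := N ⊗ M) (N := M ⊗ N) _ _)).congr
      fun _ => SymmetricCategory.symmetry _ _)
    (((isRelabel (M := N ⊗ M) (N := M ⊗ N) _ _).comp (isRelabel (M := M ⊗ N) (N := N ⊗ M) _ _)).congr
      fun _ => SymmetricCategory.symmetry _ _)

theorem isRelabel_braid (M N : Mat_ C) : IsRelabel (M := M ⊗ N) (N := N ⊗ M)
    (fun p => ⟨p.2, p.1⟩) (fun p => (β_ (M.X p.1) (N.X p.2)).hom) (braidIso M N).hom :=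
  isRelabel (M := M ⊗ N) (N := N ⊗ M) _ _

theorem braid_nat {M N M' N' : Mat_ C} (f : M ⟶ N) (g : M' ⟶ N') :
    (f ⊗ₘ g) ≫ (braidIso N N').hom = (braidIso M M').hom ≫ (g ⊗ₘ f) :=
  (isRelabel_braid M M').natural (isRelabel_braid N N') (Equiv.prodComm N.ι N'.ι).bijective _ _
    fun _ _ => BraidedCategory.braiding_naturality _ _

noncomputable instance : SymmetricCategory (Mat_ C) where
  braiding M N := braidIso M N
  braiding_naturality_right M _ _ f := braid_nat (𝟙 M) f
  braiding_naturality_left f N := braid_nat f (𝟙 N)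
  hexagon_forward X Y Z :=
    ((isRelabel_associator X Y Z).comp ((isRelabel_braid X (Y ⊗ Z)).comp
      (isRelabel_associator Y Z X))).unique
      (((isRelabel_braid X Y).tensor (isRelabel_id Z)).comp ((isRelabel_associator Y X Z).comp
        ((isRelabel_id Y).tensor (isRelabel_braid X Z))))
      fun i => by
        have := BraidedCategory.hexagon_forward (X.X i.1.1) (Y.X i.1.2) (Z.X i.2)
        rw [← id_tensorHom, ← tensorHom_id] at this
        exact this
  hexagon_reverse X Y Z :=
    ((isRelabel_associator_inv X Y Z).comp ((isRelabel_braid (X ⊗ Y) Z).comp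
      (isRelabel_associator_inv Z X Y))).unique
      (((isRelabel_id X).tensor (isRelabel_braid Y Z)).comp ((isRelabel_associator_inv X Z Y).comp
        ((isRelabel_braid X Z).tensor (isRelabel_id Y))))
      fun i => by
        have := BraidedCategory.hexagon_reverse (X.X i.1) (Y.X i.2.1) (Z.X i.2.2)
        rw [← id_tensorHom, ← tensorHom_id] at this
        exact this
  symmetry M N :=
    ((isRelabel_braid M N).comp (isRelabel_braid N M)).unique (isRelabel_id (M ⊗ N))
      fun _ => SymmetricCategory.symmetry _ _

end Symmetric

section Embedding

variable {C : Type u₁} [Category.{v₁} C] [Preadditive C] [MonoidalCategory C]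
  [MonoidalPreadditive C]

/-- The identification `(X) ⊗ (Y) ≅ (X ⊗ Y)` of one-term tuples. -/
noncomputable def embeddingμ (X Y : C) :
    (Mat_.embedding C).obj X ⊗ (Mat_.embedding C).obj Y ≅ (Mat_.embedding C).obj (X ⊗ Y) :=
  relabelIso (M := (Mat_.embedding C).obj X ⊗ (Mat_.embedding C).obj Y)
    (N := (Mat_.embedding C).obj (X ⊗ Y)) (fun _ => PUnit.unit)
    (fun _ => ⟨PUnit.unit, PUnit.unit⟩) (fun _ => 𝟙 (X ⊗ Y)) (fun _ => 𝟙 (X ⊗ Y))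
    (((isRelabel (M := (Mat_.embedding C).obj X ⊗ (Mat_.embedding C).obj Y)
      (N := (Mat_.embedding C).obj (X ⊗ Y)) _ _).comp
      (isRelabel (M := (Mat_.embedding C).obj (X ⊗ Y))
      (N := (Mat_.embedding C).obj X ⊗ (Mat_.embedding C).obj Y) _ _)).congr
        fun _ => Category.id_comp _)
    (((isRelabel (M := (Mat_.embedding C).obj (X ⊗ Y))
      (N := (Mat_.embedding C).obj X ⊗ (Mat_.embedding C).obj Y) _ _).comp
      (isRelabel (M := (Mat_.embedding C).obj X ⊗ (Mat_.embedding C).obj Y)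
      (N := (Mat_.embedding C).obj (X ⊗ Y)) _ _)).congr
        fun _ => Category.id_comp _)

theorem isRelabel_embeddingμ (X Y : C) :
    IsRelabel (M := (Mat_.embedding C).obj X ⊗ (Mat_.embedding C).obj Y)
      (N := (Mat_.embedding C).obj (X ⊗ Y)) (fun _ => PUnit.unit) (fun _ => 𝟙 (X ⊗ Y))
      (embeddingμ X Y).hom :=
  isRelabel (M := (Mat_.embedding C).obj X ⊗ (Mat_.embedding C).obj Y)
    (N := (Mat_.embedding C).obj (X ⊗ Y)) _ _

theorem isRelabel_embedding_map {X Y : C} (f : X ⟶ Y) :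
    IsRelabel (M := (Mat_.embedding C).obj X) (N := (Mat_.embedding C).obj Y)
      (fun _ => PUnit.unit) (fun _ => f) ((Mat_.embedding C).map f) :=
  ⟨fun _ => rfl, fun _ _ h => (h rfl).elim⟩

/-- The embedding of one-term tuples is a monoidal functor. -/
noncomputable instance : (Mat_.embedding C).Monoidal :=
  Functor.CoreMonoidal.toMonoidal
    { εIso := Iso.refl _
      μIso := embeddingμ
      μIso_hom_natural_left := fun {X Y} f X' =>
        (((isRelabel_embedding_map f).tensor (isRelabel_id _)).comp
          (isRelabel_embeddingμ Y X')).unique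
          ((isRelabel_embeddingμ X X').comp (isRelabel_embedding_map (f ▷ X')))
          fun _ => (Category.comp_id _).trans ((tensorHom_id _ _).trans (Category.id_comp _).symm)
      μIso_hom_natural_right := fun {X Y} X' f =>
        (((isRelabel_id _).tensor (isRelabel_embedding_map f)).comp
          (isRelabel_embeddingμ X' Y)).unique
          ((isRelabel_embeddingμ X' X).comp (isRelabel_embedding_map (X' ◁ f)))
          fun _ => (Category.comp_id _).trans ((id_tensorHom _ _).trans (Category.id_comp _).symm)
      associativity := fun X Y Z =>
        (((isRelabel_embeddingμ X Y).tensor (isRelabel_id _)).comp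
          ((isRelabel_embeddingμ (X ⊗ Y) Z).comp (isRelabel_embedding_map (α_ X Y Z).hom))).unique
          ((isRelabel_associator _ _ _).comp (((isRelabel_id _).tensor
            (isRelabel_embeddingμ Y Z)).comp (isRelabel_embeddingμ X (Y ⊗ Z))))
          fun _ => by
            have : (𝟙 (X ⊗ Y) ⊗ₘ 𝟙 Z) ≫ 𝟙 _ ≫ (α_ X Y Z).hom =
              (α_ X Y Z).hom ≫ (𝟙 X ⊗ₘ 𝟙 (Y ⊗ Z)) ≫ 𝟙 _ := by simp
            exact this
      left_unitality := fun X =>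
        (isRelabel_leftUnitor _).unique
          (((isRelabel_id _).tensor (isRelabel_id _)).comp
            ((isRelabel_embeddingμ (𝟙_ C) X).comp (isRelabel_embedding_map (λ_ X).hom)))
          fun _ => by
            have : (λ_ X).hom = (𝟙 (𝟙_ C) ⊗ₘ 𝟙 X) ≫ 𝟙 _ ≫ (λ_ X).hom := by simp
            exact this
      right_unitality := fun X =>
        (isRelabel_rightUnitor _).unique
          (((isRelabel_id _).tensor (isRelabel_id _)).comp
            ((isRelabel_embeddingμ X (𝟙_ C)).comp (isRelabel_embedding_map (ρ_ X).hom)))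
          fun _ => by
            have : (ρ_ X).hom = (𝟙 X ⊗ₘ 𝟙 (𝟙_ C)) ≫ 𝟙 _ ≫ (ρ_ X).hom := by simp
            exact this }

noncomputable instance [SymmetricCategory C] : (Mat_.embedding C).Braided where
  braided X Y :=
    ((isRelabel_embeddingμ X Y).comp (isRelabel_embedding_map (β_ X Y).hom)).unique
      ((isRelabel_braid _ _).comp (isRelabel_embeddingμ Y X))
      fun _ => (Category.id_comp _).trans (Category.comp_id _).symm

end Embedding

section Linear

variable {K : Type u} [Semiring K] {C : Type u₁} [Category.{v₁} C] [Preadditive C] [Linear K C]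

/-- Scalars act on matrices entry by entry. -/
instance : Linear K (Mat_ C) where
  homModule M N := inferInstanceAs (Module K (∀ i j, M.X i ⟶ N.X j))
  smul_comp L M N r f g := by
    ext i k
    refine Eq.trans ?_ (Finset.smul_sum (r := r)).symm
    exact Finset.sum_congr rfl fun j _ => Linear.smul_comp _ _ _ _ _ _
  comp_smul L M N f r g := by
    ext i k
    refine Eq.trans ?_ (Finset.smul_sum (r := r)).symm
    exact Finset.sum_congr rfl fun j _ => Linear.comp_smul _ _ _ _ _ _

instance : (Mat_.embedding C).Linear K where

end Linear

end MatMonoidal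

end AdditiveEnvelope

/-! ### The Karoubi envelope as a symmetric monoidal category -/

namespace KaroubiMonoidal

open CategoryTheory.Idempotents

section Induced

variable {C : Type u₁} [Category.{v₁} C]

/-- The morphism `f` is induced by a morphism `a` that intertwines the idempotents. -/
def IsInduced {P Q : Karoubi C} (a : P.X ⟶ Q.X) (f : P ⟶ Q) : Prop :=
  f.f = P.p ≫ a ∧ P.p ≫ a = a ≫ Q.p

theorem isInduced_self {P Q : Karoubi C} (f : P ⟶ Q) : IsInduced f.f f :=
  ⟨(Karoubi.p_comp f).symm, Karoubi.p_comm f⟩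

theorem isInduced_id (P : Karoubi C) : IsInduced (𝟙 P.X) (𝟙 P) :=
  ⟨(Category.comp_id _).symm, (Category.comp_id _).trans (Category.id_comp _).symm⟩

theorem IsInduced.comp {P Q R : Karoubi C} {a : P.X ⟶ Q.X} {f : P ⟶ Q} {b : Q.X ⟶ R.X} {g : Q ⟶ R}
    (hf : IsInduced a f) (hg : IsInduced b g) : IsInduced (a ≫ b) (f ≫ g) := by
  refine ⟨?_, ?_⟩
  · rw [Karoubi.comp_f, hf.1, hg.1, Category.assoc, ← Category.assoc a, ← hf.2, Category.assoc,
      ← Category.assoc P.p P.p, P.idem]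
  · rw [← Category.assoc, hf.2, Category.assoc, hg.2, Category.assoc]

theorem IsInduced.unique {P Q : Karoubi C} {a b : P.X ⟶ Q.X} {f g : P ⟶ Q}
    (hf : IsInduced a f) (hg : IsInduced b g) (h : a = b) : f = g := by
  ext
  rw [hf.1, hg.1, h]

/-- The isomorphism `(X, p) ≅ (Y, q)` induced by an isomorphism `X ≅ Y` that intertwines the
idempotents. -/
def mkIso {P Q : Karoubi C} (e : P.X ≅ Q.X) (h : P.p ≫ e.hom = e.hom ≫ Q.p) : P ≅ Q where
  hom := ⟨P.p ≫ e.hom, by simp [← h]⟩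
  inv := ⟨Q.p ≫ e.inv, by
    have h' : Q.p ≫ e.inv = e.inv ≫ P.p := by
      rw [← cancel_epi e.hom, ← cancel_mono e.hom]; simp [h]
    simp [← h']⟩
  hom_inv_id := by
    ext
    have : (P.p ≫ e.hom) ≫ Q.p ≫ e.inv = P.p := by
      rw [h, Category.assoc, ← Category.assoc Q.p Q.p, Q.idem, ← Category.assoc, ← h]; simp
    exact this
  inv_hom_id := by
    ext
    have : (Q.p ≫ e.inv) ≫ P.p ≫ e.hom = Q.p := by simp [h]
    exact this

theorem isInduced_mkIso_hom {P Q : Karoubi C} (e : P.X ≅ Q.X) (h : P.p ≫ e.hom = e.hom ≫ Q.p) :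
    IsInduced e.hom (mkIso e h).hom := ⟨rfl, h⟩

theorem isInduced_mkIso_inv {P Q : Karoubi C} (e : P.X ≅ Q.X) (h : P.p ≫ e.hom = e.hom ≫ Q.p) :
    IsInduced e.inv (mkIso e h).inv := by
  refine ⟨rfl, ?_⟩
  rw [← cancel_epi e.hom, ← cancel_mono e.hom]
  simp [h]

end Induced

section Monoidal

variable {C : Type u₁} [Category.{v₁} C] [MonoidalCategory C]

/-- The tensor product of `(X, p)` and `(Y, q)` is `(X ⊗ Y, p ⊗ q)`. -/
instance : MonoidalCategoryStruct (Karoubi C) where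
  tensorObj P Q := ⟨P.X ⊗ Q.X, P.p ⊗ₘ Q.p, by
    rw [MonoidalCategory.tensorHom_comp_tensorHom, P.idem, Q.idem]⟩
  tensorUnit := ⟨𝟙_ C, 𝟙 _, Category.comp_id _⟩
  tensorHom f g := ⟨f.f ⊗ₘ g.f, by
    simp only [MonoidalCategory.tensorHom_comp_tensorHom, Karoubi.comp_p, Karoubi.p_comp]⟩
  whiskerLeft P _ _ f := ⟨P.p ⊗ₘ f.f, by
    simp only [MonoidalCategory.tensorHom_comp_tensorHom, Karoubi.comp_p, Karoubi.p_comp,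
      Karoubi.idem]⟩
  whiskerRight f Q := ⟨f.f ⊗ₘ Q.p, by
    simp only [MonoidalCategory.tensorHom_comp_tensorHom, Karoubi.comp_p, Karoubi.p_comp,
      Karoubi.idem]⟩
  associator P Q R := mkIso (α_ P.X Q.X R.X) (MonoidalCategory.associator_naturality _ _ _)
  leftUnitor P := mkIso (λ_ P.X)
    ((congrArg (fun a => a ≫ (λ_ P.X).hom) (id_tensorHom _ _)).trans
      (leftUnitor_naturality _))
  rightUnitor P := mkIso (ρ_ P.X)
    ((congrArg (fun a => a ≫ (ρ_ P.X).hom) (tensorHom_id _ _)).trans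
      (rightUnitor_naturality _))

theorem isInduced_associator (P Q R : Karoubi C) :
    IsInduced (P := (P ⊗ Q) ⊗ R) (Q := P ⊗ (Q ⊗ R)) (α_ P.X Q.X R.X).hom (α_ P Q R).hom :=
  isInduced_mkIso_hom (P := (P ⊗ Q) ⊗ R) (Q := P ⊗ (Q ⊗ R)) _ _

theorem isInduced_associator_inv (P Q R : Karoubi C) :
    IsInduced (P := P ⊗ (Q ⊗ R)) (Q := (P ⊗ Q) ⊗ R) (α_ P.X Q.X R.X).inv (α_ P Q R).inv :=
  isInduced_mkIso_inv (P := (P ⊗ Q) ⊗ R) (Q := P ⊗ (Q ⊗ R)) _ _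

theorem isInduced_leftUnitor (P : Karoubi C) :
    IsInduced (P := 𝟙_ _ ⊗ P) (Q := P) (λ_ P.X).hom (λ_ P).hom :=
  isInduced_mkIso_hom (P := 𝟙_ _ ⊗ P) (Q := P) _ _

theorem isInduced_rightUnitor (P : Karoubi C) :
    IsInduced (P := P ⊗ 𝟙_ _) (Q := P) (ρ_ P.X).hom (ρ_ P).hom :=
  isInduced_mkIso_hom (P := P ⊗ 𝟙_ _) (Q := P) _ _

theorem IsInduced.tensor {P Q P' Q' : Karoubi C} {a : P.X ⟶ Q.X} {f : P ⟶ Q} {b : P'.X ⟶ Q'.X}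
    {g : P' ⟶ Q'} (hf : IsInduced a f) (hg : IsInduced b g) :
    IsInduced (P := P ⊗ P') (Q := Q ⊗ Q') (a ⊗ₘ b) (f ⊗ₘ g) :=
  ⟨(congrArg₂ (fun a b => a ⊗ₘ b) hf.1 hg.1).trans
      (MonoidalCategory.tensorHom_comp_tensorHom _ _ _ _).symm,
    (MonoidalCategory.tensorHom_comp_tensorHom _ _ _ _).trans
      ((congrArg₂ (fun a b => a ⊗ₘ b) hf.2 hg.2).trans
        (MonoidalCategory.tensorHom_comp_tensorHom _ _ _ _).symm)⟩

instance : MonoidalCategory (Karoubi C) :=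
  MonoidalCategory.ofTensorHom
    (id_tensorHom_id := fun P Q => rfl)
    (id_tensorHom := fun _ _ _ _ => rfl)
    (tensorHom_id := fun _ _ => rfl)
    (tensorHom_comp_tensorHom := fun f g h k => by
      ext; exact MonoidalCategory.tensorHom_comp_tensorHom _ _ _ _)
    (associator_naturality := fun {X₁ X₂ X₃ Y₁ Y₂ Y₃} f g h =>
      ((((isInduced_self f).tensor (isInduced_self g)).tensor (isInduced_self h)).comp
        (isInduced_associator _ _ _)).unique
        ((isInduced_associator _ _ _).comp
          ((isInduced_self f).tensor ((isInduced_self g).tensor (isInduced_self h))))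
        (associator_naturality _ _ _))
    (leftUnitor_naturality := fun {X Y} f =>
      (((isInduced_id _).tensor (isInduced_self f)).comp (isInduced_leftUnitor Y)).unique
        ((isInduced_leftUnitor X).comp (isInduced_self f)) (by
          have := leftUnitor_naturality f.f
          rw [← id_tensorHom] at this
          exact this))
    (rightUnitor_naturality := fun {X Y} f =>
      (((isInduced_self f).tensor (isInduced_id _)).comp (isInduced_rightUnitor Y)).unique
        ((isInduced_rightUnitor X).comp (isInduced_self f)) (by
          have := rightUnitor_naturality f.f
          rw [← tensorHom_id] at this
          exact this))
    (pentagon := fun W X Y Z =>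
      (((isInduced_associator W X Y).tensor (isInduced_id Z)).comp
        ((isInduced_associator W (X ⊗ Y) Z).comp
          ((isInduced_id W).tensor (isInduced_associator X Y Z)))).unique
        ((isInduced_associator (W ⊗ X) Y Z).comp (isInduced_associator W X (Y ⊗ Z))) (by
          have := MonoidalCategory.pentagon W.X X.X Y.X Z.X
          rw [← id_tensorHom, ← tensorHom_id] at this
          exact this))
    (triangle := fun X Y =>
      ((isInduced_associator X (𝟙_ _) Y).comp
        ((isInduced_id X).tensor (isInduced_leftUnitor Y))).unique
        ((isInduced_rightUnitor X).tensor (isInduced_id Y)) (by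
          have := MonoidalCategory.triangle X.X Y.X
          rw [← id_tensorHom, ← tensorHom_id] at this
          exact this))

theorem isInduced_toKaroubi_map {X Y : C} (f : X ⟶ Y) :
    IsInduced (P := (toKaroubi C).obj X) (Q := (toKaroubi C).obj Y) f ((toKaroubi C).map f) :=
  isInduced_self ((toKaroubi C).map f)

/-- The identification `(X, 𝟙) ⊗ (Y, 𝟙) ≅ (X ⊗ Y, 𝟙)`. -/
def toKaroubiμ (X Y : C) :
    (toKaroubi C).obj X ⊗ (toKaroubi C).obj Y ≅ (toKaroubi C).obj (X ⊗ Y) :=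
  mkIso (P := (toKaroubi C).obj X ⊗ (toKaroubi C).obj Y) (Q := (toKaroubi C).obj (X ⊗ Y))
    (Iso.refl (X ⊗ Y)) ((Category.comp_id _).trans
      ((id_tensorHom_id X Y).trans (Category.comp_id (𝟙 (X ⊗ Y))).symm))

theorem isInduced_toKaroubiμ (X Y : C) :
    IsInduced (P := (toKaroubi C).obj X ⊗ (toKaroubi C).obj Y) (Q := (toKaroubi C).obj (X ⊗ Y))
      (𝟙 (X ⊗ Y)) (toKaroubiμ X Y).hom :=
  isInduced_mkIso_hom (P := (toKaroubi C).obj X ⊗ (toKaroubi C).obj Y)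
    (Q := (toKaroubi C).obj (X ⊗ Y)) _ _

/-- The embedding of `C` in its Karoubi envelope is a monoidal functor. -/
instance : (toKaroubi C).Monoidal :=
  Functor.CoreMonoidal.toMonoidal
    { εIso := Iso.refl _
      μIso := toKaroubiμ
      μIso_hom_natural_left := fun {X Y} f X' =>
        (((isInduced_toKaroubi_map f).tensor (isInduced_id _)).comp
          (isInduced_toKaroubiμ Y X')).unique
          ((isInduced_toKaroubiμ X X').comp (isInduced_toKaroubi_map (f ▷ X')))
          ((Category.comp_id _).trans ((tensorHom_id _ _).trans (Category.id_comp _).symm))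
      μIso_hom_natural_right := fun {X Y} X' f =>
        (((isInduced_id _).tensor (isInduced_toKaroubi_map f)).comp
          (isInduced_toKaroubiμ X' Y)).unique
          ((isInduced_toKaroubiμ X' X).comp (isInduced_toKaroubi_map (X' ◁ f)))
          ((Category.comp_id _).trans ((id_tensorHom _ _).trans (Category.id_comp _).symm))
      associativity := fun X Y Z =>
        (((isInduced_toKaroubiμ X Y).tensor (isInduced_id _)).comp
          ((isInduced_toKaroubiμ (X ⊗ Y) Z).comp (isInduced_toKaroubi_map (α_ X Y Z).hom))).unique
          ((isInduced_associator _ _ _).comp (((isInduced_id _).tensor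
            (isInduced_toKaroubiμ Y Z)).comp (isInduced_toKaroubiμ X (Y ⊗ Z)))) (by
            have : (𝟙 (X ⊗ Y) ⊗ₘ 𝟙 Z) ≫ 𝟙 _ ≫ (α_ X Y Z).hom =
              (α_ X Y Z).hom ≫ (𝟙 X ⊗ₘ 𝟙 (Y ⊗ Z)) ≫ 𝟙 _ := by simp
            exact this)
      left_unitality := fun X =>
        (isInduced_leftUnitor _).unique
          (((isInduced_id _).tensor (isInduced_id _)).comp
            ((isInduced_toKaroubiμ (𝟙_ C) X).comp (isInduced_toKaroubi_map (λ_ X).hom))) (by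
            have : (λ_ X).hom = (𝟙 (𝟙_ C) ⊗ₘ 𝟙 X) ≫ 𝟙 _ ≫ (λ_ X).hom := by simp
            exact this)
      right_unitality := fun X =>
        (isInduced_rightUnitor _).unique
          (((isInduced_id _).tensor (isInduced_id _)).comp
            ((isInduced_toKaroubiμ X (𝟙_ C)).comp (isInduced_toKaroubi_map (ρ_ X).hom))) (by
            have : (ρ_ X).hom = (𝟙 X ⊗ₘ 𝟙 (𝟙_ C)) ≫ 𝟙 _ ≫ (ρ_ X).hom := by simp
            exact this) }

end Monoidal

section Symmetric

variable {C : Type u₁} [Category.{v₁} C] [MonoidalCategory C] [SymmetricCategory C]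

/-- The braiding of `(X, p)` and `(Y, q)`. -/
def braidIso (P Q : Karoubi C) : P ⊗ Q ≅ Q ⊗ P :=
  mkIso (P := P ⊗ Q) (Q := Q ⊗ P) (β_ P.X Q.X) (BraidedCategory.braiding_naturality _ _)

theorem isInduced_braid (P Q : Karoubi C) :
    IsInduced (P := P ⊗ Q) (Q := Q ⊗ P) (β_ P.X Q.X).hom (braidIso P Q).hom :=
  isInduced_mkIso_hom (P := P ⊗ Q) (Q := Q ⊗ P) _ _

theorem braid_nat {P Q P' Q' : Karoubi C} (f : P ⟶ Q) (g : P' ⟶ Q') :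
    (f ⊗ₘ g) ≫ (braidIso Q Q').hom = (braidIso P P').hom ≫ (g ⊗ₘ f) :=
  (((isInduced_self f).tensor (isInduced_self g)).comp (isInduced_braid _ _)).unique
    ((isInduced_braid _ _).comp ((isInduced_self g).tensor (isInduced_self f)))
    (BraidedCategory.braiding_naturality _ _)

instance : SymmetricCategory (Karoubi C) where
  braiding P Q := braidIso P Q
  braiding_naturality_right M _ _ f := braid_nat (𝟙 M) f
  braiding_naturality_left f N := braid_nat f (𝟙 N)
  hexagon_forward X Y Z :=
    ((isInduced_associator X Y Z).comp ((isInduced_braid X (Y ⊗ Z)).comp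
      (isInduced_associator Y Z X))).unique
      (((isInduced_braid X Y).tensor (isInduced_id Z)).comp ((isInduced_associator Y X Z).comp
        ((isInduced_id Y).tensor (isInduced_braid X Z)))) (by
        have := BraidedCategory.hexagon_forward X.X Y.X Z.X
        rw [← id_tensorHom, ← tensorHom_id] at this
        exact this)
  hexagon_reverse X Y Z :=
    ((isInduced_associator_inv X Y Z).comp ((isInduced_braid (X ⊗ Y) Z).comp
      (isInduced_associator_inv Z X Y))).unique
      (((isInduced_id X).tensor (isInduced_braid Y Z)).comp ((isInduced_associator_inv X Z Y).comp
        ((isInduced_braid X Z).tensor (isInduced_id Y)))) (by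
        have := BraidedCategory.hexagon_reverse X.X Y.X Z.X
        rw [← id_tensorHom, ← tensorHom_id] at this
        exact this)
  symmetry P Q :=
    ((isInduced_braid P Q).comp (isInduced_braid Q P)).unique (isInduced_id (P ⊗ Q))
      (SymmetricCategory.symmetry _ _)

instance : (toKaroubi C).Braided where
  braided X Y :=
    ((isInduced_toKaroubiμ X Y).comp (isInduced_toKaroubi_map (β_ X Y).hom)).unique
      ((isInduced_braid _ _).comp (isInduced_toKaroubiμ Y X))
      ((Category.id_comp _).trans (Category.comp_id _).symm)

end Symmetric

section Linear

variable {K : Type u} [Semiring K] {C : Type u₁} [Category.{v₁} C] [Preadditive C] [Linear K C]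

instance (P Q : Karoubi C) : SMul K (P ⟶ Q) where
  smul r f := ⟨r • f.f, by rw [Linear.smul_comp, Linear.comp_smul, f.comm]⟩

instance (P Q : Karoubi C) : Module K (P ⟶ Q) where
  one_smul f := by ext; exact one_smul _ _
  mul_smul r s f := by ext; exact mul_smul _ _ _
  smul_zero r := by ext; exact smul_zero _
  smul_add r f g := by ext; exact smul_add _ _ _
  add_smul r s f := by ext; exact add_smul _ _ _
  zero_smul f := by ext; exact zero_smul _ _

/-- Scalars act on the morphisms of the Karoubi envelope as in `C`. -/
instance : Linear K (Karoubi C) where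
  smul_comp _ _ _ r f g := by ext; exact Linear.smul_comp _ _ _ _ _ _
  comp_smul _ _ _ f r g := by ext; exact Linear.comp_smul _ _ _ _ _ _

instance : (toKaroubi C).Linear K where

end Linear

end KaroubiMonoidal

/-! ### Tensor categories -/

section TensorCategories

/-- A monoidal category is strict if its associators and unitors are identities. -/
class IsStrictMonoidal (C : Type u₁) [Category.{v₁} C] [MonoidalCategory C] : Prop where
  tensor_assoc : ∀ X Y Z : C, (X ⊗ Y) ⊗ Z = X ⊗ (Y ⊗ Z)
  unit_tensor : ∀ X : C, 𝟙_ C ⊗ X = X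
  tensor_unit : ∀ X : C, X ⊗ 𝟙_ C = X
  associator_hom : ∀ X Y Z : C, (α_ X Y Z).hom = eqToHom (tensor_assoc X Y Z)
  leftUnitor_hom : ∀ X : C, (λ_ X).hom = eqToHom (unit_tensor X)
  rightUnitor_hom : ∀ X : C, (ρ_ X).hom = eqToHom (tensor_unit X)

/-- A `K`-linear symmetric monoidal category is a tensor category if it is strict, its tensor
product is bilinear, every object has a dual and `End 𝟙 = K`. -/
class IsTensorCategory (K : Type u) [Field K] (C : Type u₁) [Category.{v₁} C] [Preadditive C]
    [Linear K C] [MonoidalCategory C] [SymmetricCategory C] : Prop extends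
    IsStrictMonoidal C, MonoidalPreadditive C, MonoidalLinear K C where
  exists_dual : ∀ X : C, ∃ Y : C, Nonempty (ExactPairing X Y)
  bijective_end_unit : Function.Bijective fun a : K => a • 𝟙 (𝟙_ C)

/-- The object `X` has categorical dimension `d`, that is, `ev ∘ c ∘ coev = d` for a dual `Y` of
`X` (the left side does not depend on the choice of the dual). -/
def HasDimension {K : Type u} [Field K] {C : Type u₁} [Category.{v₁} C] [Preadditive C]
    [Linear K C] [MonoidalCategory C] [SymmetricCategory C] (d : K) (X : C) : Prop :=
  ∃ (Y : C) (_ : ExactPairing X Y), η_ X Y ≫ (β_ X Y).hom ≫ ε_ X Y = d • 𝟙 (𝟙_ C)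

/-- The category of `d`-dimensional objects and their isomorphisms. -/
abbrev DimensionalObjects {K : Type u} [Field K] (d : K) (C : Type u₁) [Category.{v₁} C]
    [Preadditive C] [Linear K C] [MonoidalCategory C] [SymmetricCategory C] : Type u₁ :=
  Core (ObjectProperty.FullSubcategory fun X : C => HasDimension d X)

/-- The inclusion of the category of `d`-dimensional objects and their isomorphisms. -/
abbrev DimensionalObjects.inclusion {K : Type u} [Field K] (d : K) (C : Type u₁) [Category.{v₁} C]
    [Preadditive C] [Linear K C] [MonoidalCategory C] [SymmetricCategory C] :
    DimensionalObjects d C ⥤ C :=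
  Core.inclusion _ ⋙ ObjectProperty.ι fun X : C => HasDimension d X

end TensorCategories

/-! ### Tensor functors -/

/-- A tensor functor: a `K`-linear (strong) symmetric monoidal functor. -/
structure TensorFunctor (K : Type u) [Field K] (C : Type u₁) [Category.{v₁} C] [Preadditive C]
    [Linear K C] [MonoidalCategory C] [SymmetricCategory C] (D : Type u₂) [Category.{v₂} D]
    [Preadditive D] [Linear K D] [MonoidalCategory D] [SymmetricCategory D] where
  functor : C ⥤ D
  [braided : functor.Braided]
  [additive : functor.Additive]
  [linear : functor.Linear K]

namespace TensorFunctor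

attribute [instance] TensorFunctor.braided TensorFunctor.additive TensorFunctor.linear

variable {K : Type u} [Field K] {C : Type u₁} [Category.{v₁} C] [Preadditive C]
  [Linear K C] [MonoidalCategory C] [SymmetricCategory C] {D : Type u₂} [Category.{v₂} D]
  [Preadditive D] [Linear K D] [MonoidalCategory D] [SymmetricCategory D]

/-- The morphisms of tensor functors are the monoidal natural transformations. -/
@[ext]
structure Hom (F G : TensorFunctor K C D) where
  toNatTrans : F.functor ⟶ G.functor
  [isMonoidal : NatTrans.IsMonoidal toNatTrans]

attribute [instance] Hom.isMonoidal

instance : Category (TensorFunctor K C D) where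
  Hom := Hom
  id F := ⟨𝟙 F.functor⟩
  comp f g := ⟨f.toNatTrans ≫ g.toNatTrans⟩

/-- The evaluation functor `F ↦ F(X)`, `η ↦ η_X`. -/
def evaluation (K : Type u) [Field K] {C : Type u₁} [Category.{v₁} C] [Preadditive C]
    [Linear K C] [MonoidalCategory C] [SymmetricCategory C] (D : Type u₂) [Category.{v₂} D]
    [Preadditive D] [Linear K D] [MonoidalCategory D] [SymmetricCategory D] (X : C) :
    TensorFunctor K C D ⥤ D where
  obj F := F.functor.obj X
  map f := f.toNatTrans.app X

/-- A tensor functor `F` is strict if `F(X ⊗ Y) = FX ⊗ FY`, `F𝟙 = 𝟙` and the structure morphisms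
`F(X ⊗ Y) ⟶ FX ⊗ FY` and `F𝟙 ⟶ 𝟙` are identities. -/
structure IsStrict (F : TensorFunctor K C D) : Prop where
  obj_tensor : ∀ X Y : C, F.functor.obj (X ⊗ Y) = F.functor.obj X ⊗ F.functor.obj Y
  obj_unit : F.functor.obj (𝟙_ C) = 𝟙_ D
  δ_eq : ∀ X Y : C, Functor.OplaxMonoidal.δ F.functor X Y = eqToHom (obj_tensor X Y)
  η_eq : Functor.OplaxMonoidal.η F.functor = eqToHom obj_unit

variable {E : Type u₃} [Category.{v₃} E] [Preadditive E] [Linear K E] [MonoidalCategory E]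
  [SymmetricCategory E]

/-- The composition of tensor functors. -/
def comp (F : TensorFunctor K C D) (G : TensorFunctor K D E) : TensorFunctor K C E where
  functor := F.functor ⋙ G.functor

/-- Restriction of tensor functors along a tensor functor. -/
def precomp (F : TensorFunctor K C D) (E : Type u₃) [Category.{v₃} E] [Preadditive E]
    [Linear K E] [MonoidalCategory E] [SymmetricCategory E] :
    TensorFunctor K D E ⥤ TensorFunctor K C E where
  obj G := F.comp G
  map {G H} f :=
    { toNatTrans := Functor.whiskerLeft F.functor f.toNatTrans
      isMonoidal := inferInstanceAs (NatTrans.IsMonoidal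
        (Functor.whiskerLeft F.functor f.toNatTrans)) }

end TensorFunctor

/-- The category of strict tensor functors and monoidal natural transformations. -/
abbrev StrictTensorFunctor (K : Type u) [Field K] (C : Type u₁) [Category.{v₁} C] [Preadditive C]
    [Linear K C] [MonoidalCategory C] [SymmetricCategory C] (D : Type u₂) [Category.{v₂} D]
    [Preadditive D] [Linear K D] [MonoidalCategory D] [SymmetricCategory D] :=
  ObjectProperty.FullSubcategory fun F : TensorFunctor K C D => F.IsStrict

/-! ### The category `Rep(GL_δ)` -/

section Rep

variable {K : Type u} [Field K]

instance (δ : K) : MonoidalPreadditive (SkeletonCat δ) where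
  whiskerLeft_zero := SkeletonCat.tensor_zero _
  zero_whiskerRight := SkeletonCat.zero_tensor _
  whiskerLeft_add := SkeletonCat.tensor_add _
  add_whiskerRight f g := SkeletonCat.add_tensor f g _

/-- The object `•` of the skeleton category. -/
def SkeletonCat.bullet (δ : K) : SkeletonCat δ := ⟨[Letter.black]⟩

/-- The category `Rep(GL_δ)`: the Karoubi envelope of the additive envelope of the skeleton
category. -/
abbrev RepGL (δ : K) : Type (max 1 u) := Idempotents.Karoubi (Mat_ (SkeletonCat δ))

/-- The embedding of the skeleton category in `Rep(GL_δ)`. -/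
noncomputable def RepGL.embedding (δ : K) : TensorFunctor K (SkeletonCat δ) (RepGL δ) where
  functor := Mat_.embedding (SkeletonCat δ) ⋙ Idempotents.toKaroubi (Mat_ (SkeletonCat δ))

variable (δ : K) (T : Type u₁) [Category.{v₁} T] [Preadditive T] [Linear K T] [MonoidalCategory T]
  [SymmetricCategory T]

/-- The category of tensor functors out of `Rep(GL_δ)` whose restriction to the skeleton category
is strict. -/
abbrev RepGL.StrictRestrictionFunctor :=
  ObjectProperty.FullSubcategory fun F : TensorFunctor K (RepGL δ) T =>
    ((RepGL.embedding δ).comp F).IsStrict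

/-- Restriction of such tensor functors to the skeleton category. -/
noncomputable def RepGL.restriction :
    RepGL.StrictRestrictionFunctor δ T ⥤ StrictTensorFunctor K (SkeletonCat δ) T :=
  ObjectProperty.lift _ (ObjectProperty.ι _ ⋙ (RepGL.embedding δ).precomp T) fun F => F.property

/-- The functor `F ↦ F(•)`, `η ↦ η_•` on strict tensor functors out of the skeleton category. -/
noncomputable def SkeletonCat.evalBullet : StrictTensorFunctor K (SkeletonCat δ) T ⥤ T :=
  ObjectProperty.ι _ ⋙ TensorFunctor.evaluation K T (SkeletonCat.bullet δ)

/-- The functor `F ↦ F(•)`, `η ↦ η_•` on tensor functors out of `Rep(GL_δ)` whose restriction to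
the skeleton category is strict. -/
noncomputable def RepGL.evalBullet : RepGL.StrictRestrictionFunctor δ T ⥤ T :=
  ObjectProperty.ι _ ⋙
    TensorFunctor.evaluation K T ((RepGL.embedding δ).functor.obj (SkeletonCat.bullet δ))

end Rep

/-!
A tensor functor out of the skeleton category amounts to an object of dimension `δ`, because the
diagrams are exactly the morphisms that a dual pair `(X, Y)` of dimension `δ` generates in any
symmetric monoidal category.

*From a dual pair to a functor.* Let `Z` assign `X` to `•` and `Y` to `∘`, so that a word `w` is
sent to the tensor product `wordObj Z w`. The braidings of adjacent factors generate the
permutations of labelled factors (`PermRep`). These are compatible with the extraction of a factor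
with a given label (`PermRep.extract`), so a product of coevaluations depends only on the perfect
matching of labelled factors (`MatchingRep.unique`). Hence each diagram without bottom row has a
well-defined vector `1 ⟶ wordObj Z w`; `vecMap` is the linear extension. A morphism `g` of the
skeleton category should act on these vectors as some morphism `t` of the target does (`Realizes g
t`). Such a `t` is unique, since the first letter of the source can be bent to the target until the
source is the unit (`eq_of_vecMap`). It exists for permutations by coherence, for the cup by
construction, and for the cap by a case distinction: either the two contracted letters are matched
with each other and the dimension `δ` splits off, or their partners become matched by a triangle
identity (`VecPair.vecMap_annihilate`). It then exists for all morphisms, as these are generated by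
permutations, the cup and the cap (`TensorClosed.all`). Uniqueness turns `g ↦ t` into a symmetric
monoidal functor `wordFunctor`, with no computation of composites of diagrams in the target. If the
target is strict, all structure isomorphisms are identities, and so the functor is strict.

*Transformations.* A monoidal transformation is invertible on objects with a dual
(`isIso_app_of_dual`), so it gives an isomorphism at `•`. Its value on an object determines the
value on the dual (`app_dual_eq`), and thus its value at `•` determines all of it. Conversely, an
isomorphism at `•` and its inverse transpose at `∘` extend multiplicatively to words, and the
extension is natural because it commutes with the generators (`tensorClosed_wordNatural`). Hence
evaluation at `•` is fully faithful.

*The Karoubi envelope of the additive envelope.* Each of its objects is spanned by words, in the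
sense that its identity is a finite sum of morphisms that factor through words (`Dominates`).
Transformations therefore extend uniquely along the embedding of the skeleton category. If the
target has finite biproducts and split idempotents, a functor `F` on words extends as well: an
object `P` is sent to a direct summand of a finite direct sum of values of `F`, characterized by the
morphisms `F c ⟶ obj` that it receives from the morphisms `J c ⟶ P` (`Realization`). Choosing `F c`
itself as the value at `J c` makes the restriction of the extension equal to `F`, so that it remains
strict.
-/

/-! ### Words in a symmetric monoidal category -/

section WordObj

variable {T : Type u₁} [Category.{v₁} T] [MonoidalCategory T]

/-- The tensor product of the objects `Z a` over the letters `a` of a word, bracketed to the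
right. -/
def wordObj {A : Type*} (Z : A → T) : List A → T
  | [] => 𝟙_ T
  | a :: w => Z a ⊗ wordObj Z w

/-- Tensoring on the left with the vector `c` of `X ⊗ Y`. -/
def create {X Y : T} (c : 𝟙_ T ⟶ X ⊗ Y) (B : T) : B ⟶ X ⊗ (Y ⊗ B) :=
  (λ_ B).inv ≫ c ▷ B ≫ (α_ _ _ _).hom

theorem create_nat {X Y : T} (c : 𝟙_ T ⟶ X ⊗ Y) {B C : T} (f : B ⟶ C) :
    f ≫ create c C = create c B ≫ X ◁ (Y ◁ f) := by
  simp only [create, leftUnitor_inv_naturality_assoc, whisker_exchange_assoc,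
    associator_naturality_right, Category.assoc]

variable [SymmetricCategory T]

/-- The braiding of the first two factors. -/
def frontSwap (X Y B : T) : X ⊗ (Y ⊗ B) ⟶ Y ⊗ (X ⊗ B) :=
  (α_ X Y B).inv ≫ (β_ X Y).hom ▷ B ≫ (α_ Y X B).hom

theorem frontSwap_nat (X Y : T) {B C : T} (f : B ⟶ C) :
    X ◁ (Y ◁ f) ≫ frontSwap X Y C = frontSwap X Y B ≫ Y ◁ (X ◁ f) := by
  simp only [frontSwap, associator_inv_naturality_right_assoc, whisker_exchange_assoc,
    associator_naturality_right, Category.assoc]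

theorem frontSwap_nat_middle (X : T) {Y Y' : T} (f : Y ⟶ Y') (B : T) :
    X ◁ (f ▷ B) ≫ frontSwap X Y' B = frontSwap X Y B ≫ f ▷ (X ⊗ B) := by
  rw [frontSwap, frontSwap, associator_inv_naturality_middle_assoc, Category.assoc, Category.assoc,
    ← MonoidalCategory.comp_whiskerRight_assoc, BraidedCategory.braiding_naturality_right,
    MonoidalCategory.comp_whiskerRight_assoc, associator_naturality_left]

@[simp]
theorem frontSwap_frontSwap (X Y B : T) : frontSwap X Y B ≫ frontSwap Y X B = 𝟙 _ := by
  simp [frontSwap, ← comp_whiskerRight_assoc]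

instance (X Y B : T) : IsIso (frontSwap X Y B) :=
  ⟨frontSwap Y X B, frontSwap_frontSwap _ _ _, frontSwap_frontSwap _ _ _⟩

/-- The Yang-Baxter relation, in the presence of a further factor `B`. -/
theorem frontSwap_yangBaxter (X Y W B : T) :
    frontSwap X Y (W ⊗ B) ≫ Y ◁ frontSwap X W B ≫ frontSwap Y W (X ⊗ B) =
      X ◁ frontSwap Y W B ≫ frontSwap X W (Y ⊗ B) ≫ W ◁ frontSwap X Y B := by
  calc _ = 𝟙 _ ⊗≫ ((α_ X Y W).inv ≫ (β_ X Y).hom ▷ W ≫ (α_ Y X W).hom ≫ Y ◁ (β_ X W).hom ≫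
        (α_ Y W X).inv ≫ (β_ Y W).hom ▷ X ≫ (α_ W Y X).hom) ▷ B ⊗≫ 𝟙 _ := by
        unfold frontSwap; monoidal
    _ = _ := by rw [BraidedCategory.yang_baxter]; unfold frontSwap; monoidal

theorem frontSwap_extract {X Y B B' C C' : T} {f : B ⟶ B'} {e' : B' ⟶ X ⊗ C'} {e : B ⟶ X ⊗ C}
    {f' : C ⟶ C'} (h : f ≫ e' = e ≫ X ◁ f') :
    Y ◁ f ≫ Y ◁ e' ≫ frontSwap Y X C' = (Y ◁ e ≫ frontSwap Y X C) ≫ X ◁ (Y ◁ f') := by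
  rw [← MonoidalCategory.whiskerLeft_comp_assoc, h, MonoidalCategory.whiskerLeft_comp_assoc,
    frontSwap_nat, Category.assoc]

theorem frontSwap_extract_extract {X Y W B C : T} (e : B ⟶ W ⊗ C) :
    frontSwap X Y B ≫ Y ◁ (X ◁ e ≫ frontSwap X W C) ≫ frontSwap Y W (X ⊗ C) =
      (X ◁ (Y ◁ e ≫ frontSwap Y W C) ≫ frontSwap X W (Y ⊗ C)) ≫ W ◁ frontSwap X Y C := by
  simp only [MonoidalCategory.whiskerLeft_comp, Category.assoc]
  rw [← reassoc_of% frontSwap_nat, frontSwap_yangBaxter]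

/-- Moving an object past a pair of factors created next to it. -/
theorem create_slide {X Y : T} (c : 𝟙_ T ⟶ X ⊗ Y) (A B : T) :
    create c (A ⊗ B) ≫ X ◁ frontSwap Y A B ≫ frontSwap X A (Y ⊗ B) = A ◁ create c B := by
  calc _ = 𝟙 _ ⊗≫ (c ▷ A ≫ ((α_ X Y A).hom ≫ X ◁ (β_ Y A).hom ≫ (α_ X A Y).inv ≫
        (β_ X A).hom ▷ Y ≫ (α_ A X Y).hom)) ▷ B ⊗≫ 𝟙 _ := by
        unfold frontSwap create; monoidal
    _ = 𝟙 _ ⊗≫ (c ▷ A ≫ (β_ (X ⊗ Y) A).hom) ▷ B ⊗≫ 𝟙 _ := by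
        rw [BraidedCategory.braiding_tensor_left_hom]
    _ = _ := by rw [BraidedCategory.braiding_naturality_left]; simp [create]; monoidal

end WordObj

/-! ### Coherence for permutations of factors -/

section Perm

variable {T : Type u₁} [Category.{v₁} T] [MonoidalCategory T] [SymmetricCategory T]
  {A : Type*} (Z : A → T) {ι : Type*}

/-- `PermRep Z l w l' w' f`: the morphism `f` permutes the factors of `wordObj Z w` so that they
form `wordObj Z w'`, where the positions of the two words carry the labels `l` and `l'`. -/
inductive PermRep : (l : List ι) → (w : List A) → (l' : List ι) → (w' : List A) →
    (wordObj Z w ⟶ wordObj Z w') → Prop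
  | refl (l w) (h : l.length = w.length) : PermRep l w l w (𝟙 _)
  | cons (x a) {l w l' w' f} (h : PermRep l w l' w' f) :
      PermRep (x :: l) (a :: w) (x :: l') (a :: w') (Z a ◁ f)
  | swap {x y} (a b) {l w} (hxy : x ≠ y) (h : l.length = w.length) :
      PermRep (x :: y :: l) (a :: b :: w) (y :: x :: l) (b :: a :: w)
        (frontSwap (Z a) (Z b) (wordObj Z w))
  | trans {l w l' w' l'' w'' f g} (hf : PermRep l w l' w' f) (hg : PermRep l' w' l'' w'' g) :
      PermRep l w l'' w'' (f ≫ g)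

/-- `Extract Z x a l w m u e`: the morphism `e` moves the first factor labelled `x` of
`wordObj Z w` to the front; `m` and `u` are the remaining labels and letters. -/
inductive Extract (x : ι) (a : A) : (l : List ι) → (w : List A) → (m : List ι) → (u : List A) →
    (wordObj Z w ⟶ Z a ⊗ wordObj Z u) → Prop
  | head (m u) : Extract x a (x :: m) (a :: u) m u (𝟙 _)
  | tail {y} (b) {l w m u e} (hy : y ≠ x) (h : Extract x a l w m u e) :
      Extract x a (y :: l) (b :: w) (y :: m) (b :: u) (Z b ◁ e ≫ frontSwap (Z b) (Z a) _)

variable {Z}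

namespace PermRep

theorem length {l w l' w'} {f : wordObj Z w ⟶ wordObj Z w'} (h : PermRep (ι := ι) Z l w l' w' f) :
    l.length = w.length ∧ l'.length = w'.length ∧ l.length = l'.length := by
  induction h with
  | refl l w h => simp [h]
  | cons x a h ih => simpa using ih
  | swap a b hxy h => simp [h]
  | trans hf hg ih₁ ih₂ => omega

theorem perm {l w l' w'} {f : wordObj Z w ⟶ wordObj Z w'} (h : PermRep (ι := ι) Z l w l' w' f) :
    l.Perm l' := by
  induction h with
  | refl l w h => rfl
  | cons x a h ih => exact ih.cons _
  | swap a b hxy h => exact .swap _ _ _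
  | trans hf hg ih₁ ih₂ => exact ih₁.trans ih₂

end PermRep

namespace Extract

theorem unique {x : ι} {a a' : A} {l w m u m' u'} {e : wordObj Z w ⟶ Z a ⊗ wordObj Z u}
    {e' : wordObj Z w ⟶ Z a' ⊗ wordObj Z u'} (h : Extract Z x a l w m u e)
    (h' : Extract Z x a' l w m' u' e') : a = a' ∧ m = m' ∧ u = u' ∧ e ≍ e' := by
  induction h generalizing a' m' u' with
  | head m u =>
    cases h' with
    | head => exact ⟨rfl, rfl, rfl, .rfl⟩
    | tail b hy h => exact (hy rfl).elim
  | tail b hy h ih =>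
    cases h' with
    | head => exact (hy rfl).elim
    | tail b hy h' =>
      obtain ⟨rfl, rfl, rfl, h⟩ := ih h'
      cases h
      exact ⟨rfl, rfl, rfl, .rfl⟩

theorem isIso {x : ι} {a : A} {l w m u} {e : wordObj Z w ⟶ Z a ⊗ wordObj Z u}
    (h : Extract Z x a l w m u e) : IsIso e := by
  induction h with
  | head m u => exact inferInstanceAs (IsIso (𝟙 _))
  | tail b hy h ih => exact inferInstanceAs (IsIso (Z b ◁ _ ≫ frontSwap _ _ _))

theorem perm {x : ι} {a : A} {l w m u} {e : wordObj Z w ⟶ Z a ⊗ wordObj Z u}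
    (h : Extract Z x a l w m u e) : l.Perm (x :: m) := by
  induction h with
  | head m u => rfl
  | tail b hy h ih => exact (ih.cons _).trans (.swap _ _ _)

theorem permRep {x : ι} {a : A} {l w m u} {e : wordObj Z w ⟶ Z a ⊗ wordObj Z u}
    (h : Extract Z x a l w m u e) (hl : l.length = w.length) :
    m.length = u.length ∧ PermRep Z l w (x :: m) (a :: u) e := by
  induction h with
  | head m u => exact ⟨by simpa using hl, .refl _ _ hl⟩
  | tail b hy h ih =>
    obtain ⟨h₁, h₂⟩ := ih (by simpa using hl)
    exact ⟨by simpa using h₁, (h₂.cons _ _).trans (.swap _ _ hy h₁)⟩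

end Extract

/-- Extraction of a factor commutes with permutations. -/
theorem PermRep.extract {x : ι} {a : A} {l w l' w'} {f : wordObj Z w ⟶ wordObj Z w'}
    (h : PermRep Z l w l' w' f) {m' u'} {e' : wordObj Z w' ⟶ Z a ⊗ wordObj Z u'}
    (he : Extract Z x a l' w' m' u' e') :
    ∃ (m : List ι) (u : List A) (e : wordObj Z w ⟶ Z a ⊗ wordObj Z u)
      (f' : wordObj Z u ⟶ wordObj Z u'),
      Extract Z x a l w m u e ∧ PermRep Z m u m' u' f' ∧ f ≫ e' = e ≫ Z a ◁ f' := by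
  induction h generalizing m' u' with
  | refl l w h => exact ⟨_, _, _, _, he, .refl _ _ (he.permRep h).1, by simp⟩
  | cons y b h ih =>
    cases he with
    | head => exact ⟨_, _, _, _, .head _ _, h, (Category.comp_id _).trans (Category.id_comp _).symm⟩
    | tail _ hy he =>
      obtain ⟨m, u, e, f', h₁, h₂, h₃⟩ := ih he
      refine ⟨_, _, _, _, .tail _ hy h₁, .cons _ _ h₂, ?_⟩
      exact frontSwap_extract h₃
  | @swap y z b c l w hyz h =>
    cases he with
    | head =>
      refine ⟨_, _, _, _, .tail _ hyz (.head _ _), .refl _ _ (by simp [h]), ?_⟩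
      have : ∀ X Y B : T, frontSwap X Y B ≫ 𝟙 _ =
          (X ◁ 𝟙 (Y ⊗ B) ≫ frontSwap X Y B) ≫ Y ◁ 𝟙 _ := by simp
      exact this _ _ _
    | tail _ hz he =>
      cases he with
      | head =>
        refine ⟨_, _, _, _, .head _ _, .refl _ _ (by simp [h]), ?_⟩
        have : ∀ X Y B : T, frontSwap X Y B ≫ Y ◁ 𝟙 (X ⊗ B) ≫ frontSwap Y X B =
            𝟙 _ ≫ X ◁ 𝟙 _ := by simp
        exact this _ _ _
      | @tail _ _ _ _ m u e hy he =>
        refine ⟨_, _, _, _, .tail _ hy (.tail _ hz he), .swap _ _ hyz (he.permRep h).1, ?_⟩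
        exact frontSwap_extract_extract _
  | trans hf hg ih₁ ih₂ =>
    obtain ⟨m, u, e, f', h₁, h₂, h₃⟩ := ih₂ he
    obtain ⟨m₁, u₁, e₁, f₁, k₁, k₂, k₃⟩ := ih₁ h₁
    refine ⟨_, _, _, _, k₁, k₂.trans h₂, ?_⟩
    rw [Category.assoc, h₃, reassoc_of% k₃, MonoidalCategory.whiskerLeft_comp]

theorem PermRep.nil_right {l w l' w'} {f : wordObj Z w ⟶ wordObj Z w'}
    (h : PermRep (ι := ι) Z l w l' w' f) (hl : l' = []) :
    ∃ h : w = w', f = eqToHom (by rw [h]) := by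
  induction h with
  | refl l w h => exact ⟨rfl, rfl⟩
  | cons y b h ih => simp at hl
  | swap => simp at hl
  | trans hf hg ih₁ ih₂ =>
    obtain ⟨rfl, rfl⟩ := ih₂ hl
    have := hg.perm
    rw [hl, List.perm_nil] at this
    obtain ⟨rfl, rfl⟩ := ih₁ this
    exact ⟨rfl, by simp⟩

/-- Factors can be permuted in any order. -/
theorem PermRep.exists_of_perm {L L' : List (ι × A)} (h : L.Perm L')
    (hL : (L.map Prod.fst).Nodup) :
    ∃ f, PermRep Z (L.map Prod.fst) (L.map Prod.snd) (L'.map Prod.fst) (L'.map Prod.snd) f := by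
  induction h with
  | nil => exact ⟨_, .refl _ _ rfl⟩
  | cons x h ih => exact ⟨_, (ih (List.nodup_cons.1 hL).2).choose_spec.cons _ _⟩
  | swap x y L => exact ⟨_, .swap _ _ (fun h => by simp [h] at hL) (by simp)⟩
  | trans h _ ih₁ ih₂ =>
    exact ⟨_, (ih₁ hL).choose_spec.trans (ih₂ ((h.map _).nodup hL)).choose_spec⟩

theorem PermRep.map_label {κ : Type*} (φ : ι → κ) {l w l' w'}
    {f : wordObj Z w ⟶ wordObj Z w'} (h : PermRep Z l w l' w' f) (hφ : Set.InjOn φ {x | x ∈ l}) :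
    PermRep Z (l.map φ) w (l'.map φ) w' f := by
  induction h with
  | refl l w h => exact .refl _ _ (by simpa)
  | cons x a h ih => exact .cons _ _ (ih (hφ.mono fun _ h => List.mem_cons_of_mem _ h))
  | swap a b hxy h => exact .swap _ _ (hφ.ne (by simp) (by simp) hxy) (by simpa)
  | trans hf _ ih₁ ih₂ =>
    exact (ih₁ hφ).trans (ih₂ (hφ.mono fun _ h => hf.perm.symm.subset h))

end Perm

/-! ### Concatenation of words -/

section Append

variable {T : Type u₁} [Category.{v₁} T] [MonoidalCategory T] {A : Type*} (Z : A → T)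

/-- The tensor product over a concatenation is the tensor product of the tensor products. -/
def wordAppend : (w z : List A) → (wordObj Z (w ++ z) ≅ wordObj Z w ⊗ wordObj Z z)
  | [], z => (λ_ (wordObj Z z)).symm
  | a :: w, z =>
    whiskerLeftIso (Z a) (wordAppend w z) ≪≫ (α_ (Z a) (wordObj Z w) (wordObj Z z)).symm

variable {Z}

/-- The morphism `f ⊗ z`, read as a morphism between concatenated words. -/
def wordWhisker {w w' : List A} (f : wordObj Z w ⟶ wordObj Z w') (z : List A) :
    wordObj Z (w ++ z) ⟶ wordObj Z (w' ++ z) :=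
  (wordAppend Z w z).hom ≫ f ▷ wordObj Z z ≫ (wordAppend Z w' z).inv

theorem wordWhisker_id (w z : List A) : wordWhisker (𝟙 (wordObj Z w)) z = 𝟙 _ := by
  simp [wordWhisker]

theorem wordWhisker_comp {w w' w'' : List A} (f : wordObj Z w ⟶ wordObj Z w')
    (g : wordObj Z w' ⟶ wordObj Z w'') (z : List A) :
    wordWhisker (f ≫ g) z = wordWhisker f z ≫ wordWhisker g z := by
  simp [wordWhisker]

theorem wordWhisker_cons (a : A) {w w' : List A} (f : wordObj Z w ⟶ wordObj Z w') (z : List A) :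
    wordWhisker (w := a :: w) (w' := a :: w') (Z a ◁ f) z = Z a ◁ wordWhisker f z := by
  have : ∀ {X B B' C D D' : T} (i : D ≅ B ⊗ C) (j : D' ≅ B' ⊗ C) (f : B ⟶ B'),
      (whiskerLeftIso X i ≪≫ (α_ X B C).symm).hom ≫ (X ◁ f) ▷ C ≫
        (whiskerLeftIso X j ≪≫ (α_ X B' C).symm).inv = X ◁ (i.hom ≫ f ▷ C ≫ j.inv) := by
    intros; simp
  exact this _ _ _

theorem wordWhisker_create {a b : A} (c : 𝟙_ T ⟶ Z a ⊗ Z b) (w z : List A) :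
    wordWhisker (w' := a :: b :: w) (create c (wordObj Z w)) z = create c (wordObj Z (w ++ z)) := by
  have : ∀ {X Y B C D : T} (c : 𝟙_ T ⟶ X ⊗ Y) (i : D ≅ B ⊗ C),
      i.hom ≫ create c B ▷ C ≫ (whiskerLeftIso X (whiskerLeftIso Y i ≪≫ (α_ Y B C).symm) ≪≫
        (α_ X (Y ⊗ B) C).symm).inv = create c D := by
    intro X Y B C D c i
    have h : create c B ▷ C ≫ (α_ X (Y ⊗ B) C).hom ≫ X ◁ (α_ Y B C).hom = create c (B ⊗ C) := by
      simp [create]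
    simp only [Iso.trans_inv, whiskerLeftIso_inv, Iso.symm_inv, MonoidalCategory.whiskerLeft_comp]
    rw [reassoc_of% h, ← create_nat, Iso.hom_inv_id_assoc]
  exact this _ _

theorem wordAppend_assoc (w z y : List A) :
    (wordAppend Z (w ++ z) y).hom ≫ (wordAppend Z w z).hom ▷ wordObj Z y ≫ (α_ _ _ _).hom =
      eqToHom (by rw [List.append_assoc]) ≫ (wordAppend Z w (z ++ y)).hom ≫
        wordObj Z w ◁ (wordAppend Z z y).hom := by
  induction w with
  | nil =>
    have : ∀ {B C D : T} (i : D ≅ B ⊗ C), i.hom ≫ (λ_ B).inv ▷ C ≫ (α_ _ _ _).hom =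
      𝟙 _ ≫ (λ_ _).inv ≫ 𝟙_ T ◁ i.hom := by intros; simp
    exact this _
  | cons a w ih =>
    have : ∀ {X W B C BC WB WBC WBC' : T} (i : WB ≅ W ⊗ B) (j : WBC ≅ WB ⊗ C)
        (k : BC ≅ B ⊗ C) (l : WBC' ≅ W ⊗ BC) (h : WBC = WBC')
        (_ : j.hom ≫ i.hom ▷ C ≫ (α_ _ _ _).hom = eqToHom h ≫ l.hom ≫ W ◁ k.hom),
        (whiskerLeftIso X j ≪≫ (α_ X WB C).symm).hom ≫
          (whiskerLeftIso X i ≪≫ (α_ X W B).symm).hom ▷ C ≫ (α_ _ _ _).hom =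
        eqToHom (by rw [h]) ≫ (whiskerLeftIso X l ≪≫ (α_ X W BC).symm).hom ≫ (X ⊗ W) ◁ k.hom := by
      intro X W B C BC WB WBC WBC' i j k l h H
      subst h
      have H' := congrArg (fun f => X ◁ f) H
      simp only [eqToHom_refl, Category.id_comp, MonoidalCategory.whiskerLeft_comp] at H' ⊢
      simp only [Iso.trans_hom, whiskerLeftIso_hom, Iso.symm_hom, comp_whiskerRight,
        Category.assoc, tensor_whiskerLeft, Iso.inv_hom_id_assoc]
      rw [← reassoc_of% H']
      simp
    exact this _ _ _ _ _ ih

theorem wordAppend_nil (w : List A) :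
    (wordAppend Z w []).hom ≫ (ρ_ _).hom = eqToHom (by rw [List.append_nil]) := by
  induction w with
  | nil => exact (by rw [← unitors_equal, Iso.inv_hom_id] : (λ_ (𝟙_ T)).inv ≫ (ρ_ (𝟙_ T)).hom = 𝟙 _)
  | cons a w ih =>
    have : ∀ {X W W' : T} (i : W' ≅ W ⊗ 𝟙_ T) (h : W' = W) (_ : i.hom ≫ (ρ_ W).hom = eqToHom h),
        (whiskerLeftIso X i ≪≫ (α_ X W (𝟙_ T)).symm).hom ≫ (ρ_ (X ⊗ W)).hom =
          eqToHom (by rw [h]) := by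
      intro X W W' i h H
      subst h
      have H' := congrArg (fun f => X ◁ f) H
      simp only [eqToHom_refl, MonoidalCategory.whiskerLeft_comp, MonoidalCategory.whiskerLeft_id]
        at H' ⊢
      simpa using H'
    exact this _ _ ih

theorem wordWhisker_wordWhisker {w w' : List A} (f : wordObj Z w ⟶ wordObj Z w') (z y : List A) :
    wordWhisker (wordWhisker f z) y = eqToHom (by rw [List.append_assoc]) ≫
      wordWhisker f (z ++ y) ≫ eqToHom (by rw [List.append_assoc]) := by
  have h := wordAppend_assoc (Z := Z) w z y
  have h' := wordAppend_assoc (Z := Z) w' z y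
  rw [← cancel_mono ((wordAppend Z (w' ++ z) y).hom ≫ (wordAppend Z w' z).hom ▷ wordObj Z y ≫
    (α_ _ _ _).hom)]
  conv_rhs => rw [h']
  simp only [wordWhisker, comp_whiskerRight, Category.assoc, Iso.inv_hom_id_assoc,
    eqToHom_trans_assoc, eqToHom_refl, Category.id_comp]
  rw [inv_hom_whiskerRight_assoc, associator_naturality_left, ← whisker_exchange, reassoc_of% h]

/-- In a strict monoidal category the rebracketing is an identity. -/
theorem wordAppend_eq_eqToHom [IsStrictMonoidal T] (w z : List A) :
    ∃ h : wordObj Z (w ++ z) = wordObj Z w ⊗ wordObj Z z,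
      (wordAppend Z w z).hom = eqToHom h := by
  induction w with
  | nil =>
    refine ⟨(IsStrictMonoidal.unit_tensor _).symm, ?_⟩
    have : ∀ B : T, (λ_ B).inv = eqToHom (IsStrictMonoidal.unit_tensor _).symm := fun B => by
      rw [← cancel_mono (λ_ B).hom, Iso.inv_hom_id, IsStrictMonoidal.leftUnitor_hom, eqToHom_trans,
        eqToHom_refl]
    exact this _
  | cons a w ih =>
    obtain ⟨h, e⟩ := ih
    have : ∀ {B C D X : T} (i : D ≅ B ⊗ C) (h : D = B ⊗ C) (_ : i.hom = eqToHom h),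
        ∃ h, (whiskerLeftIso X i ≪≫ (α_ X B C).symm).hom = eqToHom h := by
      intro B C D X i h e
      refine ⟨(congrArg (X ⊗ ·) h).trans (IsStrictMonoidal.tensor_assoc _ _ _).symm, ?_⟩
      rw [← cancel_mono (α_ X B C).hom]
      simp only [Iso.trans_hom, whiskerLeftIso_hom, Iso.symm_hom, Category.assoc, Iso.inv_hom_id,
        Category.comp_id]
      rw [IsStrictMonoidal.associator_hom, e, eqToHom_trans, whiskerLeft_eqToHom]
    exact this _ h e

variable [SymmetricCategory T]

theorem wordWhisker_frontSwap (a b : A) (w z : List A) :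
    wordWhisker (w := a :: b :: w) (w' := b :: a :: w) (frontSwap (Z a) (Z b) (wordObj Z w)) z =
      frontSwap (Z a) (Z b) (wordObj Z (w ++ z)) := by
  have : ∀ {X Y B C D : T} (i : D ≅ B ⊗ C),
      (whiskerLeftIso X (whiskerLeftIso Y i ≪≫ (α_ Y B C).symm) ≪≫ (α_ X (Y ⊗ B) C).symm).hom ≫
        frontSwap X Y B ▷ C ≫
      (whiskerLeftIso Y (whiskerLeftIso X i ≪≫ (α_ X B C).symm) ≪≫ (α_ Y (X ⊗ B) C).symm).inv =
        frontSwap X Y D := by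
    intro X Y B C D i
    have h : (α_ X (Y ⊗ B) C).inv ≫ frontSwap X Y B ▷ C ≫ (α_ Y (X ⊗ B) C).hom =
        X ◁ (α_ Y B C).hom ≫ frontSwap X Y (B ⊗ C) ≫ Y ◁ (α_ X B C).inv := by
      unfold frontSwap; monoidal
    simp only [Iso.trans_inv, Iso.trans_hom, whiskerLeftIso_inv, whiskerLeftIso_hom, Iso.symm_inv,
      Iso.symm_hom, MonoidalCategory.whiskerLeft_comp, Category.assoc]
    rw [reassoc_of% h, MonoidalCategory.whiskerLeft_inv_hom_assoc,
      MonoidalCategory.whiskerLeft_inv_hom_assoc, ← frontSwap_nat,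
      ← MonoidalCategory.whiskerLeft_comp_assoc, ← MonoidalCategory.whiskerLeft_comp,
      Iso.hom_inv_id, MonoidalCategory.whiskerLeft_id, MonoidalCategory.whiskerLeft_id,
      Category.id_comp]
  exact this _

/-- Moving a letter past the source or past the target of a morphism. -/
theorem wordWhisker_moveLetter (b : A) {w w' : List A} (t : wordObj Z w ⟶ wordObj Z w')
    (z : List A) :
    Z b ◁ wordWhisker t z ≫ Z b ◁ (wordAppend Z w' z).hom ≫
        frontSwap (Z b) (wordObj Z w') (wordObj Z z) ≫ (wordAppend Z w' (b :: z)).inv =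
      (Z b ◁ (wordAppend Z w z).hom ≫ frontSwap (Z b) (wordObj Z w) (wordObj Z z) ≫
        (wordAppend Z w (b :: z)).inv) ≫ wordWhisker t (b :: z) := by
  have : ∀ {X B B' C D D' E E' : T} (i : D ≅ B ⊗ C) (j : D' ≅ B' ⊗ C) (k : E ≅ B ⊗ (X ⊗ C))
      (l : E' ≅ B' ⊗ (X ⊗ C)) (t : B ⟶ B'),
      X ◁ (i.hom ≫ t ▷ C ≫ j.inv) ≫ X ◁ j.hom ≫ frontSwap X B' C ≫ l.inv =
        (X ◁ i.hom ≫ frontSwap X B C ≫ k.inv) ≫ k.hom ≫ t ▷ (X ⊗ C) ≫ l.inv := by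
    intro X B B' C D D' E E' i j k l t
    simp only [MonoidalCategory.whiskerLeft_comp, Category.assoc, whiskerLeft_inv_hom_assoc,
      Iso.inv_hom_id_assoc]
    rw [reassoc_of% frontSwap_nat_middle]
  exact this (wordAppend Z w z) (wordAppend Z w' z) (wordAppend Z w (b :: z)) _ t

variable {ι : Type*}

namespace PermRep

theorem of_eq {l w l' w'} {f g : wordObj Z w ⟶ wordObj Z w'} (h : PermRep (ι := ι) Z l w l' w' f)
    (e : f = g) : PermRep Z l w l' w' g := e ▸ h

theorem whisker {l w l' w'} {f : wordObj Z w ⟶ wordObj Z w'} (h : PermRep (ι := ι) Z l w l' w' f)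
    (k : List ι) (z : List A) (hk : k.length = z.length) :
    PermRep Z (l ++ k) (w ++ z) (l' ++ k) (w' ++ z) (wordWhisker f z) := by
  induction h with
  | refl l w h => rw [wordWhisker_id]; exact .refl _ _ (by simp [h, hk])
  | cons x a h ih => rw [wordWhisker_cons]; exact ih.cons _ _
  | swap a b hxy h =>
    rw [wordWhisker_frontSwap]; exact .swap (l := _ ++ _) (w := _ ++ _) _ _ hxy (by simp [h, hk])
  | trans _ _ ih₁ ih₂ => rw [wordWhisker_comp]; exact ih₁.trans ih₂

/-- A letter moves past a word by the braiding. -/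
theorem moveLetter (x : ι) (a : A) (l : List ι) (w : List A) (hl : l.length = w.length)
    (l' : List ι) (w' : List A) (hl' : l'.length = w'.length) (hx : x ∉ l') :
    PermRep Z (x :: (l' ++ l)) (a :: (w' ++ w)) (l' ++ x :: l) (w' ++ a :: w)
      (Z a ◁ (wordAppend Z w' w).hom ≫ frontSwap (Z a) (wordObj Z w') (wordObj Z w) ≫
        (wordAppend Z w' (a :: w)).inv) := by
  induction l' generalizing w' with
  | nil =>
    cases w' with
    | cons => simp at hl'
    | nil =>
      have : ∀ X B : T, X ◁ (λ_ B).inv ≫ frontSwap X (𝟙_ T) B ≫ (λ_ (X ⊗ B)).hom = 𝟙 _ := by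
        intro X B; simp [frontSwap]
      exact (PermRep.refl (x :: l) (a :: w) (by simp [hl])).of_eq (this (Z a) (wordObj Z w)).symm
  | cons y l' ih =>
    cases w' with
    | nil => simp at hl'
    | cons b w' =>
      have h := (PermRep.swap (Z := Z) (l := l' ++ l) (w := w' ++ w) a b
        (fun h => hx (by simp [h])) (by simp at hl'; simp [hl', hl])).trans
        ((ih w' (by simpa using hl') (fun h => hx (List.mem_cons_of_mem _ h))).cons y b)
      have : ∀ {X Y B C D E : T} (i : D ≅ B ⊗ C) (j : E ≅ B ⊗ (X ⊗ C)),
          X ◁ (whiskerLeftIso Y i ≪≫ (α_ Y B C).symm).hom ≫ frontSwap X (Y ⊗ B) C ≫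
            (whiskerLeftIso Y j ≪≫ (α_ Y B (X ⊗ C)).symm).inv =
          frontSwap X Y D ≫ Y ◁ (X ◁ i.hom ≫ frontSwap X B C ≫ j.inv) := by
        intro X Y B C D E i j
        simp only [Iso.trans_inv, Iso.trans_hom, whiskerLeftIso_inv, whiskerLeftIso_hom,
          Iso.symm_inv, Iso.symm_hom, MonoidalCategory.whiskerLeft_comp, Category.assoc]
        rw [← reassoc_of% frontSwap_nat]
        congr 1
        simp only [← Category.assoc]
        congr 1
        simp only [frontSwap, BraidedCategory.braiding_tensor_right_hom]
        monoidal
      exact h.of_eq (this (X := Z a) (Y := Z b) (wordAppend Z w' w) (wordAppend Z w' (a :: w))).symm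

theorem appendNil (l : List ι) (w : List A) (hl : l.length = w.length) :
    PermRep Z l w (l ++ []) (w ++ []) ((ρ_ _).inv ≫ (wordAppend Z w []).inv) := by
  have h : ∀ {l' w'} (_ : l = l') (hw : w = w'),
      PermRep Z l w l' w' (eqToHom (congrArg (wordObj Z) hw)) := by
    rintro _ _ rfl rfl; exact .refl _ _ hl
  have := h (List.append_nil l).symm (List.append_nil w).symm
  refine this.of_eq ?_
  have h₂ : ∀ {W W' : T} (i : W' ≅ W ⊗ 𝟙_ T) (h : W' = W) (_ : i.hom ≫ (ρ_ W).hom = eqToHom h),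
      eqToHom h.symm = (ρ_ W).inv ≫ i.inv := by
    intro W W' i h H
    subst h
    rw [eqToHom_refl] at H ⊢
    rw [← (Iso.comp_hom_eq_id _).1 H, Iso.hom_inv_id]
  exact h₂ _ _ (wordAppend_nil w)

/-- Two words are exchanged by the braiding. -/
theorem blockSwap (l l' : List ι) (w w' : List A) (hl : l.length = w.length)
    (hl' : l'.length = w'.length) (hd : l.Disjoint l') :
    PermRep Z (l ++ l') (w ++ w') (l' ++ l) (w' ++ w)
      ((wordAppend Z w w').hom ≫ (β_ _ _).hom ≫ (wordAppend Z w' w).inv) := by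
  induction l generalizing w with
  | nil =>
    cases w with
    | cons => simp at hl
    | nil =>
      have h := appendNil (Z := Z) l' w' hl'
      have : ∀ {B C : T} (i : C ≅ B ⊗ 𝟙_ T), (λ_ B).inv ≫ (β_ _ _).hom ≫ i.inv =
        (ρ_ B).inv ≫ i.inv := by intros; simp
      exact h.of_eq (this (wordAppend Z w' [])).symm
  | cons x l ih =>
    cases w with
    | nil => simp at hl
    | cons a w =>
      simp only [List.disjoint_cons_left] at hd
      have h := ((ih w (by simpa using hl) hd.2).cons x a).trans
        (moveLetter (Z := Z) x a l w (by simpa using hl) l' w' hl' hd.1)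
      have : ∀ {X B C D E F : T} (i : D ≅ B ⊗ C) (j : E ≅ C ⊗ B) (k : F ≅ C ⊗ (X ⊗ B)),
          (whiskerLeftIso X i ≪≫ (α_ X B C).symm).hom ≫ (β_ (X ⊗ B) C).hom ≫ k.inv =
          X ◁ (i.hom ≫ (β_ B C).hom ≫ j.inv) ≫ X ◁ j.hom ≫ frontSwap X C B ≫ k.inv := by
        intro X B C D E F i j k
        simp [frontSwap, BraidedCategory.braiding_tensor_left_hom]
      exact h.of_eq (this (X := Z a) (wordAppend Z w w') (wordAppend Z w' w)
        (wordAppend Z w' (a :: w))).symm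

end PermRep

end Append

/-! ### Contractions of perfect matchings -/

/-- The other letter. -/
def Letter.flip : Letter → Letter
  | .black => .white
  | .white => .black

section Matching

variable {T : Type u₁} [Category.{v₁} T] [MonoidalCategory T] [SymmetricCategory T]

section LetterCup

variable {Z : Letter → T}

/-- The vector of `Z a ⊗ Z a.flip` given by a vector `c` of `Z black ⊗ Z white`. -/
def letterCup (c : 𝟙_ T ⟶ Z .black ⊗ Z .white) : ∀ a : Letter, 𝟙_ T ⟶ Z a ⊗ Z a.flip
  | .black => c
  | .white => c ≫ (β_ _ _).hom

theorem create_frontSwap {X Y : T} (c : 𝟙_ T ⟶ X ⊗ Y) (B : T) :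
    create c B ≫ frontSwap X Y B = create (c ≫ (β_ X Y).hom) B := by
  simp [create, frontSwap]

end LetterCup

variable (Z : Letter → T) (c : 𝟙_ T ⟶ Z .black ⊗ Z .white) {ι : Type*}

/-- `MatchingRep Z c m l w v`: the vector `v` of `wordObj Z w` is the product of the vectors `c`,
one for each pair `{x, m x}` of labels, where the positions of `w` carry the labels `l`. -/
inductive MatchingRep (m : ι → ι) : (l : List ι) → (w : Word) → (𝟙_ T ⟶ wordObj Z w) → Prop
  | nil : MatchingRep m [] [] (𝟙 _)
  | cup (x y a) {l w v} (hx : m x = y) (hy : m y = x) (h : MatchingRep m l w v) :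
      MatchingRep m (x :: y :: l) (a :: a.flip :: w) (v ≫ create (letterCup c a) (wordObj Z w))
  | perm {l w l' w' v f} (h : MatchingRep m l w v) (hf : PermRep Z l w l' w' f) :
      MatchingRep m l' w' (v ≫ f)

variable {Z}

theorem PermRep.symm {A : Type*} {Z : A → T} {l w l' w'} {f : wordObj Z w ⟶ wordObj Z w'}
    (h : PermRep (ι := ι) Z l w l' w' f) : ∃ g, PermRep Z l' w' l w g ∧ f ≫ g = 𝟙 _ := by
  induction h with
  | refl l w h => exact ⟨_, .refl _ _ h, by simp⟩
  | cons x a h ih =>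
    obtain ⟨g, h₁, h₂⟩ := ih
    exact ⟨_, h₁.cons x a, (MonoidalCategory.whiskerLeft_comp _ _ _).symm.trans
      ((congrArg _ h₂).trans (MonoidalCategory.whiskerLeft_id _ _))⟩
  | swap a b hxy h => exact ⟨_, .swap b a hxy.symm h, frontSwap_frontSwap _ _ _⟩
  | trans _ _ ih₁ ih₂ =>
    obtain ⟨g, h₁, h₂⟩ := ih₁
    obtain ⟨g', h₁', h₂'⟩ := ih₂
    exact ⟨_, h₁'.trans h₁, by rw [Category.assoc, reassoc_of% h₂', h₂]⟩

namespace MatchingRep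

variable {c} {m : ι → ι}

theorem length {l w} {v : 𝟙_ T ⟶ wordObj Z w} (h : MatchingRep Z c m l w v) :
    l.length = w.length := by
  induction h with
  | nil => rfl
  | cup x y a hx hy h ih => simpa using ih
  | perm h hf ih => exact hf.length.2.1

theorem map_label {κ : Type*} (φ : ι → κ) (m' : κ → κ) {l w} {v : 𝟙_ T ⟶ wordObj Z w}
    (h : MatchingRep Z c m l w v) (hφ : Set.InjOn φ {x | x ∈ l})
    (hm : ∀ x ∈ l, m' (φ x) = φ (m x)) : MatchingRep Z c m' (l.map φ) w v := by
  induction h with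
  | nil => exact .nil
  | cup x y a hx hy h ih =>
    refine .cup _ _ _ (by rw [hm x (by simp), hx]) (by rw [hm y (by simp), hy])
      (ih (hφ.mono fun _ h => ?_) fun z hz => hm z (by simp [hz]))
    exact List.mem_cons_of_mem _ (List.mem_cons_of_mem _ h)
  | perm h hf ih =>
    exact .perm (ih (hφ.mono fun _ h => hf.perm.subset h) fun x hx => hm x (hf.perm.subset hx))
      (hf.map_label φ (hφ.mono fun _ h => hf.perm.subset h))

theorem nil_right {l w} {v : 𝟙_ T ⟶ wordObj Z w} (h : MatchingRep Z c m l w v) (hl : l = []) :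
    ∃ h : [] = w, v = eqToHom (by rw [← h]; rfl) := by
  induction h with
  | nil => exact ⟨rfl, rfl⟩
  | cup => simp at hl
  | perm h hf ih =>
    obtain ⟨rfl, rfl⟩ := hf.nil_right hl
    have := hf.perm
    rw [hl, List.perm_nil] at this
    obtain ⟨rfl, rfl⟩ := ih this
    exact ⟨rfl, by simp⟩

/-- A pair of matched factors that is moved to the front can be split off. -/
theorem extract_pair (hm : Function.Involutive m) {x : ι} {a : Letter} {l w}
    {v : 𝟙_ T ⟶ wordObj Z w} (h : MatchingRep Z c m l w v) {n u}
    {e : wordObj Z w ⟶ Z a ⊗ wordObj Z u}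
    (he : Extract Z x a l w n u e) :
    ∃ (n' : List ι) (u' : Word) (e' : wordObj Z u ⟶ Z a.flip ⊗ wordObj Z u')
      (v' : 𝟙_ T ⟶ wordObj Z u'), Extract Z (m x) a.flip n u n' u' e' ∧
      MatchingRep Z c m n' u' v' ∧ v ≫ e ≫ Z a ◁ e' = v' ≫ create (letterCup c a) _ := by
  induction h generalizing n u with
  | nil => cases he
  | @cup y z b l w v hy hz h ih =>
    cases he with
    | head =>
      rw [hy]
      refine ⟨_, _, _, _, .head _ _, h, ?_⟩
      have : ∀ {X Y B C : T} (v : B ⟶ C) (c : 𝟙_ T ⟶ X ⊗ Y),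
        (v ≫ create c C) ≫ 𝟙 _ ≫ X ◁ (𝟙 (Y ⊗ C)) = v ≫ create c C := by simp
      exact this _ _
    | tail _ hyx he =>
      cases he with
      | head =>
        rw [hz]
        cases b
        · refine ⟨_, _, _, v, .head _ _, h, ?_⟩
          have : ∀ {X Y B C : T} (v : B ⟶ C) (c : 𝟙_ T ⟶ X ⊗ Y),
              (v ≫ create c C) ≫ (X ◁ 𝟙 (Y ⊗ C) ≫ frontSwap X Y C) ≫ Y ◁ (𝟙 (X ⊗ C)) =
                v ≫ create (c ≫ (β_ X Y).hom) C := by simp [create_frontSwap]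
          exact this _ _
        · refine ⟨_, _, _, v, .head _ _, h, ?_⟩
          have : ∀ {X Y B C : T} (v : B ⟶ C) (c : 𝟙_ T ⟶ Y ⊗ X),
              (v ≫ create (c ≫ (β_ Y X).hom) C) ≫ (X ◁ 𝟙 (Y ⊗ C) ≫ frontSwap X Y C) ≫
                Y ◁ (𝟙 (X ⊗ C)) = v ≫ create c C := by simp [← create_frontSwap]
          exact this _ _
      | @tail _ _ _ _ n u e hzx he =>
        obtain ⟨n', u', e', v', h₁, h₂, h₃⟩ := ih he
        have hy' : y ≠ m x := fun h => hzx (by rw [← hy, h, hm])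
        have hz' : z ≠ m x := fun h => hyx (by rw [← hz, h, hm])
        refine ⟨_, _, _, _, .tail _ hy' (.tail _ hz' h₁), .cup _ _ _ hy hz h₂, ?_⟩
        have : ∀ {X Y P Q B C D E : T} (v : E ⟶ B) (d : 𝟙_ T ⟶ X ⊗ Y) (p : 𝟙_ T ⟶ P ⊗ Q)
            (e : B ⟶ P ⊗ C) (e' : C ⟶ Q ⊗ D) (v' : E ⟶ D) (_ : v ≫ e ≫ P ◁ e' = v' ≫ create p D),
            (v ≫ create d B) ≫ (X ◁ (Y ◁ e ≫ frontSwap Y P C) ≫ frontSwap X P (Y ⊗ C)) ≫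
              P ◁ (X ◁ (Y ◁ e' ≫ frontSwap Y Q D) ≫ frontSwap X Q (Y ⊗ D)) =
            (v' ≫ create d D) ≫ create p (X ⊗ (Y ⊗ D)) := by
          intro X Y P Q B C D E v d p e e' v' H
          simp only [MonoidalCategory.whiskerLeft_comp, Category.assoc]
          rw [← reassoc_of% create_nat, reassoc_of% create_slide]
          simp only [← MonoidalCategory.whiskerLeft_comp]
          rw [← reassoc_of% create_nat, create_slide, MonoidalCategory.whiskerLeft_comp,
            reassoc_of% H, ← create_nat]
        exact this _ _ _ _ _ _ h₃
  | perm h hf ih =>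
    obtain ⟨n₁, u₁, e₁, f₁, h₁, h₂, h₃⟩ := hf.extract he
    obtain ⟨n', u', e', v', k₁, k₂, k₃⟩ := ih h₁
    obtain ⟨g₁, h₂', hg⟩ := h₂.symm
    obtain ⟨n₂, u₂, e₂, f₂, j₁, j₂, j₃⟩ := h₂'.extract k₁
    obtain ⟨g₂, j₂', hg₂⟩ := j₂.symm
    refine ⟨_, _, e₂, v' ≫ g₂, j₁, .perm k₂ j₂', ?_⟩
    have : f₁ ≫ e₂ = e' ≫ Z a.flip ◁ g₂ := by
      have H : e₂ = g₁ ≫ e' ≫ Z a.flip ◁ g₂ := by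
        rw [reassoc_of% j₃, ← MonoidalCategory.whiskerLeft_comp, hg₂,
          MonoidalCategory.whiskerLeft_id, Category.comp_id]
      rw [H, reassoc_of% hg]
    rw [Category.assoc, Category.assoc, reassoc_of% h₃, ← MonoidalCategory.whiskerLeft_comp, this,
      MonoidalCategory.whiskerLeft_comp, reassoc_of% k₃, create_nat]

/-- The product of the vectors `c` over the pairs of a perfect matching is well defined. -/
theorem unique (hm : Function.Involutive m) {l w} {v v' : 𝟙_ T ⟶ wordObj Z w}
    (h : MatchingRep Z c m l w v) (h' : MatchingRep Z c m l w v') : v = v' := by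
  induction hn : l.length using Nat.strong_induction_on generalizing l w with
  | _ n ih =>
    cases l with
    | nil =>
      obtain ⟨rfl, rfl⟩ := h.nil_right rfl
      obtain ⟨_, rfl⟩ := h'.nil_right rfl
      rfl
    | cons x l =>
      cases w with
      | nil => have := h.length; simp at this
      | cons a w =>
        obtain ⟨n₁, u₁, e₁, v₁, h₁, h₂, h₃⟩ := h.extract_pair hm (.head _ _)
        obtain ⟨n₂, u₂, e₂, v₂, h₁', h₂', h₃'⟩ := h'.extract_pair hm (.head _ _)
        obtain ⟨-, rfl, rfl, he⟩ := h₁.unique h₁'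
        cases he
        have hl := h₁.perm.length_eq
        simp only [List.length_cons] at hl hn
        have := ih _ (by omega) h₂ h₂' rfl
        subst this
        have := h₁.isIso
        have : ∀ {X Y B C E : T} (v v' : E ⟶ X ⊗ B) (e : B ⟶ Y ⊗ C) [IsIso e]
            (_ : v ≫ 𝟙 _ ≫ X ◁ e = v' ≫ 𝟙 _ ≫ X ◁ e), v = v' := by
          intro X Y B C E v v' e _ H
          simpa [cancel_mono] using H
        exact this _ _ e₁ (h₃.trans h₃'.symm)

end MatchingRep

end Matching

/-! ### Labelled diagrams without bottom row -/

namespace WordDiagram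

variable {w w' z : Word}

/-- The diagram with one edge, joining the two letters of the top row. -/
def cup (a : Letter) : WordDiagram [] [a, a.flip] where
  mate := Sum.elim Fin.elim0 fun i => .inr (Fin.rev (n := 2) i)
  mate_mate := by rintro (i | i); exacts [i.elim0, congrArg Sum.inr (Fin.rev_rev (n := 2) i)]
  letter_iff := by
    rintro (i | i)
    · exact i.elim0
    · change Fin 2 at i
      fin_cases i <;> cases a <;> simp [vertexLetter, Letter.flip, Fin.rev]

/-- The diagram with one edge, joining the two letters of the bottom row. -/
def cap (a : Letter) : WordDiagram [a, a.flip] [] where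
  mate := Sum.elim (fun i => .inl (Fin.rev (n := 2) i)) Fin.elim0
  mate_mate := by rintro (i | i); exacts [congrArg Sum.inl (Fin.rev_rev (n := 2) i), i.elim0]
  letter_iff := by
    rintro (i | i)
    · change Fin 2 at i
      fin_cases i <;> cases a <;> simp [vertexLetter, Letter.flip, Fin.rev]
    · exact i.elim0

/-- The top row of `M` carries the labels `l`, and `m` matches the labels of adjacent letters. -/
def IsLabelled {ι : Type*} (m : ι → ι) (l : List ι) (w : Word) (M : WordDiagram [] w) : Prop :=
  l.length = w.length ∧ ∀ i j : Fin w.length, M.mate (.inr i) = .inr j →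
    l[i.val]?.map m = l[j.val]?

theorem exists_mate_inr (M : WordDiagram [] w) (i : Fin w.length) :
    ∃ j : Fin w.length, M.mate (.inr i) = .inr j := by
  rcases h : M.mate (.inr i) with k | j
  · exact k.elim0
  · exact ⟨j, rfl⟩

theorem IsLabelled.unique {ι : Type*} {m : ι → ι} {l : List ι} {M M' : WordDiagram [] w}
    (h : IsLabelled m l w M) (h' : IsLabelled m l w M') (hl : l.Nodup) : M = M' := by
  ext1
  funext v
  rcases v with i | i
  · exact i.elim0
  · obtain ⟨j, hj⟩ := exists_mate_inr M i
    obtain ⟨j', hj'⟩ := exists_mate_inr M' i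
    have := (h.2 i j hj).symm.trans (h'.2 i j' hj')
    rw [hj, hj', Fin.ext ((List.getElem?_inj (by rw [h.1]; exact j.isLt) hl).1 this)]

theorem loops_ofEquiv (M : WordDiagram z w) (p : WordEquiv w w') : loops M (ofEquiv p) = 0 := by
  rw [loops, Nat.card_eq_zero]
  refine .inl ⟨fun ⟨c, hc⟩ => ?_⟩
  induction c using Quotient.inductionOn with
  | h a =>
    rcases a with i | j | k
    · exact hc (.inl i) rfl
    · exact hc (.inr (p.toEquiv j)) (Quotient.sound (.symm _ _ (.rel _ _ (.upper (.inl j)))))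
    · exact hc (.inr k) rfl

theorem mate_comp_ofEquiv (M : WordDiagram [] w) (p : WordEquiv w w') {i j : Fin w.length}
    (h : M.mate (.inr i) = .inr j) :
    (comp M (ofEquiv p)).mate (.inr (p.toEquiv i)) = .inr (p.toEquiv j) := by
  have hij : j ≠ i := fun hij => M.mate_ne (.inr i) (by rw [h, hij])
  have h₁ : Relation.EqvGen (StackEdge M (ofEquiv p)) (.inr (.inl i)) (.inr (.inr (p.toEquiv i))) :=
    .rel _ _ (.upper (.inl i))
  have h₂ : Relation.EqvGen (StackEdge M (ofEquiv p)) (.inr (.inl j)) (.inr (.inr (p.toEquiv j))) :=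
    .rel _ _ (.upper (.inl j))
  have h₃ : Relation.EqvGen (StackEdge M (ofEquiv p)) (.inr (.inl i)) (.inr (.inl j)) := by
    have := StackEdge.lower (X := M) (Y := ofEquiv p) (.inr i)
    rw [h] at this
    exact .rel _ _ this
  rcases (connected_outer_iff M (ofEquiv p) (.inr (p.toEquiv i)) (.inr (p.toEquiv j))).1
    (.trans _ _ _ (.symm _ _ h₁) (.trans _ _ _ h₃ h₂)) with h | h
  · exact (hij (p.toEquiv.injective (Sum.inr_injective h))).elim
  · exact h.symm

theorem IsLabelled.comp_ofEquiv {ι : Type*} {m : ι → ι} {l l' : List ι} {M : WordDiagram [] w}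
    (h : IsLabelled m l w M) (p : WordEquiv w w') (hl' : l'.length = w'.length)
    (hp : ∀ i, l'[(p.toEquiv i).val]? = l[i.val]?) : IsLabelled m l' w' (comp M (ofEquiv p)) := by
  refine ⟨hl', fun i j hij => ?_⟩
  obtain ⟨i, rfl⟩ := p.toEquiv.surjective i
  obtain ⟨k, hk⟩ := exists_mate_inr M i
  rw [mate_comp_ofEquiv M p hk, Sum.inr.injEq] at hij
  rw [← hij, hp, hp, h.2 i k hk]

theorem isLabelled_nil {ι : Type*} (m : ι → ι) : IsLabelled m [] [] (id []) :=
  ⟨rfl, fun i => i.elim0⟩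

theorem IsLabelled.cup_tensor {ι : Type*} {m : ι → ι} {l : List ι} {M : WordDiagram [] w}
    (h : IsLabelled m l w M) {x y : ι} (hx : m x = y) (hy : m y = x) (a : Letter) :
    IsLabelled m (x :: y :: l) (a :: a.flip :: w) (tensor (cup a) M) := by
  refine ⟨by simp [h.1], fun i j hij => ?_⟩
  obtain ⟨i, rfl⟩ := (splitEquiv [a, a.flip] w).surjective i
  obtain ⟨j, rfl⟩ := (splitEquiv [a, a.flip] w).surjective j
  have hi : (Sum.inr (splitEquiv [a, a.flip] w i) : DiagramVertex ([] ++ []) ([a, a.flip] ++ w)) =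
      vertexEquiv [] [a, a.flip] [] w (i.map .inr .inr) := by rcases i with i | i <;> rfl
  have hj : (Sum.inr (splitEquiv [a, a.flip] w j) : DiagramVertex ([] ++ []) ([a, a.flip] ++ w)) =
      vertexEquiv [] [a, a.flip] [] w (j.map .inr .inr) := by rcases j with j | j <;> rfl
  change vertexEquiv [] [a, a.flip] [] w (Sum.map (cup a).mate M.mate
    ((vertexEquiv [] [a, a.flip] [] w).symm (Sum.inr (splitEquiv [a, a.flip] w i)))) =
    Sum.inr (splitEquiv [a, a.flip] w j) at hij
  rw [hi, hj, Equiv.symm_apply_apply, Equiv.apply_eq_iff_eq] at hij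
  rcases i with i | i <;> rcases j with j | j
  · change Fin 2 at i j
    simp only [Sum.map_inl, Sum.inl.injEq] at hij
    have hij' : i.rev = j := Sum.inr_injective hij
    subst hij'
    fin_cases i
    · exact congrArg some hx
    · exact congrArg some hy
  · simp at hij
  · simp at hij
  · simp only [Sum.map_inr, Sum.inr.injEq] at hij
    refine (congrArg (fun n => (x :: y :: l)[n]?.map m) (splitEquiv_inr_val i)).trans
      (Eq.trans ?_ (congrArg (fun n => (x :: y :: l)[n]?) (splitEquiv_inr_val j)).symm)
    simpa [Nat.add_comm 2] using h.2 i j hij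

end WordDiagram

namespace WordDiagram.WordEquiv

variable {ι : Type*} {w w' : Word} {l l' : List ι}

theorem label_cons (x : ι) (a : Letter) {p : WordEquiv w w'}
    (h : ∀ i, l'[(p.toEquiv i).val]? = l[i.val]?) (i) :
    (x :: l')[(((WordEquiv.ofEq (rfl : [a] = [a])).append p).toEquiv i).val]? =
      (x :: l)[i.val]? := by
  obtain ⟨i, rfl⟩ := (splitEquiv [a] w).surjective i
  have : ((WordEquiv.ofEq (rfl : [a] = [a])).append p).toEquiv (splitEquiv [a] w i) =
      splitEquiv [a] w' (i.map _root_.id p.toEquiv) := by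
    rcases i with i | i <;> simp [WordEquiv.append, WordEquiv.ofEq]
  rw [this]
  rcases i with i | i
  · exact (congrArg (fun n => (x :: l')[n]?) (splitEquiv_inl_val i)).trans
      (Eq.trans (by simp)
        (congrArg (fun n => (x :: l)[n]?) (splitEquiv_inl_val i)).symm)
  · refine (congrArg (fun n => (x :: l')[n]?) (splitEquiv_inr_val (p.toEquiv i))).trans
      (Eq.trans ?_ (congrArg (fun n => (x :: l)[n]?) (splitEquiv_inr_val i)).symm)
    simpa [Nat.add_comm 1] using h i

theorem label_swap (x y : ι) (a b : Letter) (w : Word) (l : List ι) (i) :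
    (y :: x :: l)[(((WordEquiv.swap [a] [b]).append
      (WordEquiv.ofEq (rfl : w = w))).toEquiv i).val]? =
      (x :: y :: l)[i.val]? := by
  rw [WordEquiv.append_ofEq_val]
  split_ifs with hi
  · rw [WordEquiv.swap_val]
    change i.val < 2 at hi
    interval_cases h : i.val <;> simp
  · obtain ⟨k, hk⟩ := Nat.exists_eq_add_of_le (not_lt.1 hi)
    simp only [List.length_append, List.length_cons, List.length_nil] at hk hi ⊢
    rw [hk]
    simp [Nat.add_comm]

/-- A bijection of letters is determined by its effect on distinct labels. -/
theorem ext_label {p q : WordEquiv w w'} (hl : l'.Nodup) (hlen : l'.length = w'.length)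
    (hp : ∀ i, l'[(p.toEquiv i).val]? = l[i.val]?) (hq : ∀ i, l'[(q.toEquiv i).val]? = l[i.val]?) :
    p = q :=
  WordEquiv.ext' fun i => (List.getElem?_inj (by rw [hlen]; exact (p.toEquiv i).isLt) hl).1
    ((hp i).trans (hq i).symm)

end WordDiagram.WordEquiv

namespace PermRep

open WordDiagram

variable {T : Type u₁} [Category.{v₁} T] [MonoidalCategory T] [SymmetricCategory T]
  {Z : Letter → T} {ι : Type*}

/-- The bijection of letters underlying a permutation of factors. -/
theorem exists_wordEquiv (P : ∀ {w w' : Word}, WordEquiv w w' → Prop)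
    (hid : ∀ w, P (WordEquiv.ofEq (rfl : w = w)))
    (hcons : ∀ a {w w'} (p : WordEquiv w w'), P p →
      P ((WordEquiv.ofEq (rfl : [a] = [a])).append p))
    (hswap : ∀ a b w, P ((WordEquiv.swap [a] [b]).append (WordEquiv.ofEq (rfl : w = w))))
    (htrans : ∀ {w w' w''} (p : WordEquiv w w') (q : WordEquiv w' w''), P p → P q → P (p.trans q))
    {l w l' w'} {f : wordObj Z w ⟶ wordObj Z w'} (h : PermRep (ι := ι) Z l w l' w' f) :
    ∃ p : WordEquiv w w', P p ∧ ∀ i, l'[(p.toEquiv i).val]? = l[i.val]? := by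
  induction h with
  | refl l w h => exact ⟨_, hid w, fun i => rfl⟩
  | @cons x a l w l' w' f h ih =>
    obtain ⟨p, hp, h⟩ := ih
    exact ⟨_, hcons a p hp, WordEquiv.label_cons x a h⟩
  | @swap x y a b l w hxy h => exact ⟨_, hswap a b w, WordEquiv.label_swap x y a b w l⟩
  | trans hf hg ih₁ ih₂ =>
    obtain ⟨p, hp, h₁⟩ := ih₁
    obtain ⟨q, hq, h₂⟩ := ih₂
    exact ⟨_, htrans p q hp hq, fun i => (h₂ _).trans (h₁ i)⟩

end PermRep

namespace MatchingRep

open WordDiagram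

variable {T : Type u₁} [Category.{v₁} T] [MonoidalCategory T] [SymmetricCategory T]
  {Z : Letter → T} {c : 𝟙_ T ⟶ Z .black ⊗ Z .white} {ι : Type*} {m : ι → ι}

/-- The perfect matching underlying a product of pair vectors. -/
theorem exists_diagram (P : ∀ {w : Word}, WordDiagram [] w → Prop) (hnil : P (WordDiagram.id []))
    (hcup : ∀ a {w} (M : WordDiagram [] w), P M → P (WordDiagram.tensor (WordDiagram.cup a) M))
    (hperm : ∀ {w w'} (M : WordDiagram [] w) (p : WordEquiv w w'), P M →
      P (WordDiagram.comp M (ofEquiv p)))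
    {l w} {v : 𝟙_ T ⟶ wordObj Z w} (h : MatchingRep Z c m l w v) :
    ∃ M : WordDiagram [] w, P M ∧ IsLabelled m l w M := by
  induction h with
  | nil => exact ⟨_, hnil, isLabelled_nil m⟩
  | cup x y a hx hy h ih =>
    obtain ⟨M, hM, hm⟩ := ih
    exact ⟨_, hcup a M hM, hm.cup_tensor hx hy a⟩
  | perm h hf ih =>
    obtain ⟨M, hM, hm⟩ := ih
    obtain ⟨p, -, hp⟩ := hf.exists_wordEquiv (fun _ => True) (by simp) (by simp) (by simp) (by simp)
    exact ⟨_, hperm M p hM, hm.comp_ofEquiv p hf.length.2.1 hp⟩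

/-- Every perfect matching of opposite letters has a product of pair vectors. -/
theorem exists_of_flip (hm : Function.Involutive m) (L : List (ι × Letter))
    (hL : (L.map Prod.fst).Nodup) (hflip : ∀ x a, (x, a) ∈ L → (m x, a.flip) ∈ L) :
    ∃ v, MatchingRep Z c m (L.map Prod.fst) (L.map Prod.snd) v := by
  induction hn : L.length using Nat.strong_induction_on generalizing L with
  | _ n ih =>
    cases L with
    | nil => exact ⟨_, .nil⟩
    | cons q L =>
      obtain ⟨x, a⟩ := q
      have h := hflip x a List.mem_cons_self
      rcases List.mem_cons.1 h with h | h
      · cases a <;> simp [Letter.flip] at h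
      obtain ⟨s, t, rfl⟩ := List.append_of_mem h
      have hp : ((x, a) :: (s ++ (m x, a.flip) :: t)).Perm
          ((x, a) :: (m x, a.flip) :: (s ++ t)) := (List.perm_middle).cons _
      have hnd := (hp.map Prod.fst).nodup_iff.1 hL
      obtain ⟨v, hv⟩ := ih (s ++ t).length (by simp at hn ⊢; omega) (s ++ t)
        (by simp at hnd ⊢; exact hnd.2.2) (fun y b hy => by
          have h₁ : (m y, b.flip) ∈ (x, a) :: (m x, a.flip) :: (s ++ t) :=
            hp.subset (hflip y b (hp.symm.subset (by simp only [List.mem_cons, hy, or_true])))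
          have hy' : y ∈ (s ++ t).map Prod.fst := List.mem_map.2 ⟨_, hy, rfl⟩
          rcases List.mem_cons.1 h₁ with h₁ | h₁
          · have := (Prod.ext_iff.1 h₁).1
            simp only at this
            have hym : y = m x := by rw [← this, hm]
            subst hym
            exact ((List.nodup_cons.1 (List.nodup_cons.1 hnd).2).1 hy').elim
          rcases List.mem_cons.1 h₁ with h₁ | h₁
          · have := hm.injective (Prod.ext_iff.1 h₁).1
            subst this
            exact ((List.nodup_cons.1 hnd).1 (List.mem_cons_of_mem _ hy')).elim
          · exact h₁) rfl
      obtain ⟨f, hf⟩ := PermRep.exists_of_perm (Z := Z) hp.symm hnd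
      exact ⟨_, .perm (.cup x (m x) a rfl (hm x) hv) hf⟩

end MatchingRep

/-! ### Duality in the skeleton category -/

namespace WordDiagram

variable {w w' w'' : Word}

open scoped Classical in
/-- The loops of a stack of two diagrams can be counted by the colourings with two colours that are
constant on components and trivial on the outer rows. -/
theorem two_pow_loops (X : WordDiagram w w') (Y : WordDiagram w' w'') :
    2 ^ loops X Y = Nat.card {h : Fin w'.length → Bool //
      X.Compat (fun _ => true) h ∧ Y.Compat h (fun _ => true)} :=
  (card_compat X Y fun v => by
    have : ∀ u : DiagramVertex w w'', Sum.elim (fun _ => true) (fun _ => true) u = true := by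
      rintro (u | u) <;> rfl
    rw [this, this]).symm

theorem loops_eq_zero (X : WordDiagram w w') (Y : WordDiagram w' w'')
    (h : ∀ h : Fin w'.length → Bool, X.Compat (fun _ => true) h → Y.Compat h (fun _ => true) →
      h = fun _ => true) : loops X Y = 0 := by
  have h₁ := two_pow_loops X Y
  have : Subsingleton {h : Fin w'.length → Bool //
      X.Compat (fun _ => true) h ∧ Y.Compat h (fun _ => true)} :=
    ⟨fun a b => Subtype.ext ((h _ a.2.1 a.2.2).trans (h _ b.2.1 b.2.2).symm)⟩
  by_contra hne
  have h₂ := Nat.one_lt_two_pow hne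
  rw [h₁] at h₂
  exact absurd h₂ (not_lt.2 (Finite.card_le_one_iff_subsingleton.2 this))

theorem compat_cup (a : Letter) (f g) : (cup a).Compat f g ↔ g (0 : Fin 2) = g (1 : Fin 2) := by
  constructor
  · intro h
    exact h (.inr (1 : Fin 2))
  · intro h v
    rcases v with i | i
    · exact i.elim0
    · change Fin 2 at i
      fin_cases i
      · exact h.symm
      · exact h

theorem compat_cap (a : Letter) (f g) : (cap a).Compat f g ↔ f (0 : Fin 2) = f (1 : Fin 2) := by
  constructor
  · intro h
    exact h (.inl (1 : Fin 2))
  · intro h v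
    rcases v with i | i
    · change Fin 2 at i
      fin_cases i
      · exact h.symm
      · exact h
    · exact i.elim0

theorem eq_of_two_vertices (h : ∀ v a b : DiagramVertex w w', a ≠ v → b ≠ v → a = b)
    (X Y : WordDiagram w w') : X = Y := by
  ext1
  funext v
  exact h v _ _ (X.mate_ne v) (Y.mate_ne v)

instance (a b : Letter) : Subsingleton (WordDiagram [a] [b]) :=
  ⟨eq_of_two_vertices (by
    change ∀ v a b : Fin 1 ⊕ Fin 1, a ≠ v → b ≠ v → a = b
    decide)⟩

instance (a b : Letter) : Subsingleton (WordDiagram [] [a, b]) :=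
  ⟨eq_of_two_vertices (by
    change ∀ v a b : Fin 0 ⊕ Fin 2, a ≠ v → b ≠ v → a = b
    decide)⟩

instance : Subsingleton (WordDiagram [] []) :=
  ⟨eq_of_two_vertices (by
    change ∀ v a b : Fin 0 ⊕ Fin 0, a ≠ v → b ≠ v → a = b
    decide)⟩

theorem compat_id (f g : Fin w.length → Bool) : (id w).Compat f g ↔ g = f :=
  compat_ofEquiv _ _ _

theorem loops_cup_cap (a : Letter) : loops (cup a) (cap a) = 1 := by
  have := two_pow_loops (cup a) (cap a)
  simp only [compat_cup, compat_cap, and_self] at this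
  have e : {h : Fin [a, a.flip].length → Bool // h (0 : Fin 2) = h (1 : Fin 2)} ≃ Bool :=
    { toFun := fun h => h.1 (0 : Fin 2)
      invFun := fun b => ⟨fun _ => b, rfl⟩
      left_inv := fun h => by
        ext i
        change Fin 2 at i
        fin_cases i
        · rfl
        · exact h.2
      right_inv := fun _ => rfl }
  rw [Nat.card_congr e] at this
  have h2 : 2 ^ loops (cup a) (cap a) = 2 ^ 1 := by simpa using this
  exact Nat.pow_right_injective le_rfl h2

end WordDiagram

namespace SkeletonCat

open WordDiagram

variable {K : Type u} [Field K] {δ : K}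

/-- The word with the single letter `a`. -/
abbrev letter (δ : K) (a : Letter) : SkeletonCat δ := ⟨[a]⟩

/-- The coevaluation of a letter. -/
noncomputable def cupHom (δ : K) (a : Letter) : 𝟙_ (SkeletonCat δ) ⟶ letter δ a ⊗ letter δ a.flip :=
  ofDiagram (cup a)

/-- The pairing of a letter with the other letter. -/
noncomputable def capHom (δ : K) (a : Letter) : letter δ a ⊗ letter δ a.flip ⟶ 𝟙_ (SkeletonCat δ) :=
  ofDiagram (cap a)

theorem ofDiagram_comp_of {a b c : SkeletonCat δ} {X : WordDiagram a.word b.word}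
    {Y : WordDiagram b.word c.word} {W : WordDiagram a.word c.word} (h : WordDiagram.comp X Y = W)
    {n : ℕ} (hn : loops X Y = n) :
    (ofDiagram X : a ⟶ b) ≫ (ofDiagram Y : b ⟶ c) = δ ^ n • ofDiagram W := by
  rw [ofDiagram_comp, h, hn]

theorem black_zigzag : cupHom δ .black ▷ letter δ .black ≫ (α_ _ _ _).hom ≫
    letter δ .black ◁ capHom δ .white = (λ_ _).hom ≫ (ρ_ _).inv := by
  have h : (ofDiagram (a := letter δ .black) (b := ⟨[.black, .white, .black]⟩)
      (WordDiagram.tensor (cup .black) (WordDiagram.id [.black]))) ≫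
      (ofDiagram (b := letter δ .black)
        (WordDiagram.tensor (WordDiagram.id [.black]) (cap .white))) = 𝟙 _ := by
    refine (ofDiagram_comp_of (a := letter δ .black) (b := ⟨[.black, .white, .black]⟩)
      (c := letter δ .black)
      (Subsingleton.elim (α := WordDiagram [.black] [.black]) _ (WordDiagram.id _))
      (loops_eq_zero _ _ ?_)).trans ?_
    · intro h h₁ h₂
      change Fin 3 → Bool at h
      have h₃ := (compat_tensor (cup .black) (WordDiagram.id [.black]) _ _).1 h₁
      have h₄ := (compat_tensor (WordDiagram.id [.black]) (cap .white) _ _).1 h₂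
      rw [compat_cup, compat_id] at h₃
      rw [compat_cap, compat_id] at h₄
      have e₀ : h 0 = h 1 := h₃.1
      have e₁ : h 2 = true := congrFun h₃.2 (0 : Fin 1)
      have e₂ : h 1 = h 2 := h₄.2
      funext i
      change Fin 3 at i
      fin_cases i
      · exact (e₀.trans e₂).trans e₁
      · exact e₂.trans e₁
      · exact e₁
    · rw [pow_zero, one_smul]; rfl
  have e₁ := ofDiagram_tensor (δ := δ) (a := 𝟙_ _) (b := letter δ .black ⊗ letter δ .white)
    (c := letter δ .black) (d := letter δ .black) (cup .black) (WordDiagram.id [.black])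
  have e₂ := ofDiagram_tensor (δ := δ) (c := letter δ .white ⊗ letter δ .black) (d := 𝟙_ _)
    (a := letter δ .black) (b := letter δ .black) (WordDiagram.id [.black]) (cap .white)
  refine Eq.trans ?_ (h.trans (Category.comp_id _).symm)
  refine Eq.trans ?_ (congrArg₂ (· ≫ ·) e₁ e₂)
  exact congrArg (_ ≫ ·) (Category.id_comp _)

theorem white_zigzag : letter δ .white ◁ cupHom δ .black ≫ (α_ _ _ _).inv ≫
    capHom δ .white ▷ letter δ .white = (ρ_ _).hom ≫ (λ_ _).inv := by
  have h : (ofDiagram (a := letter δ .white) (b := ⟨[.white, .black, .white]⟩)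
      (WordDiagram.tensor (WordDiagram.id [.white]) (cup .black))) ≫
      (ofDiagram (b := letter δ .white)
        (WordDiagram.tensor (cap .white) (WordDiagram.id [.white]))) = 𝟙 _ := by
    refine (ofDiagram_comp_of (a := letter δ .white) (b := ⟨[.white, .black, .white]⟩)
      (c := letter δ .white)
      (Subsingleton.elim (α := WordDiagram [.white] [.white]) _ (WordDiagram.id _))
      (loops_eq_zero _ _ ?_)).trans ?_
    · intro h h₁ h₂
      change Fin 3 → Bool at h
      have h₃ := (compat_tensor (WordDiagram.id [.white]) (cup .black) _ _).1 h₁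
      have h₄ := (compat_tensor (cap .white) (WordDiagram.id [.white]) _ _).1 h₂
      rw [compat_cup, compat_id] at h₃
      rw [compat_cap, compat_id] at h₄
      have e₀ : h 0 = true := congrFun h₃.1 (0 : Fin 1)
      have e₁ : h 1 = h 2 := h₃.2
      have e₂ : h 0 = h 1 := h₄.1
      funext i
      change Fin 3 at i
      fin_cases i
      · exact e₀
      · exact e₂.symm.trans e₀
      · exact e₁.symm.trans (e₂.symm.trans e₀)
    · rw [pow_zero, one_smul]; rfl
  have e₁ := ofDiagram_tensor (δ := δ) (c := 𝟙_ _) (d := letter δ .black ⊗ letter δ .white)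
    (a := letter δ .white) (b := letter δ .white) (WordDiagram.id [.white]) (cup .black)
  have e₂ := ofDiagram_tensor (δ := δ) (a := letter δ .white ⊗ letter δ .black) (b := 𝟙_ _)
    (c := letter δ .white) (d := letter δ .white) (cap .white) (WordDiagram.id [.white])
  refine Eq.trans ?_ (h.trans (Category.comp_id _).symm)
  refine Eq.trans ?_ (congrArg₂ (· ≫ ·) e₁ e₂)
  exact congrArg (_ ≫ ·) (Category.id_comp _)

/-- The letters `•` and `∘` are dual to each other. -/
noncomputable instance blackWhite (δ : K) : ExactPairing (letter δ .black) (letter δ .white) where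
  coevaluation' := cupHom δ .black
  evaluation' := capHom δ .white
  coevaluation_evaluation' := white_zigzag
  evaluation_coevaluation' := black_zigzag

theorem cupHom_braiding : cupHom δ .black ≫ (β_ _ _).hom = cupHom δ .white := by
  have h := ofDiagram_comp (δ := δ) (a := 𝟙_ _) (b := letter δ .black ⊗ letter δ .white)
    (c := letter δ .white ⊗ letter δ .black) (cup .black) (ofEquiv (.swap [.black] [.white]))
  have h₀ := loops_ofEquiv (cup .black) (.swap [.black] [.white])
  refine h.trans ((congrArg (fun n => δ ^ n • _) h₀).trans ?_)
  rw [pow_zero, one_smul]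
  exact congrArg (ofDiagram (a := 𝟙_ (SkeletonCat δ)) (b := letter δ .white ⊗ letter δ .black))
    (Subsingleton.elim (α := WordDiagram [] [.white, .black]) _ _)

theorem cupHom_capHom (a : Letter) : cupHom δ a ≫ capHom δ a = δ • 𝟙 _ := by
  have h := ofDiagram_comp (δ := δ) (a := 𝟙_ _) (b := letter δ a ⊗ letter δ a.flip)
    (c := 𝟙_ _) (cup a) (cap a)
  refine h.trans ((congrArg (fun n => δ ^ n • _) (loops_cup_cap a)).trans ?_)
  rw [pow_one]
  exact congrArg (fun X => δ • ofDiagram (a := 𝟙_ (SkeletonCat δ)) (b := 𝟙_ (SkeletonCat δ)) X)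
    (Subsingleton.elim (α := WordDiagram [] []) _ _)

end SkeletonCat

/-! ### Standard labels -/

namespace WordDiagram

/-- The mate of a vertex of the top row, as a map of all natural numbers that fixes those which
are not positions of a letter. -/
def mateFun {w : Word} (M : WordDiagram [] w) (k : ℕ) : ℕ :=
  if h : k < w.length then Sum.elim (fun _ => k) (fun j => j.val) (M.mate (.inr ⟨k, h⟩)) else k

theorem mateFun_of_mate {w : Word} {M : WordDiagram [] w} {i j : Fin w.length}
    (h : M.mate (.inr i) = .inr j) : M.mateFun i = j := by
  rw [mateFun, dif_pos i.isLt, h]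
  rfl

theorem mateFun_involutive {w : Word} (M : WordDiagram [] w) : Function.Involutive M.mateFun := by
  intro k
  by_cases h : k < w.length
  · obtain ⟨j, hj⟩ := exists_mate_inr M ⟨k, h⟩
    have hj' : M.mate (.inr j) = .inr ⟨k, h⟩ := by rw [← hj, M.mate_mate]
    have h₁ := mateFun_of_mate hj
    have h₂ := mateFun_of_mate hj'
    simp only at h₁ h₂
    rw [h₁, h₂]
  · simp [mateFun, h]

theorem isLabelled_range {w : Word} (M : WordDiagram [] w) :
    IsLabelled M.mateFun (List.range w.length) w M := by
  refine ⟨by simp, fun i j h => ?_⟩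
  simp [mateFun_of_mate h]

/-- Every diagram without bottom row is a product of pair vectors. -/
theorem exists_matchingRep {T : Type u₁} [Category.{v₁} T] [MonoidalCategory T]
    [SymmetricCategory T] (Z : Letter → T) (c : 𝟙_ T ⟶ Z .black ⊗ Z .white) {w : Word}
    (M : WordDiagram [] w) :
    ∃ v, MatchingRep Z c M.mateFun (List.range w.length) w v := by
  have h₁ : (List.ofFn fun i : Fin w.length => (i.val, w.get i)).map Prod.fst =
      List.range w.length := by
    apply List.ext_getElem <;> simp
  have h₂ : (List.ofFn fun i : Fin w.length => (i.val, w.get i)).map Prod.snd = w := by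
    apply List.ext_getElem <;> simp
  have := MatchingRep.exists_of_flip (Z := Z) (c := c) M.mateFun_involutive
    (List.ofFn fun i : Fin w.length => (i.val, w.get i)) (by rw [h₁]; exact List.nodup_range)
    (fun x a hx => by
      obtain ⟨i, hi⟩ := (List.mem_ofFn' _ _).1 hx
      obtain ⟨rfl, rfl⟩ := Prod.ext_iff.1 hi
      obtain ⟨j, hj⟩ := exists_mate_inr M i
      refine (List.mem_ofFn' _ _).2 ⟨j, Prod.ext (mateFun_of_mate hj).symm ?_⟩
      have := (M.letter_iff (.inr i)).2 (by rw [hj]; rfl)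
      rw [hj] at this
      change w.get i ≠ w.get j at this
      change w.get j = (w.get i).flip
      generalize w.get i = a at *
      generalize w.get j = b at *
      cases a <;> cases b <;> simp_all [Letter.flip])
  rwa [h₁, h₂] at this

theorem WordEquiv.exists_permRep {T : Type u₁} [Category.{v₁} T] [MonoidalCategory T]
    [SymmetricCategory T] (Z : Letter → T) {w w' : Word} (p : WordEquiv w w') {ι : Type*}
    {l l' : List ι} (hl : l.Nodup) (hw : l.length = w.length) (hw' : l'.length = w'.length)
    (hp : ∀ i, l'[(p.toEquiv i).val]? = l[i.val]?) : ∃ f, PermRep Z l w l' w' f := by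
  have hl' : l'.Nodup := by
    rw [List.nodup_iff_injective_get] at hl ⊢
    intro i j hij
    obtain ⟨i', hi⟩ := p.toEquiv.surjective (Fin.cast hw' i)
    obtain ⟨j', hj⟩ := p.toEquiv.surjective (Fin.cast hw' j)
    have h₁ := hp i'
    have h₂ := hp j'
    rw [hi] at h₁
    rw [hj] at h₂
    simp only [Fin.val_cast] at h₁ h₂
    have h₃ : l[i'.val]? = l[j'.val]? := by
      rw [← h₁, ← h₂, List.getElem?_eq_getElem i.isLt, List.getElem?_eq_getElem j.isLt]
      exact congrArg some hij
    have h₄ := Fin.ext ((List.getElem?_inj (by rw [hw]; exact i'.isLt)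
      (List.nodup_iff_injective_get.2 hl)).1 h₃)
    rw [h₄, hj] at hi
    exact (Fin.cast_injective _ hi).symm
  have h₁ : (l.zip w).map Prod.fst = l := List.map_fst_zip hw.le
  have h₂ : (l.zip w).map Prod.snd = w := List.map_snd_zip hw.ge
  have h₁' : (l'.zip w').map Prod.fst = l' := List.map_fst_zip hw'.le
  have h₂' : (l'.zip w').map Prod.snd = w' := List.map_snd_zip hw'.ge
  have hp : (l.zip w).Perm (l'.zip w') := by
    refine (List.perm_ext_iff_of_nodup (List.Nodup.of_map Prod.fst (by rwa [h₁]))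
      (List.Nodup.of_map Prod.fst (by rwa [h₁']))).2 fun q => ?_
    constructor
    · intro hq
      obtain ⟨i, hi, rfl⟩ := List.mem_iff_getElem.1 hq
      have hi' : i < w.length := by simp at hi; exact hi.2
      have := hp ⟨i, hi'⟩
      have h₃ := p.get_eq ⟨i, hi'⟩
      generalize p.toEquiv ⟨i, hi'⟩ = j at *
      refine List.mem_iff_getElem.2 ⟨j, by simp [hw'], ?_⟩
      simp only [List.getElem_zip]
      rw [List.getElem?_eq_getElem (by rw [hw']; exact j.isLt),
        List.getElem?_eq_getElem (by rw [hw]; exact hi')] at this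
      exact Prod.ext (Option.some_injective _ this) h₃
    · intro hq
      obtain ⟨j, hj, rfl⟩ := List.mem_iff_getElem.1 hq
      have hj' : j < w'.length := by simp at hj; exact hj.2
      obtain ⟨i, hi⟩ := p.toEquiv.surjective ⟨j, hj'⟩
      have := hp i
      have h₃ := p.get_eq i
      rw [hi] at this h₃
      refine List.mem_iff_getElem.2 ⟨i, by simp [hw], ?_⟩
      simp only [List.getElem_zip]
      simp only at this
      rw [List.getElem?_eq_getElem (by rw [hw']; exact hj'),
        List.getElem?_eq_getElem (by rw [hw]; exact i.isLt)] at this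
      exact Prod.ext (Option.some_injective _ this.symm) h₃.symm
  have := PermRep.exists_of_perm (Z := Z) hp (by rwa [h₁])
  rwa [h₁, h₂, h₁', h₂'] at this

/-- Every bijection of letters is a permutation of factors. -/
theorem WordEquiv.exists_permRep_range {T : Type u₁} [Category.{v₁} T] [MonoidalCategory T]
    [SymmetricCategory T] (Z : Letter → T) {w w' : Word} (p : WordEquiv w w') :
    ∃ l' f, PermRep Z (List.range w.length) w l' w' f ∧
      ∀ i, l'[(p.toEquiv i).val]? = (List.range w.length)[i.val]? := by
  refine ⟨(List.range w'.length).map fun j =>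
    if h : j < w'.length then (p.toEquiv.symm ⟨j, h⟩).val else 0, ?_⟩
  have hp : ∀ i, ((List.range w'.length).map fun j => if h : j < w'.length then
      (p.toEquiv.symm ⟨j, h⟩).val else 0)[(p.toEquiv i).val]? =
      (List.range w.length)[i.val]? := by
    intro i; simp
  obtain ⟨f, hf⟩ := p.exists_permRep Z List.nodup_range (by simp) (by simp) hp
  exact ⟨f, hf, hp⟩

end WordDiagram

namespace SkeletonCat

open WordDiagram

/-! ### Generation of the skeleton category -/

variable {K : Type u} [Field K] {δ : K}

/-- Properties of morphisms of the skeleton category that pass to linear combinations, compositions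
and tensor products with words on the right, and hold for the permutations and for one vector and
one form relating the two letters. -/
structure TensorClosed (P : ∀ ⦃a b : SkeletonCat δ⦄, (a ⟶ b) → Prop) : Prop where
  comp {a b c : SkeletonCat δ} {f : a ⟶ b} {g : b ⟶ c} : P f → P g → P (f ≫ g)
  zero (a b : SkeletonCat δ) : P (0 : a ⟶ b)
  add {a b : SkeletonCat δ} {f g : a ⟶ b} : P f → P g → P (f + g)
  smul (r : K) {a b : SkeletonCat δ} {f : a ⟶ b} : P f → P (r • f)
  whiskerRight {a b : SkeletonCat δ} {f : a ⟶ b} (c : SkeletonCat δ) : P f → P (f ▷ c)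
  perm {a b : SkeletonCat δ} (p : WordEquiv a.word b.word) : P (ofDiagram (ofEquiv p) : a ⟶ b)
  cup : P (cupHom δ .black)
  cap : P (capHom δ .white)

namespace TensorClosed

variable {P : ∀ ⦃a b : SkeletonCat δ⦄, (a ⟶ b) → Prop}

theorem eqToHom (hP : TensorClosed P) {a b : SkeletonCat δ} (h : a = b) : P (eqToHom h) := by
  rw [eqToHom_eq]; exact hP.perm _

theorem associator_inv (hP : TensorClosed P) (a b c : SkeletonCat δ) : P (α_ a b c).inv :=
  hP.eqToHom (congrArg SkeletonCat.mk (List.append_assoc a.word b.word c.word).symm)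

theorem leftUnitor_hom (hP : TensorClosed P) (a : SkeletonCat δ) : P (λ_ a).hom :=
  hP.eqToHom (congrArg SkeletonCat.mk (List.nil_append a.word))

theorem leftUnitor_inv (hP : TensorClosed P) (a : SkeletonCat δ) : P (λ_ a).inv :=
  hP.eqToHom (congrArg SkeletonCat.mk (List.nil_append a.word).symm)

theorem whiskerLeft (hP : TensorClosed P) (c : SkeletonCat δ) {a b : SkeletonCat δ} {f : a ⟶ b}
    (h : P f) : P (c ◁ f) := by
  have : c ◁ f = (β_ c a).hom ≫ f ▷ c ≫ (β_ b c).hom := by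
    rw [← BraidedCategory.braiding_naturality_right_assoc]; simp
  rw [this]
  exact hP.comp (hP.perm _) (hP.comp (hP.whiskerRight _ h) (hP.perm _))

theorem cupHom (hP : TensorClosed P) (a : Letter) : P (cupHom δ a) := by
  cases a
  · exact hP.cup
  · rw [← cupHom_braiding]
    exact hP.comp hP.cup (hP.perm _)

theorem ofDiagram_vector (hP : TensorClosed P) {w : Word} (M : WordDiagram [] w) :
    P (ofDiagram M : 𝟙_ (SkeletonCat δ) ⟶ ⟨w⟩) := by
  obtain ⟨v, hv⟩ := exists_matchingRep (letter δ) (SkeletonCat.cupHom δ .black) M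
  obtain ⟨M', h₁, h₂⟩ := hv.exists_diagram
    (fun {w} M => P (ofDiagram M : 𝟙_ (SkeletonCat δ) ⟶ ⟨w⟩)) (hP.perm _)
    (fun a w M hM => by
      have h₁ := (ofDiagram_tensor (δ := δ) (a := 𝟙_ _) (b := letter δ a ⊗ letter δ a.flip)
        (c := 𝟙_ _) (d := ⟨w⟩) (WordDiagram.cup a) M).symm
      rw [MonoidalCategory.tensorHom_def', id_whiskerLeft] at h₁
      have h₂ := hP.comp (hP.comp (hP.leftUnitor_hom _) (hP.comp hM (hP.leftUnitor_inv _)))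
        (hP.whiskerRight ⟨w⟩ (hP.cupHom a))
      exact h₁ ▸ h₂)
    (fun {w w'} M p hM => by
      have := hP.comp hM (hP.perm (a := ⟨w⟩) (b := ⟨w'⟩) p)
      rwa [ofDiagram_comp, loops_ofEquiv, pow_zero, one_smul] at this)
  rwa [(isLabelled_range M).unique h₂ List.nodup_range]

/-- Bending the first letter of the source to the target reduces to morphisms out of the unit. -/
theorem all (hP : TensorClosed P) {a b : SkeletonCat δ} (f : a ⟶ b) : P f := by
  obtain ⟨w⟩ := a
  induction w generalizing b with
  | nil =>
    refine hom_induction (hP.zero _ _) (fun _ _ => hP.add) (fun r X => hP.smul r ?_) f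
    exact hP.ofDiagram_vector X
  | cons x w ih =>
    have key : ∀ (y : SkeletonCat δ) [ExactPairing y (letter δ x)],
        P (ε_ y (letter δ x)) → P f := by
      intro y _ hy
      rw [← (tensorLeftHomEquiv ⟨w⟩ y (letter δ x) b).symm_apply_apply f]
      exact hP.comp (hP.whiskerLeft _ (ih _)) (hP.comp (hP.associator_inv _ _ _)
        (hP.comp (hP.whiskerRight _ hy) (hP.leftUnitor_hom _)))
    cases x
    · let := BraidedCategory.exactPairing_swap (letter δ .black) (letter δ .white)
      exact key (letter δ .white) (hP.comp (hP.perm _) hP.cap)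
    · exact key (letter δ .black) hP.cap

end TensorClosed

/-- The permutations are generated by the braidings of letters. -/
theorem ofEquiv_generated {P : ∀ ⦃a b : SkeletonCat δ⦄, (a ⟶ b) → Prop}
    (hid : ∀ a, P (𝟙 a))
    (hcomp : ∀ ⦃a b c : SkeletonCat δ⦄ (f : a ⟶ b) (g : b ⟶ c), P f → P g → P (f ≫ g))
    (hleft : ∀ (x : Letter) ⦃a b : SkeletonCat δ⦄ (f : a ⟶ b), P f → P (letter δ x ◁ f))
    (hright : ∀ ⦃a b : SkeletonCat δ⦄ (f : a ⟶ b) (c : SkeletonCat δ), P f → P (f ▷ c))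
    (hbraid : ∀ x y, P (β_ (letter δ x) (letter δ y)).hom) {a b : SkeletonCat δ}
    (p : WordEquiv a.word b.word) : P (ofDiagram (ofEquiv p) : a ⟶ b) := by
  obtain ⟨w⟩ := a
  obtain ⟨w'⟩ := b
  obtain ⟨l', f, hf, hp⟩ := p.exists_permRep_range (letter δ)
  obtain ⟨q, h₁, h₂⟩ := hf.exists_wordEquiv
    (fun {w w'} p => P (ofDiagram (ofEquiv p) : (⟨w⟩ : SkeletonCat δ) ⟶ ⟨w'⟩)) (fun w => hid _)
    (fun a w w' p hp => by
      have := hleft a _ hp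
      have h := ofDiagram_tensor (δ := δ) (a := letter δ a) (b := letter δ a) (c := ⟨w⟩) (d := ⟨w'⟩)
        (WordDiagram.id [a]) (ofEquiv p)
      rw [WordDiagram.id, tensor_ofEquiv] at h
      exact h ▸ this)
    (fun a b w => by
      have := hright _ ⟨w⟩ (hbraid a b)
      exact swapHom_tensor_id (letter δ a) (letter δ b) ⟨w⟩ ▸ this)
    (fun p q hp hq => by
      have := hcomp _ _ hp hq
      rwa [ofEquiv_comp_hom] at this)
  rwa [WordEquiv.ext_label (hf.perm.nodup_iff.1 List.nodup_range) hf.length.2.1 hp h₂]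

end SkeletonCat

/-! ### Contraction of adjacent factors -/

section Annihilate

variable {T : Type u₁} [Category.{v₁} T] [MonoidalCategory T]

/-- Contracting the first two factors with the form `e`. -/
def annihilate {X Y : T} (e : X ⊗ Y ⟶ 𝟙_ T) (B : T) : X ⊗ (Y ⊗ B) ⟶ B :=
  (α_ _ _ _).inv ≫ e ▷ B ≫ (λ_ B).hom

theorem annihilate_nat {X Y : T} (e : X ⊗ Y ⟶ 𝟙_ T) {B C : T} (f : B ⟶ C) :
    X ◁ (Y ◁ f) ≫ annihilate e C = annihilate e B ≫ f := by
  simp only [annihilate, associator_inv_naturality_right_assoc, whisker_exchange_assoc,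
    leftUnitor_naturality, Category.assoc]

theorem create_annihilate {X Y : T} (c : 𝟙_ T ⟶ X ⊗ Y) (e : X ⊗ Y ⟶ 𝟙_ T) (B : T) :
    create c B ≫ annihilate e B = (λ_ B).inv ≫ (c ≫ e) ▷ B ≫ (λ_ B).hom := by
  simp [create, annihilate]

theorem create_annihilate_of_comp {K : Type*} [Semiring K] [Preadditive T] [Linear K T]
    [MonoidalPreadditive T] [MonoidalLinear K T] {X Y : T} {c : 𝟙_ T ⟶ X ⊗ Y} {e : X ⊗ Y ⟶ 𝟙_ T}
    {d : K} (h : c ≫ e = d • 𝟙 (𝟙_ T)) {A B : T} (v : A ⟶ B) :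
    (v ≫ create c B) ≫ annihilate e B = d • v := by
  rw [Category.assoc, create_annihilate, h]
  simp

/-- A morphism out of a tensor product is determined by bending the first factor to the target. -/
theorem eq_of_create_eq {X Y : T} [ExactPairing X Y] {A B : T} {t t' : Y ⊗ A ⟶ B}
    (h : create (η_ X Y) A ≫ X ◁ t = create (η_ X Y) A ≫ X ◁ t') : t = t' := by
  apply (tensorLeftHomEquiv A X Y B).injective
  simpa [create, tensorLeftHomEquiv] using h

variable [SymmetricCategory T]

/-- Moving an object past a pair of factors that is contracted next to it. -/
theorem annihilate_slide {X Y : T} (e : X ⊗ Y ⟶ 𝟙_ T) (A B : T) :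
    frontSwap A X (Y ⊗ B) ≫ X ◁ frontSwap A Y B ≫ annihilate e (A ⊗ B) = A ◁ annihilate e B := by
  calc _ = 𝟙 _ ⊗≫ (((α_ A X Y).inv ≫ (β_ A X).hom ▷ Y ≫ (α_ X A Y).hom ≫ X ◁ (β_ A Y).hom ≫
        (α_ X Y A).inv) ≫ e ▷ A) ▷ B ⊗≫ 𝟙 _ := by
        unfold frontSwap annihilate; monoidal
    _ = 𝟙 _ ⊗≫ ((β_ A (X ⊗ Y)).hom ≫ e ▷ A) ▷ B ⊗≫ 𝟙 _ := by
        rw [BraidedCategory.braiding_tensor_right_hom]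
    _ = _ := by
        rw [← BraidedCategory.braiding_naturality_right]; simp [annihilate]; monoidal

/-- A created factor that is contracted with a neighbour takes its place. -/
theorem zigzag_annihilate (X Y : T) [ExactPairing X Y] (E : T) :
    create (η_ X Y ≫ (β_ X Y).hom) (X ⊗ E) ≫ Y ◁ frontSwap X X E ≫ annihilate (ε_ X Y) (X ⊗ E) =
      𝟙 _ := by
  rw [← create_frontSwap, Category.assoc, annihilate_slide]
  calc _ = 𝟙 _ ⊗≫ (η_ X Y ▷ X ≫ (α_ _ _ _).hom ≫ X ◁ ε_ X Y) ▷ E ⊗≫ 𝟙 _ := by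
        unfold create annihilate; monoidal
    _ = _ := by rw [ExactPairing.evaluation_coevaluation]; monoidal

theorem create_frontSwap_annihilate {X Y : T} [ExactPairing X Y] {A B D : T} (v : A ⟶ X ⊗ B)
    (g : X ⊗ B ⟶ D) :
    ((v ≫ create (η_ X Y ≫ (β_ X Y).hom) (X ⊗ B)) ≫ Y ◁ frontSwap X X B) ≫
      (Y ◁ (X ◁ g)) ≫ annihilate (ε_ X Y) D = v ≫ g := by
  rw [annihilate_nat, Category.assoc, Category.assoc, reassoc_of% (zigzag_annihilate X Y B)]

end Annihilate

namespace SkeletonCat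

open WordDiagram

variable {K : Type u} [Field K] {δ : K}

/-! ### Vectors of the skeleton category -/

instance : MonoidalLinear K (SkeletonCat δ) where
  whiskerLeft_smul _ _ _ r f := tensor_smul r _ f
  smul_whiskerRight r _ _ f _ := smul_tensor r f _

theorem create_cupHom (a : Letter) (w : Word) :
    create (cupHom δ a) ⟨w⟩ = cupHom δ a ▷ (⟨w⟩ : SkeletonCat δ) :=
  (Category.id_comp _).trans (Category.comp_id _)

theorem annihilate_capHom (a : Letter) (w : Word) :
    annihilate (capHom δ a) ⟨w⟩ = capHom δ a ▷ (⟨w⟩ : SkeletonCat δ) :=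
  (Category.id_comp _).trans (Category.comp_id _)

theorem ofDiagram_create (a : Letter) {w : Word} (M : WordDiagram [] w) :
    (ofDiagram M : 𝟙_ (SkeletonCat δ) ⟶ ⟨w⟩) ≫ create (cupHom δ a) ⟨w⟩ =
      (ofDiagram (tensor (cup a) M) : 𝟙_ (SkeletonCat δ) ⟶ ⟨a :: a.flip :: w⟩) := by
  have h₁ := (ofDiagram_tensor (δ := δ) (a := 𝟙_ _) (b := letter δ a ⊗ letter δ a.flip)
    (c := 𝟙_ _) (d := ⟨w⟩) (cup a) M)
  rw [MonoidalCategory.tensorHom_def', id_whiskerLeft] at h₁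
  refine Eq.trans ?_ h₁
  rw [create_cupHom]
  exact congrArg (· ≫ _) ((Category.id_comp _).trans (Category.comp_id _)).symm

theorem letter_whiskerLeft_ofEquiv (a : Letter) {w w' : Word} (p : WordEquiv w w') :
    letter δ a ◁ (ofDiagram (ofEquiv p) : (⟨w⟩ : SkeletonCat δ) ⟶ ⟨w'⟩) =
      (ofDiagram (ofEquiv ((WordEquiv.ofEq (rfl : [a] = [a])).append p)) :
        (⟨a :: w⟩ : SkeletonCat δ) ⟶ ⟨a :: w'⟩) := by
  have h := ofDiagram_tensor (δ := δ) (a := letter δ a) (b := letter δ a) (c := ⟨w⟩) (d := ⟨w'⟩)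
    (WordDiagram.id [a]) (ofEquiv p)
  rw [WordDiagram.id, tensor_ofEquiv] at h
  exact h

theorem frontSwap_letters (a b : Letter) (w : Word) :
    frontSwap (letter δ a) (letter δ b) ⟨w⟩ =
      (ofDiagram (ofEquiv ((WordEquiv.swap [a] [b]).append (WordEquiv.ofEq (rfl : w = w)))) :
        (⟨a :: b :: w⟩ : SkeletonCat δ) ⟶ ⟨b :: a :: w⟩) :=
  Eq.trans ((Category.id_comp _).trans (Category.comp_id _))
    (swapHom_tensor_id (letter δ a) (letter δ b) ⟨w⟩)

section Pairs

variable {T : Type u₁} [Category.{v₁} T] [MonoidalCategory T] [SymmetricCategory T]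
  (Z : Letter → T) {ι : Type*}

/-- The same permutation of labelled letters, in the skeleton category and for the objects `Z`. -/
structure PermPair (l : List ι) (w : Word) (l' : List ι) (w' : Word)
    (g : (⟨w⟩ : SkeletonCat δ) ⟶ ⟨w'⟩) (t : wordObj Z w ⟶ wordObj Z w') : Prop where
  permRep : PermRep Z l w l' w' t
  exists_equiv : ∃ p : WordEquiv w w', g = ofDiagram (ofEquiv p) ∧
    ∀ i, l'[(p.toEquiv i).val]? = l[i.val]?

/-- The same perfect matching of labelled letters, in the skeleton category and for the objects
`Z`. -/
structure VecPair (c : 𝟙_ T ⟶ Z .black ⊗ Z .white) (m : ι → ι) (l : List ι) (w : Word)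
    (f : 𝟙_ (SkeletonCat δ) ⟶ ⟨w⟩) (v : 𝟙_ T ⟶ wordObj Z w) : Prop where
  matchingRep : MatchingRep Z c m l w v
  exists_diagram : ∃ M : WordDiagram [] w, f = ofDiagram M ∧ IsLabelled m l w M

variable {Z}

theorem _root_.PermRep.exists_permPair {l w l' w'} {t : wordObj Z w ⟶ wordObj Z w'}
    (h : PermRep (ι := ι) Z l w l' w' t) :
    ∃ g : (⟨w⟩ : SkeletonCat δ) ⟶ ⟨w'⟩, PermPair Z l w l' w' g t := by
  obtain ⟨p, -, hp⟩ := h.exists_wordEquiv (fun _ => True) (by simp) (by simp) (by simp) (by simp)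
  exact ⟨_, h, p, rfl, hp⟩

theorem PermPair.cons (x : ι) (a : Letter) {l w l' w'} {g : (⟨w⟩ : SkeletonCat δ) ⟶ ⟨w'⟩}
    {t : wordObj Z w ⟶ wordObj Z w'} (h : PermPair Z l w l' w' g t) :
    PermPair Z (x :: l) (a :: w) (x :: l') (a :: w') (letter δ a ◁ g) (Z a ◁ t) := by
  obtain ⟨h, p, rfl, hp⟩ := h
  exact ⟨h.cons x a, _, letter_whiskerLeft_ofEquiv a p, WordEquiv.label_cons x a hp⟩

theorem PermPair.swap {x y : ι} (a b : Letter) {l w} (hxy : x ≠ y) (h : l.length = w.length) :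
    PermPair Z (x :: y :: l) (a :: b :: w) (y :: x :: l) (b :: a :: w)
      (frontSwap (letter δ a) (letter δ b) ⟨w⟩) (frontSwap (Z a) (Z b) (wordObj Z w)) :=
  ⟨.swap a b hxy h, _, frontSwap_letters a b w, WordEquiv.label_swap x y a b w l⟩

theorem PermPair.map_label {κ : Type*} (φ : ι → κ) (hφ : Function.Injective φ) {l w l' w'}
    {g : (⟨w⟩ : SkeletonCat δ) ⟶ ⟨w'⟩} {t : wordObj Z w ⟶ wordObj Z w'}
    (h : PermPair Z l w l' w' g t) : PermPair Z (l.map φ) w (l'.map φ) w' g t := by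
  obtain ⟨h, p, rfl, hp⟩ := h
  exact ⟨h.map_label φ hφ.injOn, p, rfl, fun i => by rw [List.getElem?_map, List.getElem?_map, hp]⟩

variable {c : 𝟙_ T ⟶ Z .black ⊗ Z .white} {m : ι → ι}

theorem _root_.MatchingRep.exists_vecPair {l w} {v : 𝟙_ T ⟶ wordObj Z w}
    (h : MatchingRep Z c m l w v) :
    ∃ f : 𝟙_ (SkeletonCat δ) ⟶ ⟨w⟩, VecPair Z c m l w f v := by
  obtain ⟨M, -, hM⟩ := h.exists_diagram (fun _ => True) trivial (by simp) (by simp)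
  exact ⟨_, h, M, rfl, hM⟩

theorem VecPair.addCup {l w} {f : 𝟙_ (SkeletonCat δ) ⟶ ⟨w⟩} {v : 𝟙_ T ⟶ wordObj Z w}
    (h : VecPair Z c m l w f v) {x y : ι} (hx : m x = y) (hy : m y = x) (a : Letter) :
    VecPair Z c m (x :: y :: l) (a :: a.flip :: w) (f ≫ create (cupHom δ a) ⟨w⟩)
      (v ≫ create (letterCup c a) (wordObj Z w)) := by
  obtain ⟨h, M, rfl, hM⟩ := h
  exact ⟨h.cup x y a hx hy, _, ofDiagram_create a M, hM.cup_tensor hx hy a⟩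

theorem VecPair.perm {l w l' w'} {f : 𝟙_ (SkeletonCat δ) ⟶ ⟨w⟩} {v : 𝟙_ T ⟶ wordObj Z w}
    (h : VecPair Z c m l w f v) {g : (⟨w⟩ : SkeletonCat δ) ⟶ ⟨w'⟩}
    {t : wordObj Z w ⟶ wordObj Z w'} (h' : PermPair Z l w l' w' g t) :
    VecPair Z c m l' w' (f ≫ g) (v ≫ t) := by
  obtain ⟨h, M, rfl, hM⟩ := h
  obtain ⟨h', p, rfl, hp⟩ := h'
  refine ⟨h.perm h', _, ?_, hM.comp_ofEquiv p h'.length.2.1 hp⟩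
  rw [ofDiagram_comp, loops_ofEquiv, pow_zero, one_smul]

theorem VecPair.unique (hm : Function.Involutive m) {l w} (hl : l.Nodup)
    {f f' : 𝟙_ (SkeletonCat δ) ⟶ ⟨w⟩} {v v' : 𝟙_ T ⟶ wordObj Z w} (h : VecPair Z c m l w f v)
    (h' : VecPair Z c m l w f' v') : f = f' ∧ v = v' := by
  obtain ⟨h, M, rfl, hM⟩ := h
  obtain ⟨h', M', rfl, hM'⟩ := h'
  exact ⟨by rw [hM.unique hM' hl], h.unique hm h'⟩

/-- Labels can be replaced by positions. -/
theorem VecPair.exists_diagram_range {l w} (hl : l.Nodup) {f : 𝟙_ (SkeletonCat δ) ⟶ ⟨w⟩}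
    {v : 𝟙_ T ⟶ wordObj Z w} (h : VecPair Z c m l w f v) :
    ∃ M : WordDiagram [] w, f = ofDiagram M ∧
      MatchingRep Z c M.mateFun (List.range w.length) w v := by
  classical
  obtain ⟨h, M, rfl, hM⟩ := h
  refine ⟨M, rfl, ?_⟩
  have h₁ : l.map (fun x => l.idxOf x) = List.range w.length := by
    apply List.ext_getElem
    · simp [hM.1]
    · intro i h₁ h₂
      simp [hl.idxOf_getElem]
  rw [← h₁]
  refine h.map_label _ _ (fun x hx y hy hxy => (List.idxOf_inj hx).1 hxy) fun x hx => ?_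
  obtain ⟨i, hi, rfl⟩ := List.mem_iff_getElem.1 hx
  have hi' : i < w.length := by rwa [← hM.1]
  obtain ⟨j, hj⟩ := exists_mate_inr M ⟨i, hi'⟩
  have hj' : j.val < l.length := by rw [hM.1]; exact j.isLt
  have h₂ := hM.2 _ _ hj
  rw [List.getElem?_eq_getElem hi, List.getElem?_eq_getElem hj'] at h₂
  rw [Option.some_injective _ h₂, hl.idxOf_getElem, hl.idxOf_getElem]
  exact mateFun_of_mate hj

end Pairs

end SkeletonCat

namespace SkeletonCat

open WordDiagram

variable {K : Type u} [Field K] {δ : K}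

/-! ### Realization of morphisms by their action on vectors -/

section Realize

variable {T : Type u₁} [Category.{v₁} T] [MonoidalCategory T] [SymmetricCategory T]
  (Z : Letter → T) [ExactPairing (Z .black) (Z .white)]

/-- The vector of a diagram without bottom row: the product of the coevaluations of its edges. -/
noncomputable def diagramVec {w : Word} (M : WordDiagram [] w) : 𝟙_ T ⟶ wordObj Z w :=
  (exists_matchingRep Z (η_ (Z .black) (Z .white)) M).choose

theorem matchingRep_diagramVec {w : Word} (M : WordDiagram [] w) :
    MatchingRep Z (η_ (Z .black) (Z .white)) M.mateFun (List.range w.length) w (diagramVec Z M) :=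
  (exists_matchingRep Z (η_ (Z .black) (Z .white)) M).choose_spec

variable [Preadditive T] [Linear K T]

/-- The linear extension of `diagramVec`. -/
noncomputable def vecMap (a : SkeletonCat δ) :
    (𝟙_ (SkeletonCat δ) ⟶ a) →ₗ[K] (𝟙_ T ⟶ wordObj Z a.word) :=
  Finsupp.linearCombination K (diagramVec Z (w := a.word))

theorem vecMap_ofDiagram {a : SkeletonCat δ} (M : WordDiagram [] a.word) :
    vecMap (δ := δ) Z a (ofDiagram M) = diagramVec Z M := by
  refine (Finsupp.linearCombination_single K (1 : K) M).trans ?_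
  rw [one_smul]

theorem vecPair_vecMap {w : Word} (M : WordDiagram [] w) :
    VecPair Z (η_ (Z .black) (Z .white)) M.mateFun (List.range w.length) w
      (ofDiagram M : 𝟙_ (SkeletonCat δ) ⟶ ⟨w⟩) (vecMap (δ := δ) Z ⟨w⟩ (ofDiagram M)) := by
  rw [vecMap_ofDiagram]
  exact ⟨matchingRep_diagramVec Z M, M, rfl, isLabelled_range M⟩

variable {Z}

theorem VecPair.vecMap_eq {ι : Type*} {m : ι → ι} {l : List ι} {w : Word} (hl : l.Nodup)
    {f : 𝟙_ (SkeletonCat δ) ⟶ ⟨w⟩} {v : 𝟙_ T ⟶ wordObj Z w}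
    (h : VecPair Z (η_ (Z .black) (Z .white)) m l w f v) : vecMap Z ⟨w⟩ f = v := by
  obtain ⟨M, rfl, h'⟩ := h.exists_diagram_range hl
  rw [vecMap_ofDiagram]
  exact (matchingRep_diagramVec Z M).unique M.mateFun_involutive h'

theorem vecMap_id : vecMap Z (𝟙_ (SkeletonCat δ)) (𝟙 _) = 𝟙 (𝟙_ T) := by
  refine VecPair.vecMap_eq (ι := ℕ) (m := _root_.id) (l := []) (w := []) List.nodup_nil ?_
  exact ⟨.nil, _, rfl, isLabelled_nil _⟩

/-- Two linear maps on vectors agree if they agree on diagrams. -/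
theorem vector_linear_ext {a : SkeletonCat δ} {V : Type*} [AddCommGroup V] [Module K V]
    {F G : (𝟙_ (SkeletonCat δ) ⟶ a) →ₗ[K] V}
    (h : ∀ M : WordDiagram [] a.word, F (ofDiagram M) = G (ofDiagram M)) : F = G := by
  ext f
  refine hom_induction (by simp) (fun f g hf hg => by simp [hf, hg]) (fun r X => ?_) f
  rw [map_smul, map_smul]
  exact congrArg _ (h X)

theorem vecMap_permPair {l l' : List ℕ} {w w' : Word} (hl : l = List.range w.length)
    {g : (⟨w⟩ : SkeletonCat δ) ⟶ ⟨w'⟩} {t : wordObj Z w ⟶ wordObj Z w'}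
    (h : PermPair Z l w l' w' g t) (f : 𝟙_ (SkeletonCat δ) ⟶ ⟨w⟩) :
    vecMap Z ⟨w'⟩ (f ≫ g) = vecMap Z ⟨w⟩ f ≫ t := by
  subst hl
  have : (vecMap Z ⟨w'⟩).comp (Linear.rightComp K _ g) =
      (Linear.rightComp K _ t).comp (vecMap Z ⟨w⟩) := by
    refine vector_linear_ext fun M => ?_
    exact ((vecPair_vecMap Z M).perm h).vecMap_eq (h.permRep.perm.nodup_iff.1 List.nodup_range)
  exact LinearMap.congr_fun this f

theorem vecMap_create {w : Word} (f : 𝟙_ (SkeletonCat δ) ⟶ ⟨w⟩) (a : Letter) :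
    vecMap Z ⟨a :: a.flip :: w⟩ (f ≫ create (cupHom δ a) ⟨w⟩) =
      vecMap Z ⟨w⟩ f ≫ create (letterCup (η_ (Z .black) (Z .white)) a) (wordObj Z w) := by
  have : (vecMap Z ⟨a :: a.flip :: w⟩).comp (Linear.rightComp K _ (create (cupHom δ a) ⟨w⟩)) =
      (Linear.rightComp K _ (create (letterCup (η_ (Z .black) (Z .white)) a) (wordObj Z w))).comp
        (vecMap Z ⟨w⟩) := by
    refine vector_linear_ext fun M => ?_
    obtain ⟨h, M', h₁, h₂⟩ := vecPair_vecMap (δ := δ) Z M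
    -- the new edge is labelled by the two elements of `Bool`
    have h' : VecPair Z (η_ (Z .black) (Z .white)) (Sum.map not M.mateFun)
        ((List.range w.length).map Sum.inr) w (ofDiagram M) (vecMap Z ⟨w⟩ (ofDiagram M)) := by
      refine ⟨h.map_label _ _ (Sum.inr_injective.injOn) fun _ _ => rfl, M', h₁, by simp, ?_⟩
      intro i j hij
      have := h₂.2 i j hij
      rw [List.getElem?_map, List.getElem?_map, ← this, Option.map_map, Option.map_map]
      rfl
    refine (h'.addCup (x := .inl false) (y := .inl true) rfl rfl a).vecMap_eq ?_
    simp [List.nodup_range.map Sum.inr_injective]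
  exact LinearMap.congr_fun this f

variable [MonoidalPreadditive T] [MonoidalLinear K T]

/-- Contracting a white letter with an adjacent black one: either the two letters are joined, and a
loop appears, or their partners become joined. -/
theorem VecPair.vecMap_annihilate (hdim : η_ (Z .black) (Z .white) ≫ (β_ _ _).hom ≫
    ε_ (Z .black) (Z .white) = δ • 𝟙 (𝟙_ T)) {ι : Type*} {m : ι → ι} (hm : Function.Involutive m)
    {x y : ι} {l : List ι} (hl : (x :: y :: l).Nodup) {w : Word}
    {f : 𝟙_ (SkeletonCat δ) ⟶ ⟨.white :: .black :: w⟩}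
    {v : 𝟙_ T ⟶ wordObj Z (.white :: .black :: w)}
    (h : VecPair Z (η_ (Z .black) (Z .white)) m (x :: y :: l) (.white :: .black :: w) f v) :
    vecMap Z ⟨w⟩ (f ≫ annihilate (capHom δ .white) ⟨w⟩) =
      v ≫ annihilate (ε_ (Z .black) (Z .white)) (wordObj Z w) := by
  classical
  obtain ⟨n₁, u₁, e₁, v₁, hE, h₁, h₂⟩ := h.matchingRep.extract_pair hm (.head _ _)
  cases hE with
  | head =>
    obtain ⟨f₁, hf₁⟩ := h₁.exists_vecPair (δ := δ)
    obtain ⟨rfl, rfl⟩ := h.unique hm hl (hf₁.addCup rfl (hm x) .white)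
    have e₁ := create_annihilate_of_comp (cupHom_capHom (δ := δ) .white) f₁
    have e₂ := create_annihilate_of_comp ((Category.assoc _ _ _).trans hdim) v₁
    refine (congrArg _ e₁).trans (Eq.trans ?_ e₂.symm)
    rw [map_smul, hf₁.vecMap_eq (List.nodup_cons.1 (List.nodup_cons.1 hl).2).2]
  | @tail _ _ _ _ n₂ u₂ e₂ hyx hE =>
    obtain ⟨n₃, u₃, e₃, v₃, hE₃, h₃, h₄⟩ := h₁.extract_pair hm (.head _ _)
    obtain ⟨f₃, hf₃⟩ := h₃.exists_vecPair (δ := δ)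
    have P₁ := hf₃.addCup (x := y) (y := m y) rfl (hm y) .black
    have hlen : l.length = w.length := by simpa using h.matchingRep.length
    obtain ⟨hlen₂, hp⟩ := hE.permRep hlen
    obtain ⟨hlen₃, hp₃⟩ := hE₃.permRep hlen₂
    have P₂ := (P₁.addCup (x := x) (y := m x) rfl (hm x) .white).perm
      ((PermPair.swap (y := y) .black .black hyx.symm (by simp [hlen₃])).cons x .white)
    obtain ⟨s, hs, -⟩ := (hp.trans (hp₃.cons _ _)).symm
    obtain ⟨g, hg⟩ := hs.exists_permPair (δ := δ)
    obtain ⟨rfl, rfl⟩ := h.unique hm hl (P₂.perm ((hg.cons y .black).cons x .white))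
    -- after the contraction the partner of `y` is matched with the partner of `x`
    have hnd : (m x :: m y :: n₃).Nodup := by
      refine hs.perm.nodup_iff.2 (List.nodup_cons.1 (List.nodup_cons.1 hl).2).2
    have hy : y ∉ m x :: m y :: n₃ := fun hy =>
      (List.nodup_cons.1 (List.nodup_cons.1 hl).2).1 (hs.perm.subset hy)
    have hφ : (m x :: m y :: n₃).map (Equiv.swap (m x) y) = y :: m y :: n₃ := by
      simp only [List.mem_cons, not_or, List.nodup_cons] at hy hnd
      simp only [List.map_cons, Equiv.swap_apply_left, List.cons.injEq, true_and]
      refine ⟨Equiv.swap_apply_of_ne_of_ne (Ne.symm hnd.1.1) (Ne.symm hy.2.1), ?_⟩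
      refine (List.map_congr_left (g := _root_.id) fun k hk =>
        Equiv.swap_apply_of_ne_of_ne ?_ ?_).trans (List.map_id _)
      · rintro rfl; exact hnd.1.2 hk
      · rintro rfl; exact hy.2.2 hk
    have hg' := hg.map_label (Equiv.swap (m x) y) (Equiv.injective _)
    rw [hφ] at hg'
    have P₃ := (P₁.perm hg').vecMap_eq
      ((hg'.permRep.perm.nodup_iff).1 (hφ ▸ hnd.map (Equiv.injective _)))
    have k₁ := create_frontSwap_annihilate (X := letter δ .black) (Y := letter δ .white)
      (B := letter δ .white ⊗ ⟨u₃⟩) (D := ⟨w⟩)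
      (f₃ ≫ create (cupHom δ .black) ⟨u₃⟩) g
    have k₂ := create_frontSwap_annihilate (X := Z .black) (Y := Z .white)
      (B := Z .white ⊗ wordObj Z u₃) (D := wordObj Z w)
      (v₃ ≫ create (η_ (Z .black) (Z .white)) (wordObj Z u₃)) s
    rw [show η_ (letter δ .black) (letter δ .white) ≫ (β_ _ _).hom = cupHom δ .white from
      cupHom_braiding] at k₁
    refine (congrArg (vecMap Z ⟨w⟩) ((Category.assoc _ _ _).trans k₁)).trans (P₃.trans ?_)
    exact k₂.symm.trans (Category.assoc _ _ _).symm

end Realize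

end SkeletonCat

namespace SkeletonCat

open WordDiagram

variable {K : Type u} [Field K] {δ : K}

/-! ### Morphisms that act alike on vectors -/

section Realize

variable {T : Type u₁} [Category.{v₁} T] [MonoidalCategory T] [SymmetricCategory T]
  {Z : Letter → T} [ExactPairing (Z .black) (Z .white)] [Preadditive T] [Linear K T]

theorem vecMap_eqToHom {a b : SkeletonCat δ} (h : a = b) (f : 𝟙_ (SkeletonCat δ) ⟶ a) :
    vecMap Z b (f ≫ eqToHom h) = vecMap Z a f ≫ eqToHom (by rw [h]) := by
  subst h; simp

/-- A permutation of factors acts on vectors as a permutation of letters. -/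
theorem exists_vecMap_perm {ι : Type*} {l l' : List ι} {w w' : Word} (hl : l.Nodup)
    {t : wordObj Z w ⟶ wordObj Z w'} (h : PermRep Z l w l' w' t) :
    ∃ g : (⟨w⟩ : SkeletonCat δ) ⟶ ⟨w'⟩, ∀ f : 𝟙_ (SkeletonCat δ) ⟶ ⟨w⟩,
      vecMap Z ⟨w'⟩ (f ≫ g) = vecMap Z ⟨w⟩ f ≫ t := by
  classical
  have h₁ : l.map (fun x => l.idxOf x) = List.range w.length := by
    apply List.ext_getElem
    · simp [h.length.1]
    · intro i h₁ h₂
      simp [hl.idxOf_getElem]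
  obtain ⟨g, hg⟩ := (h.map_label (fun x => l.idxOf x)
    fun x hx y hy hxy => (List.idxOf_inj hx).1 hxy).exists_permPair (δ := δ)
  exact ⟨g, vecMap_permPair h₁ hg⟩

/-- The morphism `t` acts on vectors as the morphism `g` of the skeleton category does, also in the
presence of a further factor. -/
def Realizes {a b : SkeletonCat δ} (g : a ⟶ b) (t : wordObj Z a.word ⟶ wordObj Z b.word) : Prop :=
  ∀ (z : SkeletonCat δ) (f : 𝟙_ (SkeletonCat δ) ⟶ a ⊗ z),
    vecMap Z (b ⊗ z) (f ≫ g ▷ z) = vecMap Z (a ⊗ z) f ≫ wordWhisker t z.word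

namespace Realizes

theorem id (a : SkeletonCat δ) : Realizes (𝟙 a) (𝟙 (wordObj Z a.word)) := fun z f => by
  rw [wordWhisker_id, id_whiskerRight, Category.comp_id]
  exact (Category.comp_id _).symm

theorem comp {a b c : SkeletonCat δ} {g : a ⟶ b} {g' : b ⟶ c}
    {t : wordObj Z a.word ⟶ wordObj Z b.word} {t' : wordObj Z b.word ⟶ wordObj Z c.word}
    (h : Realizes g t) (h' : Realizes g' t') : Realizes (g ≫ g') (t ≫ t') := fun z f => by
  rw [comp_whiskerRight, ← Category.assoc, h', h, wordWhisker_comp]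
  exact Category.assoc _ _ _

/-- The additional factor in the definition of `Realizes` absorbs the whiskering. -/
theorem whiskerRight {a b : SkeletonCat δ} {g : a ⟶ b} {t : wordObj Z a.word ⟶ wordObj Z b.word}
    (h : Realizes g t) (c : SkeletonCat δ) :
    Realizes (g ▷ c) (wordWhisker t c.word) := fun z f => by
  have h₁ := h (c ⊗ z) (f ≫ (α_ a c z).hom)
  have h₂ : (g ▷ c) ▷ z = (α_ a c z).hom ≫ g ▷ (c ⊗ z) ≫ (α_ b c z).inv := by simp
  have h₃ : (α_ b c z).inv = eqToHom (congrArg SkeletonCat.mk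
    (List.append_assoc b.word c.word z.word).symm) := rfl
  rw [h₂, ← Category.assoc, ← Category.assoc, h₃, vecMap_eqToHom, h₁, associator_hom_eq,
    vecMap_eqToHom]
  refine Eq.trans ?_ (congrArg _ (wordWhisker_wordWhisker t c.word z.word).symm)
  simp only [Category.assoc]
  rfl

theorem of_permRep {w w' : Word} {l' : List ℕ} {t : wordObj Z w ⟶ wordObj Z w'}
    (ht : PermRep Z (List.range w.length) w l' w' t) {p : WordEquiv w w'}
    (hp : ∀ i, l'[(p.toEquiv i).val]? = (List.range w.length)[i.val]?) :
    Realizes (ofDiagram (ofEquiv p) : (⟨w⟩ : SkeletonCat δ) ⟶ ⟨w'⟩) t := by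
  rintro ⟨z⟩ f
  have h := ht.whisker ((List.range z.length).map (w.length + ·)) z (by simp)
  have e : (ofDiagram (ofEquiv p) : (⟨w⟩ : SkeletonCat δ) ⟶ ⟨w'⟩) ▷ ⟨z⟩ =
      ofDiagram (ofEquiv (p.append (.ofEq rfl))) := by
    have := ofDiagram_tensor (δ := δ) (a := ⟨w⟩) (b := ⟨w'⟩) (c := ⟨z⟩) (d := ⟨z⟩) (ofEquiv p)
      (WordDiagram.id z)
    rw [WordDiagram.id, tensor_ofEquiv] at this
    exact this
  refine vecMap_permPair (Z := Z) (w := w ++ z) (w' := w' ++ z) ?_ ⟨h, _, e, ?_⟩ f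
  · rw [List.length_append, List.range_add]
  · intro i
    rw [WordEquiv.append_ofEq_val]
    have hl' := ht.length.2.1
    split_ifs with hi
    · rw [List.getElem?_append_left (by rw [hl']; exact (p.toEquiv _).isLt),
        List.getElem?_append_left (by simpa using hi)]
      exact hp ⟨i.val, hi⟩
    · rw [List.getElem?_append_right (by rw [hl']; omega),
        List.getElem?_append_right (by simpa using hi), hl', List.length_range]
      congr 1
      omega

theorem exists_perm {a b : SkeletonCat δ} (p : WordEquiv a.word b.word) :
    ∃ t : wordObj Z a.word ⟶ wordObj Z b.word, Realizes (ofDiagram (ofEquiv p) : a ⟶ b) t := by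
  obtain ⟨l', t, ht, hp⟩ := WordEquiv.exists_permRep_range Z p
  exact ⟨t, of_permRep ht hp⟩

/-- The braiding of two words is realized by the braiding of their tensor products. -/
theorem braiding (a b : SkeletonCat δ) : Realizes (Z := Z) (β_ a b).hom
    ((wordAppend Z a.word b.word).hom ≫ (β_ _ _).hom ≫ (wordAppend Z b.word a.word).inv) := by
  have h := PermRep.blockSwap (Z := Z) (List.range' 0 a.word.length)
    (List.range' a.word.length b.word.length) a.word b.word (by simp) (by simp)
    (List.disjoint_left.2 fun x hx => by simp [List.mem_range'_1] at hx ⊢; omega)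
  have h' : List.range' 0 a.word.length ++ List.range' a.word.length b.word.length =
      List.range (a.word ++ b.word).length := by
    have := List.range'_append_1 (s := 0) (m := a.word.length) (n := b.word.length)
    rw [Nat.zero_add] at this
    rw [this, List.range_eq_range', List.length_append]
  rw [h'] at h
  refine of_permRep (w := a.word ++ b.word) (w' := b.word ++ a.word) h
    (p := WordEquiv.swap a.word b.word) fun i => ?_
  have hi : i.val < a.word.length + b.word.length := i.isLt.trans_eq List.length_append
  rw [WordEquiv.swap_val, List.getElem?_range i.isLt]
  generalize i.val = k at hi
  split_ifs with h₁
  · rw [List.getElem?_append_right (by simp)]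
    simp [h₁]
  · rw [List.getElem?_append_left (by simp; omega), List.getElem?_range' (by omega)]
    simp
    omega

theorem cupHom : Realizes (cupHom δ .black)
    (create (η_ (Z .black) (Z .white)) (𝟙_ T) : 𝟙_ T ⟶ wordObj Z [.black, .white]) := fun z f => by
  have h₁ := vecMap_create (Z := Z) (w := z.word) f .black
  rw [create_cupHom] at h₁
  have h₂ := wordWhisker_create (Z := Z) (a := .black) (b := .white) (η_ (Z .black) (Z .white))
    [] z.word
  exact h₁.trans (congrArg _ h₂.symm)

variable [MonoidalPreadditive T]

theorem zero (a b : SkeletonCat δ) :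
    Realizes (0 : a ⟶ b) (0 : wordObj Z a.word ⟶ wordObj Z b.word) := fun z f => by
  simp [wordWhisker, MonoidalPreadditive.zero_whiskerRight]

theorem add {a b : SkeletonCat δ} {g g' : a ⟶ b} {t t' : wordObj Z a.word ⟶ wordObj Z b.word}
    (h : Realizes g t) (h' : Realizes g' t') : Realizes (g + g') (t + t') := fun z f => by
  have : wordWhisker (t + t') z.word = wordWhisker t z.word + wordWhisker t' z.word := by
    simp [wordWhisker]
  rw [MonoidalPreadditive.add_whiskerRight, Preadditive.comp_add, map_add, h, h', this]
  exact (Preadditive.comp_add _ _ _ _ _ _).symm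

variable [MonoidalLinear K T]

theorem smul (r : K) {a b : SkeletonCat δ} {g : a ⟶ b} {t : wordObj Z a.word ⟶ wordObj Z b.word}
    (h : Realizes g t) : Realizes (r • g) (r • t) := fun z f => by
  have : wordWhisker (r • t) z.word = r • wordWhisker t z.word := by
    simp [wordWhisker]
  rw [MonoidalLinear.smul_whiskerRight, Linear.comp_smul, map_smul, h, this]
  exact (Linear.comp_smul _ _ _ _ _ _).symm

theorem capHom (hdim : η_ (Z .black) (Z .white) ≫ (β_ _ _).hom ≫
    ε_ (Z .black) (Z .white) = δ • 𝟙 (𝟙_ T)) : Realizes (capHom δ .white)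
    (annihilate (ε_ (Z .black) (Z .white)) (𝟙_ T) : wordObj Z [.white, .black] ⟶ 𝟙_ T) := by
  rintro ⟨z⟩ f
  have h₁ : (vecMap Z ⟨z⟩).comp
      (Linear.rightComp K _ (annihilate (SkeletonCat.capHom δ .white) ⟨z⟩)) =
      (Linear.rightComp K _ (annihilate (ε_ (Z .black) (Z .white)) (wordObj Z z))).comp
        (vecMap Z ⟨.white :: .black :: z⟩) := by
    refine vector_linear_ext fun M => ?_
    have h := vecPair_vecMap (δ := δ) (w := .white :: .black :: z) Z M
    have h' : List.range (Letter.white :: Letter.black :: z).length =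
        0 :: 1 :: (List.range z.length).map (· + 2) := by
      rw [List.length_cons, List.length_cons, List.range_succ_eq_map, List.range_succ_eq_map]
      simp
    have hnd := h' ▸ List.nodup_range (n := (Letter.white :: Letter.black :: z).length)
    rw [h'] at h
    exact h.vecMap_annihilate hdim M.mateFun_involutive hnd
  have h₂ : wordWhisker (w := [.white, .black]) (w' := [])
      (annihilate (ε_ (Z .black) (Z .white)) (𝟙_ T)) z =
      annihilate (ε_ (Z .black) (Z .white)) (wordObj Z z) := by
    have : ∀ {X Y B : T} (e : X ⊗ Y ⟶ 𝟙_ T), (whiskerLeftIso X (whiskerLeftIso Y (λ_ B).symm ≪≫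
        (α_ Y (𝟙_ T) B).symm) ≪≫ (α_ X (Y ⊗ 𝟙_ T) B).symm).hom ≫ annihilate e (𝟙_ T) ▷ B ≫
        (λ_ B).symm.inv = annihilate e B := by
      intro X Y B e
      simp [annihilate]
    exact this _
  have h₃ := LinearMap.congr_fun h₁ f
  simp only [LinearMap.comp_apply, Linear.rightComp_apply, annihilate_capHom] at h₃
  exact h₃.trans (congrArg _ h₂.symm)

/-- Every morphism of the skeleton category acts on vectors as a morphism of the target does,
provided that the dual pair has dimension `δ`. -/
theorem exists_of_dimension (hdim : η_ (Z .black) (Z .white) ≫ (β_ _ _).hom ≫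
    ε_ (Z .black) (Z .white) = δ • 𝟙 (𝟙_ T)) {a b : SkeletonCat δ} (g : a ⟶ b) :
    ∃ t : wordObj Z a.word ⟶ wordObj Z b.word, Realizes g t := by
  refine TensorClosed.all
    (P := fun a b g => ∃ t : wordObj Z a.word ⟶ wordObj Z b.word, Realizes g t)
    { comp := fun ⟨_, h⟩ ⟨_, h'⟩ => ⟨_, h.comp h'⟩
      zero := fun a b => ⟨_, zero a b⟩
      add := fun ⟨_, h⟩ ⟨_, h'⟩ => ⟨_, h.add h'⟩
      smul := fun r _ _ _ ⟨_, h⟩ => ⟨_, h.smul r⟩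
      whiskerRight := fun c ⟨_, h⟩ => ⟨_, h.whiskerRight c⟩
      perm := exists_perm
      cup := ⟨_, cupHom⟩
      cap := ⟨_, capHom hdim⟩ } g

end Realizes

/-- Bending the first factor of the source to the target turns a morphism detected by vectors into
a morphism detected by vectors. -/
theorem vecMap_bend (b : Letter) {w w' : Word}
    {t t' : wordObj Z (b.flip :: w) ⟶ wordObj Z w'}
    (h : ∀ (z : Word) (f : 𝟙_ (SkeletonCat δ) ⟶ ⟨(b.flip :: w) ++ z⟩),
      vecMap Z ⟨(b.flip :: w) ++ z⟩ f ≫ wordWhisker t z =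
        vecMap Z ⟨(b.flip :: w) ++ z⟩ f ≫ wordWhisker t' z)
    (z : Word) (f : 𝟙_ (SkeletonCat δ) ⟶ ⟨w ++ z⟩) :
    vecMap Z ⟨w ++ z⟩ f ≫ wordWhisker (w' := b :: w')
      (create (letterCup (η_ (Z .black) (Z .white)) b) (wordObj Z w) ≫ Z b ◁ t) z =
    vecMap Z ⟨w ++ z⟩ f ≫ wordWhisker (w' := b :: w')
      (create (letterCup (η_ (Z .black) (Z .white)) b) (wordObj Z w) ≫ Z b ◁ t') z := by
  have h₁ : PermRep Z (0 :: (List.range' 1 (b.flip :: w).length ++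
      List.range' (1 + (b.flip :: w).length) z.length)) (b :: ((b.flip :: w) ++ z)) _ _ _ :=
    PermRep.moveLetter (Z := Z) (0 : ℕ) b (List.range' (1 + (b.flip :: w).length) z.length) z
      (by simp) (List.range' 1 (b.flip :: w).length) (b.flip :: w) (by simp)
      (by simp [List.mem_range', Nat.add_comm 1])
  have hnd : (0 :: (List.range' 1 (b.flip :: w).length ++
      List.range' (1 + (b.flip :: w).length) z.length)).Nodup := by
    rw [List.range'_append_1]
    exact (List.range'_succ (s := 0) (n := _) (step := 1)) ▸ List.nodup_range'
  obtain ⟨g, hg⟩ := exists_vecMap_perm (δ := δ) hnd h₁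
  have key : ∀ t : wordObj Z (b.flip :: w) ⟶ wordObj Z w', (vecMap Z ⟨w ++ z⟩ f ≫
      wordWhisker (w' := b :: w') (create (letterCup (η_ (Z .black) (Z .white)) b) (wordObj Z w) ≫
        Z b ◁ t) z) ≫ (Z b ◁ (wordAppend Z w' z).hom ≫ frontSwap _ _ _ ≫
          (wordAppend Z w' (b :: z)).inv) =
      vecMap Z ⟨(b.flip :: w) ++ b :: z⟩ ((f ≫ create (cupHom δ b) ⟨w ++ z⟩) ≫ g) ≫
        wordWhisker t (b :: z) := by
    intro t
    have e := hg (f ≫ create (cupHom δ b) ⟨w ++ z⟩)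
    have e' := e.trans (congrArg (· ≫ _) (vecMap_create (Z := Z) f b))
    have e₁ : wordWhisker (w' := b :: w')
        (create (letterCup (η_ (Z .black) (Z .white)) b) (wordObj Z w) ≫ Z b ◁ t) z =
        create (letterCup (η_ (Z .black) (Z .white)) b) (wordObj Z (w ++ z)) ≫
          Z b ◁ wordWhisker t z :=
      (wordWhisker_comp (w' := b :: b.flip :: w) (w'' := b :: w') _ _ z).trans
        (congrArg₂ (· ≫ ·) (wordWhisker_create _ w z) (wordWhisker_cons b t z))
    have : ∀ {A B C D E F : T} {v : A ⟶ B} {c : B ⟶ C} {s : C ⟶ D} {m' : D ⟶ F} {m : C ⟶ E}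
        {t : E ⟶ F} (_ : s ≫ m' = m ≫ t), (v ≫ c ≫ s) ≫ m' = ((v ≫ c) ≫ m) ≫ t := by
      intro A B C D E F v c s m' m t H
      simp [H]
    refine Eq.trans ?_ (congrArg (· ≫ wordWhisker t (b :: z)) e'.symm)
    rw [e₁]
    exact this (wordWhisker_moveLetter b t z)
  have : ∀ {A B C D E : T} (i : A ≅ B ⊗ C) (j : E ≅ B ⊗ (Z b ⊗ C)) {f g : D ⟶ Z b ⊗ A}
      (_ : f ≫ Z b ◁ i.hom ≫ frontSwap (Z b) B C ≫ j.inv =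
        g ≫ Z b ◁ i.hom ≫ frontSwap (Z b) B C ≫ j.inv), f = g := by
    intro A B C D E i j f g H
    exact (cancel_mono _).1 H
  exact this _ _ ((key t).trans ((h _ _).trans (key t').symm))

/-- A morphism between tensor products of letters is determined by its action on vectors. -/
theorem eq_of_vecMap {w w' : Word} {t t' : wordObj Z w ⟶ wordObj Z w'}
    (h : ∀ (z : Word) (f : 𝟙_ (SkeletonCat δ) ⟶ ⟨w ++ z⟩),
      vecMap Z ⟨w ++ z⟩ f ≫ wordWhisker t z = vecMap Z ⟨w ++ z⟩ f ≫ wordWhisker t' z) : t = t' := by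
  induction w generalizing w' with
  | nil =>
    have h₁ := h [] (𝟙 _)
    have h₃ : ∀ {B C D : T} (i : 𝟙_ T ≅ B) (j : C ≅ D) {v : 𝟙_ T ⟶ 𝟙_ T} (_ : v = 𝟙 _) {f g : B ⟶ D}
        (_ : v ≫ i.hom ≫ f ≫ j.inv = v ≫ i.hom ≫ g ≫ j.inv), f = g := by
      rintro B C D i j _ rfl f g H
      simpa using H
    exact (whiskerRight_iff _ _).1 (h₃ _ _ vecMap_id h₁)
  | cons a w ih =>
    cases a with
    | black =>
      let := BraidedCategory.exactPairing_swap (Z .black) (Z .white)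
      have h₂ : η_ (Z .white) (Z .black) = letterCup (η_ (Z .black) (Z .white)) .white := by
        change _ ≫ (β_ _ _).inv = _ ≫ (β_ _ _).hom
        rw [SymmetricCategory.braiding_swap_eq_inv_braiding]
      refine eq_of_create_eq (X := Z .white) (Y := Z .black) ?_
      rw [h₂]
      exact ih (w' := .white :: w') (vecMap_bend .white h)
    | white =>
      exact eq_of_create_eq (X := Z .black) (Y := Z .white)
        (ih (w' := .black :: w') (vecMap_bend .black h))

theorem Realizes.unique {a b : SkeletonCat δ} {g : a ⟶ b}
    {t t' : wordObj Z a.word ⟶ wordObj Z b.word} (h : Realizes g t) (h' : Realizes g t') :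
    t = t' :=
  eq_of_vecMap (δ := δ) fun z f => (h ⟨z⟩ f).symm.trans (h' ⟨z⟩ f)

end Realize

end SkeletonCat

namespace SkeletonCat

open WordDiagram

variable {K : Type u} [Field K] {δ : K}

/-! ### The tensor functor of a dual pair of dimension `δ` -/

section WordFunctor

variable {T : Type u₁} [Category.{v₁} T] [MonoidalCategory T] [SymmetricCategory T]
  (Z : Letter → T) [ExactPairing (Z .black) (Z .white)] [Preadditive T] [Linear K T]
  [MonoidalPreadditive T] [MonoidalLinear K T]
  (hdim : η_ (Z .black) (Z .white) ≫ (β_ _ _).hom ≫ ε_ (Z .black) (Z .white) = δ • 𝟙 (𝟙_ T))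

/-- The functor that sends a word to the tensor product of the objects `Z` and a morphism to the
morphism with the same action on vectors. -/
noncomputable def wordFunctor : SkeletonCat δ ⥤ T where
  obj a := wordObj Z a.word
  map g := (Realizes.exists_of_dimension hdim g).choose
  map_id a := (Realizes.exists_of_dimension hdim (𝟙 a)).choose_spec.unique (.id a)
  map_comp f g := (Realizes.exists_of_dimension hdim (f ≫ g)).choose_spec.unique
    (.comp (Realizes.exists_of_dimension hdim f).choose_spec
      (Realizes.exists_of_dimension hdim g).choose_spec)

variable {Z}

theorem realizes_map {a b : SkeletonCat δ} (g : a ⟶ b) :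
    Realizes g ((wordFunctor Z hdim).map g) :=
  (Realizes.exists_of_dimension hdim g).choose_spec

instance : (wordFunctor Z hdim).Additive where
  map_add {_ _ f g} := (realizes_map hdim (f + g)).unique
    ((realizes_map hdim f).add (realizes_map hdim g))

instance : (wordFunctor Z hdim).Linear K where
  map_smul f r := (realizes_map hdim (r • f)).unique ((realizes_map hdim f).smul r)

theorem wordFunctor_map_whiskerRight {a b : SkeletonCat δ} (f : a ⟶ b) (c : SkeletonCat δ) :
    (wordFunctor Z hdim).map (f ▷ c) = (wordAppend Z a.word c.word).hom ≫
      (wordFunctor Z hdim).map f ▷ wordObj Z c.word ≫ (wordAppend Z b.word c.word).inv :=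
  (realizes_map hdim (f ▷ c)).unique ((realizes_map hdim f).whiskerRight c)

theorem wordFunctor_map_braiding (a b : SkeletonCat δ) :
    (wordFunctor Z hdim).map (β_ a b).hom =
      (wordAppend Z a.word b.word).hom ≫ (β_ _ _).hom ≫ (wordAppend Z b.word a.word).inv :=
  (realizes_map hdim (β_ a b).hom).unique (.braiding a b)

theorem wordFunctor_map_whiskerLeft {a b : SkeletonCat δ} (f : a ⟶ b) (c : SkeletonCat δ) :
    (wordFunctor Z hdim).map (c ◁ f) = (wordAppend Z c.word a.word).hom ≫
      wordObj Z c.word ◁ (wordFunctor Z hdim).map f ≫ (wordAppend Z c.word b.word).inv := by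
  have : c ◁ f = (β_ c a).hom ≫ f ▷ c ≫ (β_ b c).hom := by
    rw [← BraidedCategory.braiding_naturality_right_assoc]; simp
  rw [this, Functor.map_comp, Functor.map_comp, wordFunctor_map_braiding, wordFunctor_map_braiding,
    wordFunctor_map_whiskerRight]
  have : ∀ {A B C D E G H : T} (f : A ⟶ B) (i : D ≅ C ⊗ A) (j : E ≅ A ⊗ C) (k : G ≅ B ⊗ C)
      (l : H ≅ C ⊗ B), (i.hom ≫ (β_ C A).hom ≫ j.inv) ≫ (j.hom ≫ f ▷ C ≫ k.inv) ≫
        (k.hom ≫ (β_ B C).hom ≫ l.inv) = i.hom ≫ C ◁ f ≫ l.inv := by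
    intro A B C D E G H f i j k l
    have h := BraidedCategory.braiding_naturality_right_assoc C f ((β_ _ _).hom ≫ l.inv)
    rw [SymmetricCategory.symmetry_assoc] at h
    simp only [Category.assoc, Iso.inv_hom_id_assoc, h]
  exact this _ _ _ _ _

noncomputable instance : (wordFunctor Z hdim).Monoidal :=
  Functor.CoreMonoidal.toMonoidal <| Functor.CoreMonoidal.mk' (Iso.refl _)
    (fun a b => (wordAppend Z a.word b.word).symm)
    (fun f c => by
      rw [wordFunctor_map_whiskerRight]
      have : ∀ {A B C D : T} (i : A ≅ B) (f : B ⟶ C) (j : D ≅ C),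
        i.symm.inv ≫ f = (i.hom ≫ f ≫ j.inv) ≫ j.symm.inv := by intros; simp
      exact this _ _ _)
    (fun c f => by
      rw [wordFunctor_map_whiskerLeft]
      have : ∀ {A B C D : T} (i : A ≅ B) (f : B ⟶ C) (j : D ≅ C),
        i.symm.inv ≫ f = (i.hom ≫ f ≫ j.inv) ≫ j.symm.inv := by intros; simp
      exact this _ _ _)
    (fun a b c => by
      rw [associator_hom_eq, eqToHom_map]
      exact wordAppend_assoc (Z := Z) a.word b.word c.word)
    (fun a => by
      have : ∀ A : T, (λ_ A).inv = 𝟙 _ ≫ (λ_ A).inv ≫ 𝟙 (𝟙_ T) ▷ A := by intros; simp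
      rw [show (λ_ a).inv = eqToHom (congrArg SkeletonCat.mk (List.nil_append a.word).symm)
        from rfl, eqToHom_map]
      exact this _)
    (fun a => by
      have : ∀ {A B C : T} (h : A = C) (i : C ≅ A ⊗ B) (r : A ⊗ B ≅ A)
          (_ : i.hom ≫ r.hom = eqToHom h.symm), r.inv = eqToHom h ≫ i.hom ≫ A ◁ 𝟙 B := by
        intro A B C h i r H
        subst h
        rw [eqToHom_refl, Category.id_comp, MonoidalCategory.whiskerLeft_id, Category.comp_id]
        exact ((Iso.comp_hom_eq_id _).1 H).symm
      rw [show (ρ_ a).inv = eqToHom (congrArg SkeletonCat.mk (List.append_nil a.word).symm)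
        from rfl, eqToHom_map]
      exact this _ _ _ (wordAppend_nil (Z := Z) a.word))

noncomputable instance : (wordFunctor Z hdim).Braided where
  braided a b := by
    rw [wordFunctor_map_braiding]
    exact Iso.inv_hom_id_assoc _ _

variable (Z)

/-- The functor `wordFunctor` as a tensor functor. -/
noncomputable def wordTensorFunctor : TensorFunctor K (SkeletonCat δ) T where
  functor := wordFunctor Z hdim

theorem wordTensorFunctor_isStrict [IsStrictMonoidal T] :
    (wordTensorFunctor Z hdim).IsStrict where
  obj_tensor a b := (wordAppend_eq_eqToHom a.word b.word).choose
  obj_unit := rfl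
  δ_eq a b := (wordAppend_eq_eqToHom a.word b.word).choose_spec
  η_eq := rfl

end WordFunctor

end SkeletonCat

/-! ### Dual objects and monoidal transformations -/

section Dual

open Functor.LaxMonoidal Functor.OplaxMonoidal

variable {C : Type u₁} [Category.{v₁} C] [MonoidalCategory C] {D : Type u₂} [Category.{v₂} D]
  [MonoidalCategory D]

/-- A monoidal functor maps a dual pair to a dual pair. -/
@[reducible]
def mapExactPairing (F : C ⥤ D) [F.Monoidal] (X Y : C) [ExactPairing X Y] :
    ExactPairing (F.obj X) (F.obj Y) where
  coevaluation' := ε F ≫ F.map (η_ X Y) ≫ δ F X Y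
  evaluation' := μ F Y X ≫ F.map (ε_ X Y) ≫ η F
  coevaluation_evaluation' := by
    have h := congrArg (fun t => F.obj Y ◁ ε F ≫ μ F Y _ ≫ F.map t ≫ δ F _ Y ≫ η F ▷ F.obj Y)
      (ExactPairing.coevaluation_evaluation X Y)
    simp only [Functor.map_comp, Functor.Monoidal.map_whiskerLeft, whiskerLeft_comp,
      comp_whiskerRight, Functor.Monoidal.map_whiskerRight, Functor.Monoidal.map_associator_inv,
      Functor.Monoidal.map_rightUnitor, Functor.Monoidal.map_leftUnitor_inv, Category.assoc,
      Functor.Monoidal.μ_δ_assoc,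
      Functor.Monoidal.whiskerLeft_ε_η_assoc, Functor.Monoidal.whiskerRight_ε_η,
      Category.comp_id] at h ⊢
    exact h
  evaluation_coevaluation' := by
    have h := congrArg (fun t => ε F ▷ F.obj X ≫ μ F _ X ≫ F.map t ≫ δ F X _ ≫ F.obj X ◁ η F)
      (ExactPairing.evaluation_coevaluation X Y)
    simp only [Functor.map_comp, Functor.Monoidal.map_whiskerLeft, whiskerLeft_comp,
      comp_whiskerRight, Functor.Monoidal.map_whiskerRight, Functor.Monoidal.map_associator,
      Functor.Monoidal.map_leftUnitor, Functor.Monoidal.map_rightUnitor_inv, Category.assoc,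
      Functor.Monoidal.μ_δ_assoc,
      Functor.Monoidal.whiskerRight_ε_η_assoc, Functor.Monoidal.whiskerLeft_ε_η,
      Category.comp_id] at h ⊢
    exact h

/-- The transpose of `f` with respect to two dual pairs. -/
def transpose {X Y X' Y' : D} [ExactPairing X Y] [ExactPairing X' Y'] (f : X' ⟶ X) : Y ⟶ Y' :=
  (ρ_ Y).inv ≫ Y ◁ (η_ X' Y' ≫ f ▷ Y') ≫ (α_ _ _ _).inv ≫ ε_ X Y ▷ Y' ≫ (λ_ Y').hom

theorem coevaluation_transpose {X Y X' Y' : D} [ExactPairing X Y] [ExactPairing X' Y']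
    (f : X' ⟶ X) : η_ X Y ≫ X ◁ transpose f = η_ X' Y' ≫ f ▷ Y' := by
  calc _ = 𝟙 _ ⊗≫ (η_ X Y ▷ 𝟙_ D ≫ (X ⊗ Y) ◁ (η_ X' Y' ≫ f ▷ Y')) ⊗≫ X ◁ ε_ X Y ▷ Y' ⊗≫ 𝟙 _ := by
        unfold transpose; monoidal
    _ = (η_ X' Y' ≫ f ▷ Y') ⊗≫ (η_ X Y ▷ X ⊗≫ X ◁ ε_ X Y) ▷ Y' ⊗≫ 𝟙 _ := by
        rw [← whisker_exchange]; monoidal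
    _ = _ := by rw [ExactPairing.evaluation_coevaluation'']; monoidal

theorem transpose_evaluation {X Y X' Y' : D} [ExactPairing X Y] [ExactPairing X' Y']
    (f : X' ⟶ X) : transpose f ▷ X' ≫ ε_ X' Y' = Y ◁ f ≫ ε_ X Y := by
  calc _ = 𝟙 _ ⊗≫ Y ◁ (η_ X' Y' ▷ X') ⊗≫ Y ◁ f ▷ (Y' ⊗ X') ⊗≫ (ε_ X Y ▷ (Y' ⊗ X') ≫
        𝟙_ D ◁ ε_ X' Y') ⊗≫ 𝟙 _ := by
        unfold transpose; monoidal
    _ = 𝟙 _ ⊗≫ Y ◁ (η_ X' Y' ▷ X') ⊗≫ Y ◁ (f ▷ (Y' ⊗ X') ≫ X ◁ ε_ X' Y') ⊗≫ ε_ X Y ⊗≫ 𝟙 _ := by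
        rw [← whisker_exchange]; monoidal
    _ = 𝟙 _ ⊗≫ Y ◁ (η_ X' Y' ▷ X' ⊗≫ X' ◁ ε_ X' Y') ⊗≫ Y ◁ f ⊗≫ ε_ X Y ⊗≫ 𝟙 _ := by
        rw [← whisker_exchange]; monoidal
    _ = _ := by rw [ExactPairing.evaluation_coevaluation'']; monoidal

/-- A morphism that, together with `g`, respects two dual pairs is invertible; its inverse is the
transpose of `g`. -/
theorem isIso_of_dual {X Y X' Y' : D} [ExactPairing X Y] [ExactPairing X' Y'] {f : X ⟶ X'}
    {g : Y ⟶ Y'} (hη : η_ X Y ≫ (f ⊗ₘ g) = η_ X' Y') (hε : (g ⊗ₘ f) ≫ ε_ X' Y' = ε_ X Y) :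
    IsIso f := by
  refine ⟨(λ_ X').inv ≫ η_ X Y ▷ X' ≫ (α_ _ _ _).hom ≫ X ◁ (g ▷ X' ≫ ε_ X' Y') ≫ (ρ_ X).hom,
    ?_, ?_⟩
  · calc _ = 𝟙 _ ⊗≫ (𝟙_ D ◁ f ≫ η_ X Y ▷ X') ⊗≫ X ◁ (g ▷ X' ≫ ε_ X' Y') ⊗≫ 𝟙 _ := by monoidal
      _ = 𝟙 _ ⊗≫ η_ X Y ▷ X ⊗≫ X ◁ ((g ⊗ₘ f) ≫ ε_ X' Y') ⊗≫ 𝟙 _ := by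
        rw [whisker_exchange, MonoidalCategory.tensorHom_def']; monoidal
      _ = 𝟙 _ ⊗≫ (η_ X Y ▷ X ⊗≫ X ◁ ε_ X Y) ⊗≫ 𝟙 _ := by rw [hε]; monoidal
      _ = _ := by rw [ExactPairing.evaluation_coevaluation'']; monoidal
  · calc _ = 𝟙 _ ⊗≫ (η_ X Y ≫ X ◁ g) ▷ X' ⊗≫ (X ◁ ε_ X' Y' ≫ f ▷ 𝟙_ D) ⊗≫ 𝟙 _ := by monoidal
      _ = 𝟙 _ ⊗≫ (η_ X Y ≫ (f ⊗ₘ g)) ▷ X' ⊗≫ X' ◁ ε_ X' Y' ⊗≫ 𝟙 _ := by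
        rw [whisker_exchange, MonoidalCategory.tensorHom_def']; monoidal
      _ = 𝟙 _ ⊗≫ (η_ X' Y' ▷ X' ⊗≫ X' ◁ ε_ X' Y') ⊗≫ 𝟙 _ := by rw [hη]; monoidal
      _ = _ := by rw [ExactPairing.evaluation_coevaluation'']; monoidal

/-- Compatibility with the evaluation determines the second component of a morphism of dual pairs
from an invertible first component. -/
theorem eq_of_dual {X Y X' Y' : D} [ExactPairing X' Y'] {f : X ⟶ X'} [IsIso f] {g g' : Y ⟶ Y'}
    (h : (g ⊗ₘ f) ≫ ε_ X' Y' = (g' ⊗ₘ f) ≫ ε_ X' Y') : g = g' := by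
  rw [MonoidalCategory.tensorHom_def', MonoidalCategory.tensorHom_def', Category.assoc,
    Category.assoc, cancel_epi] at h
  have e : (tensorRightHomEquiv Y' X' Y' (𝟙_ D)).symm (λ_ Y').inv = ε_ X' Y' := by
    simp [tensorRightHomEquiv, unitors_inv_equal]
  rw [← cancel_mono (λ_ Y').inv]
  apply (tensorRightHomEquiv Y X' Y' (𝟙_ D)).symm.injective
  rw [tensorRightHomEquiv_symm_naturality, tensorRightHomEquiv_symm_naturality, e, h]

variable {F G : C ⥤ D} [F.Monoidal] [G.Monoidal] (τ : F ⟶ G) [NatTrans.IsMonoidal τ]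

theorem map_coevaluation_comp (X Y : C) [ExactPairing X Y] :
    (ε F ≫ F.map (η_ X Y) ≫ δ F X Y) ≫ (τ.app X ⊗ₘ τ.app Y) = ε G ≫ G.map (η_ X Y) ≫ δ G X Y := by
  have h := NatTrans.IsMonoidal.tensor (τ := τ) X Y
  have h' : δ F X Y ≫ (τ.app X ⊗ₘ τ.app Y) = τ.app (X ⊗ Y) ≫ δ G X Y := by
    rw [← cancel_mono (μ G X Y), Category.assoc, Category.assoc, ← h, Functor.Monoidal.δ_μ_assoc,
      Functor.Monoidal.δ_μ, Category.comp_id]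
  rw [Category.assoc, Category.assoc, h', NatTrans.naturality_assoc,
    ← NatTrans.IsMonoidal.unit (τ := τ), Category.assoc]

theorem comp_map_evaluation (X Y : C) [ExactPairing X Y] :
    (τ.app Y ⊗ₘ τ.app X) ≫ μ G Y X ≫ G.map (ε_ X Y) ≫ η G = μ F Y X ≫ F.map (ε_ X Y) ≫ η F := by
  have h : τ.app (𝟙_ C) ≫ η G = η F := by
    rw [← cancel_epi (ε F), ← Category.assoc, NatTrans.IsMonoidal.unit]; simp
  rw [← reassoc_of% (NatTrans.IsMonoidal.tensor (τ := τ) Y X), ← NatTrans.naturality_assoc, h]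

/-- A monoidal transformation is invertible on objects with a dual. -/
theorem isIso_app_of_dual (X Y : C) [ExactPairing X Y] : IsIso (τ.app X) :=
  let := mapExactPairing F X Y
  let := mapExactPairing G X Y
  isIso_of_dual (map_coevaluation_comp τ X Y) (comp_map_evaluation τ X Y)

variable {τ}

/-- The value of a monoidal transformation on an object determines the value on its dual. -/
theorem app_dual_eq {τ' : F ⟶ G} [NatTrans.IsMonoidal τ'] (X Y : C) [ExactPairing X Y]
    (h : τ.app X = τ'.app X) :
    τ.app Y = τ'.app Y := by
  let := mapExactPairing G X Y
  have := isIso_app_of_dual τ' X Y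
  have e := (comp_map_evaluation τ X Y).trans (comp_map_evaluation τ' X Y).symm
  rw [h] at e
  exact eq_of_dual e

end Dual

/-! ### Monoidal transformations between functors out of the skeleton category -/

section TensorApp

open Functor.LaxMonoidal Functor.OplaxMonoidal

variable {C : Type u₁} [Category.{v₁} C] [MonoidalCategory C] {D : Type u₂} [Category.{v₂} D]
  [MonoidalCategory D] {F G : C ⥤ D} [F.Monoidal] [G.Monoidal]

/-- The component on `A ⊗ B` of a monoidal transformation with components `f` on `A` and `g`
on `B`. -/
def tensorApp {A B : C} (f : F.obj A ⟶ G.obj A) (g : F.obj B ⟶ G.obj B) :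
    F.obj (A ⊗ B) ⟶ G.obj (A ⊗ B) :=
  δ F A B ≫ (f ⊗ₘ g) ≫ μ G A B

theorem μ_tensorApp {A B : C} (f : F.obj A ⟶ G.obj A) (g : F.obj B ⟶ G.obj B) :
    μ F A B ≫ tensorApp f g = (f ⊗ₘ g) ≫ μ G A B := by
  simp [tensorApp]

theorem tensorApp_leftUnitor {A : C} (f : F.obj A ⟶ G.obj A) :
    F.map (λ_ A).hom ≫ f = tensorApp (η F ≫ ε G) f ≫ G.map (λ_ A).hom := by
  rw [← cancel_epi (μ F (𝟙_ C) A), reassoc_of% μ_tensorApp, ← cancel_epi (ε F ▷ F.obj A)]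
  simp only [MonoidalCategory.tensorHom_def, comp_whiskerRight, Category.assoc,
    Functor.Monoidal.whiskerRight_ε_η_assoc]
  rw [← whisker_exchange_assoc, ← Functor.LaxMonoidal.left_unitality,
    ← Functor.LaxMonoidal.left_unitality_assoc, leftUnitor_naturality]

theorem tensorApp_rightUnitor {A : C} (f : F.obj A ⟶ G.obj A) :
    F.map (ρ_ A).hom ≫ f = tensorApp f (η F ≫ ε G) ≫ G.map (ρ_ A).hom := by
  rw [← cancel_epi (μ F A (𝟙_ C)), reassoc_of% μ_tensorApp, ← cancel_epi (F.obj A ◁ ε F)]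
  simp only [MonoidalCategory.tensorHom_def', whiskerLeft_comp, Category.assoc,
    Functor.Monoidal.whiskerLeft_ε_η_assoc]
  rw [whisker_exchange_assoc, ← Functor.LaxMonoidal.right_unitality,
    ← Functor.LaxMonoidal.right_unitality_assoc, rightUnitor_naturality]

theorem tensorApp_associator {A B E : C} (f : F.obj A ⟶ G.obj A) (g : F.obj B ⟶ G.obj B)
    (k : F.obj E ⟶ G.obj E) : F.map (α_ A B E).hom ≫ tensorApp f (tensorApp g k) =
      tensorApp (tensorApp f g) k ≫ G.map (α_ A B E).hom := by
  rw [← cancel_epi (μ F (A ⊗ B) E), reassoc_of% μ_tensorApp, ← cancel_epi (μ F A B ▷ F.obj E),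
    Functor.LaxMonoidal.associativity_assoc, μ_tensorApp, ← tensorHom_id, ← id_tensorHom,
    MonoidalCategory.tensorHom_comp_tensorHom_assoc,
    MonoidalCategory.tensorHom_comp_tensorHom_assoc, μ_tensorApp, μ_tensorApp, Category.id_comp,
    Category.id_comp]
  simp only [MonoidalCategory.tensorHom_def, comp_whiskerRight, whiskerLeft_comp, Category.assoc]
  rw [← whisker_exchange_assoc (μ G A B) k, Functor.LaxMonoidal.associativity]
  simp

theorem tensorApp_whiskerRight {A B E : C} {s : A ⟶ B} {f : F.obj A ⟶ G.obj A}
    {f' : F.obj B ⟶ G.obj B} (h : F.map s ≫ f' = f ≫ G.map s) (g : F.obj E ⟶ G.obj E) :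
    F.map (s ▷ E) ≫ tensorApp f' g = tensorApp f g ≫ G.map (s ▷ E) := by
  simp only [tensorApp, Functor.Monoidal.map_whiskerRight, Category.assoc,
    Functor.Monoidal.μ_δ_assoc, whiskerRight_comp_tensorHom_assoc, h,
    tensorHom_comp_whiskerRight_assoc]

theorem tensorApp_whiskerLeft {A B E : C} {s : A ⟶ B} {f : F.obj A ⟶ G.obj A}
    {f' : F.obj B ⟶ G.obj B} (h : F.map s ≫ f' = f ≫ G.map s) (g : F.obj E ⟶ G.obj E) :
    F.map (E ◁ s) ≫ tensorApp g f' = tensorApp g f ≫ G.map (E ◁ s) := by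
  simp only [tensorApp, Functor.Monoidal.map_whiskerLeft, Category.assoc,
    Functor.Monoidal.μ_δ_assoc, whiskerLeft_comp_tensorHom_assoc, h,
    tensorHom_comp_whiskerLeft_assoc]

theorem tensorApp_braiding {C : Type u₁} [Category.{v₁} C] [MonoidalCategory C] [BraidedCategory C]
    {D : Type u₂} [Category.{v₂} D] [MonoidalCategory D] [BraidedCategory D] {F G : C ⥤ D}
    [F.Braided] [G.Braided] {A B : C} (f : F.obj A ⟶ G.obj A) (g : F.obj B ⟶ G.obj B) :
    F.map (β_ A B).hom ≫ tensorApp g f = tensorApp f g ≫ G.map (β_ A B).hom := by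
  rw [← cancel_epi (μ F A B), reassoc_of% μ_tensorApp, Functor.map_braiding, Functor.map_braiding,
    tensorApp]
  simp

end TensorApp

namespace SkeletonCat

open Functor.LaxMonoidal Functor.OplaxMonoidal

section WordTransformation

variable {K : Type u} [Field K] {δ' : K} {D : Type u₂} [Category.{v₂} D] [MonoidalCategory D]

section

variable {F G : SkeletonCat δ' ⥤ D} [F.Monoidal] [G.Monoidal]

/-- The multiplicative extension of a family of morphisms indexed by the letters. -/
noncomputable def wordApp (n : ∀ a, F.obj (letter δ' a) ⟶ G.obj (letter δ' a)) :
    ∀ w : Word, F.obj ⟨w⟩ ⟶ G.obj ⟨w⟩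
  | [] => η F ≫ ε G
  | a :: w => tensorApp (A := letter δ' a) (B := ⟨w⟩) (n a) (wordApp n w)

variable {n : ∀ a, F.obj (letter δ' a) ⟶ G.obj (letter δ' a)}

theorem wordApp_append (w z : Word) : wordApp n (w ++ z) =
    tensorApp (A := (⟨w⟩ : SkeletonCat δ')) (B := ⟨z⟩) (wordApp n w) (wordApp n z) := by
  induction w with
  | nil =>
    have h := tensorApp_leftUnitor (wordApp n z)
    rw [show (λ_ (⟨z⟩ : SkeletonCat δ')).hom = 𝟙 _ from rfl, F.map_id, G.map_id] at h
    exact (Category.id_comp _).symm.trans (h.trans (Category.comp_id _))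
  | cons a w ih =>
    have h := tensorApp_associator (n a) (wordApp n w) (wordApp n z)
    rw [show (α_ (letter δ' a) ⟨w⟩ (⟨z⟩ : SkeletonCat δ')).hom = 𝟙 _ from rfl, F.map_id,
      G.map_id] at h
    refine Eq.trans ?_ ((Category.id_comp _).symm.trans (h.trans (Category.comp_id _)))
    exact congrArg (tensorApp (A := letter δ' a) (B := ⟨w ++ z⟩) (n a)) ih

theorem wordApp_tensor (a b : SkeletonCat δ') :
    wordApp n (a ⊗ b).word = tensorApp (wordApp n a.word) (wordApp n b.word) :=
  wordApp_append a.word b.word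

theorem wordApp_singleton (a : Letter) : wordApp n [a] = n a := by
  have h := tensorApp_rightUnitor (n a)
  rw [show (ρ_ (letter δ' a)).hom = 𝟙 _ from rfl, F.map_id, G.map_id] at h
  exact ((Category.id_comp _).symm.trans (h.trans (Category.comp_id _))).symm

/-- A monoidal transformation is the multiplicative extension of its values on letters. -/
theorem eq_wordApp (τ : F ⟶ G) [NatTrans.IsMonoidal τ] (w : Word) :
    τ.app ⟨w⟩ = wordApp (fun a => τ.app (letter δ' a)) w := by
  induction w with
  | nil =>
    have h : ∀ (f : F.obj (𝟙_ _) ⟶ G.obj (𝟙_ _)), ε F ≫ f = ε G → f = η F ≫ ε G := by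
      rintro f h; simp [← h]
    exact h _ NatTrans.IsMonoidal.unit
  | cons a w ih =>
    have h := NatTrans.IsMonoidal.tensor (τ := τ) (letter δ' a) ⟨w⟩
    rw [ih] at h
    exact (Functor.Monoidal.δ_μ_assoc _ _ _ _).symm.trans (congrArg (δ F _ _ ≫ ·) h)

end

section Natural

variable [SymmetricCategory D] [Preadditive D] [Linear K D]
  {F G : SkeletonCat δ' ⥤ D} [F.Braided] [G.Braided] [F.Additive] [G.Additive] [F.Linear K]
  [G.Linear K]
  {n : ∀ a, F.obj (letter δ' a) ⟶ G.obj (letter δ' a)}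

/-- The property of commuting with the multiplicative extension of `n`. -/
def WordNatural (n : ∀ a, F.obj (letter δ' a) ⟶ G.obj (letter δ' a)) ⦃a b : SkeletonCat δ'⦄
    (f : a ⟶ b) : Prop :=
  F.map f ≫ wordApp n b.word = wordApp n a.word ≫ G.map f

/-- A multiplicative family that respects the duality of the letters is a natural
transformation. -/
theorem tensorClosed_wordNatural
    (hcup : (ε F ≫ F.map (cupHom δ' .black) ≫ δ F _ _) ≫ (n .black ⊗ₘ n .white) =
      ε G ≫ G.map (cupHom δ' .black) ≫ δ G _ _)
    (hcap : (n .white ⊗ₘ n .black) ≫ μ G _ _ ≫ G.map (capHom δ' .white) ≫ η G =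
      μ F _ _ ≫ F.map (capHom δ' .white) ≫ η F) : TensorClosed (WordNatural n) := by
  have hcomp : ∀ ⦃a b c : SkeletonCat δ'⦄ (f : a ⟶ b) (g : b ⟶ c),
      WordNatural n f → WordNatural n g → WordNatural n (f ≫ g) := by
    intro a b c f g hf hg
    unfold WordNatural at *
    rw [Functor.map_comp, Functor.map_comp, Category.assoc, hg, reassoc_of% hf]
  have hright : ∀ ⦃a b : SkeletonCat δ'⦄ (f : a ⟶ b) (c : SkeletonCat δ'),
      WordNatural n f → WordNatural n (f ▷ c) := by
    intro a b f c hf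
    unfold WordNatural at *
    rw [wordApp_tensor, wordApp_tensor, tensorApp_whiskerRight hf]
  have hleft : ∀ (c : SkeletonCat δ') ⦃a b : SkeletonCat δ'⦄ (f : a ⟶ b),
      WordNatural n f → WordNatural n (c ◁ f) := by
    intro c a b f hf
    unfold WordNatural at *
    rw [wordApp_tensor, wordApp_tensor, tensorApp_whiskerLeft hf]
  have hbraid : ∀ a b : SkeletonCat δ', WordNatural n (β_ a b).hom := by
    intro a b
    unfold WordNatural
    rw [wordApp_tensor, wordApp_tensor, tensorApp_braiding]
  refine ⟨fun h h' => hcomp _ _ h h', fun a b => ?_, fun h h' => ?_, fun r _ _ _ h => ?_,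
    fun c h => hright _ c h,
    fun p => ofEquiv_generated (fun a => ?_) hcomp (fun x => hleft _) hright
      (fun x y => hbraid _ _) p, ?_, ?_⟩
  · simp [WordNatural]
  · unfold WordNatural at *
    rw [Functor.map_add, Functor.map_add, Preadditive.add_comp, Preadditive.comp_add, h, h']
  · unfold WordNatural at *
    rw [Functor.map_smul, Functor.map_smul, Linear.smul_comp, Linear.comp_smul, h]
  · simp [WordNatural]
  · have h : ∀ {A B : SkeletonCat δ'} (f : F.obj A ⟶ G.obj A) (g : F.obj B ⟶ G.obj B)
        (c : 𝟙_ _ ⟶ A ⊗ B), (ε F ≫ F.map c ≫ δ F A B) ≫ (f ⊗ₘ g) = ε G ≫ G.map c ≫ δ G A B →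
        F.map c ≫ tensorApp f g = (η F ≫ ε G) ≫ G.map c := by
      intro A B f g c h
      rw [← cancel_epi (ε F), ← cancel_mono (δ G _ _)]
      simpa [tensorApp] using h
    have e : wordApp n [.black, .white] = tensorApp (n .black) (n .white) :=
      congrArg (tensorApp (A := letter δ' .black) (B := letter δ' .white) _) (wordApp_singleton _)
    exact (congrArg _ e).trans (h _ _ _ hcup)
  · have h : ∀ {A B : SkeletonCat δ'} (f : F.obj A ⟶ G.obj A) (g : F.obj B ⟶ G.obj B)
        (c : A ⊗ B ⟶ 𝟙_ _), (f ⊗ₘ g) ≫ μ G A B ≫ G.map c ≫ η G = μ F A B ≫ F.map c ≫ η F →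
        F.map c ≫ η F ≫ ε G = tensorApp f g ≫ G.map c := by
      intro A B f g c h
      rw [← cancel_epi (μ F _ _), ← cancel_mono (η G)]
      simpa [tensorApp] using h.symm
    have e : wordApp n [.white, .black] = tensorApp (n .white) (n .black) :=
      congrArg (tensorApp (A := letter δ' .white) (B := letter δ' .black) _) (wordApp_singleton _)
    exact (h _ _ _ hcap).trans (congrArg (· ≫ G.map _) e.symm)

end Natural

end WordTransformation

end SkeletonCat

namespace SkeletonCat

open Functor.LaxMonoidal Functor.OplaxMonoidal

/-! ### Evaluation of tensor functors at `•` -/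

section Evaluation

variable {K : Type u} [Field K] {δ' : K} {T : Type u₁} [Category.{v₁} T] [Preadditive T]
  [Linear K T] [MonoidalCategory T] [SymmetricCategory T]

/-- Tensor functors preserve duals and dimensions, and `•` has dimension `δ`. -/
theorem hasDimension_obj (F : TensorFunctor K (SkeletonCat δ') T) :
    HasDimension δ' (F.functor.obj (bullet δ')) := by
  refine ⟨F.functor.obj (letter δ' .white), mapExactPairing F.functor (letter δ' .black) _, ?_⟩
  change (ε F.functor ≫ F.functor.map (cupHom δ' .black) ≫ δ F.functor _ _) ≫ _ ≫
    μ F.functor _ _ ≫ F.functor.map (capHom δ' .white) ≫ η F.functor = _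
  have key : ∀ {A B : SkeletonCat δ'} (c : 𝟙_ _ ⟶ A ⊗ B) (e : B ⊗ A ⟶ 𝟙_ _)
      (_ : c ≫ (β_ A B).hom ≫ e = δ' • 𝟙 _), (ε F.functor ≫ F.functor.map c ≫ δ F.functor _ _) ≫
        (β_ _ _).hom ≫ μ F.functor _ _ ≫ F.functor.map e ≫ η F.functor = δ' • 𝟙 (𝟙_ T) := by
    intro A B c e h
    have h₁ : F.functor.map (𝟙 (𝟙_ (SkeletonCat δ'))) = 𝟙 _ := F.functor.map_id _
    have h' := congrArg (fun t => ε F.functor ≫ F.functor.map t ≫ η F.functor) h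
    simpa only [Functor.map_comp, Functor.map_braiding, Category.assoc, Functor.map_smul,
      h₁, Linear.smul_comp, Linear.comp_smul, Category.id_comp,
      Functor.Monoidal.ε_η] using h'
  exact key _ _ ((Category.assoc _ _ _).symm.trans
    ((congrArg (· ≫ capHom δ' .white) cupHom_braiding).trans (cupHom_capHom .white)))

instance isIso_app_bullet {F G : TensorFunctor K (SkeletonCat δ') T} (τ : F ⟶ G) :
    IsIso (τ.toNatTrans.app (bullet δ')) :=
  isIso_app_of_dual τ.toNatTrans (letter δ' .black) (letter δ' .white)

variable (δ' T) in
/-- The functor `F ↦ F(•)`, `η ↦ η_•` with values in the `δ`-dimensional objects and their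
isomorphisms. -/
noncomputable def evalDimensional :
    TensorFunctor K (SkeletonCat δ') T ⥤ DimensionalObjects δ' T where
  obj F := ⟨⟨F.functor.obj (bullet δ'), hasDimension_obj F⟩⟩
  map τ :=
    CoreHom.mk (ObjectProperty.isoMk _ (asIso (τ.toNatTrans.app (bullet δ'))))
  map_id _ := Core.hom_ext (ObjectProperty.hom_ext _ rfl)
  map_comp _ _ := Core.hom_ext (ObjectProperty.hom_ext _ rfl)

instance : (evalDimensional δ' T).Faithful where
  map_injective {_ _ τ τ'} h := by
    have hb : τ.toNatTrans.app (letter δ' .black) = τ'.toNatTrans.app (letter δ' .black) :=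
      congrArg (DimensionalObjects.inclusion δ' T).map h
    have hw := app_dual_eq (letter δ' .black) (letter δ' .white) hb
    refine TensorFunctor.Hom.ext (NatTrans.ext (funext fun a => ?_))
    obtain ⟨w⟩ := a
    rw [eq_wordApp, eq_wordApp]
    congr 1
    funext a
    cases a
    · exact hb
    · exact hw

/-- An isomorphism of the values at `•` is the value of a monoidal transformation; its value at `∘`
has to be the inverse transpose. -/
theorem exists_hom_of_iso {F G : TensorFunctor K (SkeletonCat δ') T}
    (e : F.functor.obj (bullet δ') ≅ G.functor.obj (bullet δ')) :
    ∃ τ : F ⟶ G, τ.toNatTrans.app (bullet δ') = e.hom := by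
  let := mapExactPairing F.functor (letter δ' .black) (letter δ' .white)
  let := mapExactPairing G.functor (letter δ' .black) (letter δ' .white)
  let n : ∀ a, F.functor.obj (letter δ' a) ⟶ G.functor.obj (letter δ' a)
    | .black => e.hom
    | .white => transpose (X := F.functor.obj (letter δ' .black))
        (Y := F.functor.obj (letter δ' .white))
        (X' := G.functor.obj (letter δ' .black)) (Y' := G.functor.obj (letter δ' .white)) e.inv
  have hn : TensorClosed (WordNatural n) := by
    refine tensorClosed_wordNatural ?_ ?_
    · have h : ∀ {X Y X' Y' : T} [ExactPairing X Y] [ExactPairing X' Y'] (e : X ≅ X'),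
        η_ X Y ≫ (e.hom ⊗ₘ transpose e.inv) = η_ X' Y' := by
        intro X Y X' Y' _ _ e
        rw [MonoidalCategory.tensorHom_def', reassoc_of% coevaluation_transpose,
          ← comp_whiskerRight]
        simp
      exact h (X := F.functor.obj (letter δ' .black)) (Y := F.functor.obj (letter δ' .white))
        (X' := G.functor.obj (letter δ' .black)) (Y' := G.functor.obj (letter δ' .white)) e
    · have h : ∀ {X Y X' Y' : T} [ExactPairing X Y] [ExactPairing X' Y'] (e : X ≅ X'),
        (transpose e.inv ⊗ₘ e.hom) ≫ ε_ X' Y' = ε_ X Y := by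
        intro X Y X' Y' _ _ e
        rw [MonoidalCategory.tensorHom_def', Category.assoc, transpose_evaluation,
          ← whiskerLeft_comp_assoc]
        simp
      exact h (X := F.functor.obj (letter δ' .black)) (Y := F.functor.obj (letter δ' .white))
        (X' := G.functor.obj (letter δ' .black)) (Y' := G.functor.obj (letter δ' .white)) e
  let τ : F.functor ⟶ G.functor :=
    { app := fun a => wordApp n a.word
      naturality := fun a b f => hn.all f }
  have : NatTrans.IsMonoidal τ :=
    { unit := by
        have : ∀ {A B C : T} (i : A ≅ B) (f : A ⟶ C), i.hom ≫ i.inv ≫ f = f := by simp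
        exact this (Functor.Monoidal.εIso F.functor) _
      tensor := fun a b => by
        have h := wordApp_tensor (n := n) a b
        refine Eq.trans (congrArg _ h) (μ_tensorApp _ _) }
  exact ⟨⟨τ⟩, wordApp_singleton .black⟩

instance : (evalDimensional δ' T).Full where
  map_surjective e := by
    obtain ⟨τ, h⟩ := exists_hom_of_iso ((DimensionalObjects.inclusion δ' T).mapIso (asIso e))
    exact ⟨τ, Core.hom_ext (ObjectProperty.hom_ext _ h)⟩

/-- An object of dimension `δ` is the value at `•` of a strict tensor functor. -/
theorem exists_strict_of_hasDimension [IsTensorCategory K T] {X : T} (h : HasDimension δ' X) :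
    ∃ F : TensorFunctor K (SkeletonCat δ') T, F.IsStrict ∧ F.functor.obj (bullet δ') = X := by
  obtain ⟨Y, _, h⟩ := h
  let Z : Letter → T
    | .black => X
    | .white => Y
  let : ExactPairing (Z .black) (Z .white) := inferInstanceAs (ExactPairing X Y)
  exact ⟨wordTensorFunctor Z h, wordTensorFunctor_isStrict Z h, IsStrictMonoidal.tensor_unit X⟩

end Evaluation

end SkeletonCat

/-! ### Spanning families of morphisms -/

section Spanning

variable {T : Type u₁} [Category.{v₁} T] [Preadditive T]

/-- A family of morphisms with a common target is spanning if the identity of the target is a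
finite sum of morphisms that factor through members of the family. -/
def Spanning {ι : Type*} {A : ι → T} {Y : T} (f : ∀ i, A i ⟶ Y) : Prop :=
  ∃ (n : Type) (_ : Fintype n) (s : n → ι) (p : ∀ j, Y ⟶ A (s j)), ∑ j, p j ≫ f (s j) = 𝟙 Y

namespace Spanning

variable {ι ι' : Type*} {A : ι → T} {A' : ι' → T} {Y Y' : T} {f : ∀ i, A i ⟶ Y}
  {f' : ∀ i, A' i ⟶ Y'}

theorem hom_ext (hf : Spanning f) {Z : T} {t t' : Y ⟶ Z} (h : ∀ i, f i ≫ t = f i ≫ t') :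
    t = t' := by
  obtain ⟨n, _, s, p, hp⟩ := hf
  rw [← Category.id_comp t, ← Category.id_comp t', ← hp, Preadditive.sum_comp, Preadditive.sum_comp]
  exact Finset.sum_congr rfl fun j _ => by rw [Category.assoc, h, Category.assoc]

theorem tensor [MonoidalCategory T] [MonoidalPreadditive T] (hf : Spanning f) (hf' : Spanning f') :
    Spanning fun i : ι × ι' => f i.1 ⊗ₘ f' i.2 := by
  obtain ⟨n, _, s, p, hp⟩ := hf
  obtain ⟨n', _, s', p', hp'⟩ := hf'
  refine ⟨n × n', inferInstance, fun j => (s j.1, s' j.2), fun j => p j.1 ⊗ₘ p' j.2, ?_⟩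
  simp only [MonoidalCategory.tensorHom_comp_tensorHom, Fintype.sum_prod_type]
  simp only [← tensor_sum, ← sum_tensor, hp, hp', MonoidalCategory.id_tensorHom_id]

theorem map {D : Type u₂} [Category.{v₂} D] [Preadditive D] (F : T ⥤ D) [F.Additive]
    (hf : Spanning f) : Spanning fun i => F.map (f i) := by
  obtain ⟨n, _, s, p, hp⟩ := hf
  refine ⟨n, inferInstance, s, fun j => F.map (p j), ?_⟩
  simp only [← F.map_comp, ← F.map_sum, hp, F.map_id]

theorem retract (hf : Spanning f) {r : Y' ⟶ Y} {q : Y ⟶ Y'} (h : r ≫ q = 𝟙 Y') :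
    Spanning fun i => f i ≫ q := by
  obtain ⟨n, _, s, p, hp⟩ := hf
  refine ⟨n, inferInstance, s, fun j => r ≫ p j, ?_⟩
  have : ∀ j, (r ≫ p j) ≫ f (s j) ≫ q = r ≫ (p j ≫ f (s j)) ≫ q := by simp
  simp only [this, ← Preadditive.comp_sum, ← Preadditive.sum_comp, hp, Category.id_comp, h]

theorem of_comp {κ : Type*} (s : κ → ι) (hf : Spanning fun k => f (s k)) : Spanning f := by
  obtain ⟨n, _, t, p, hp⟩ := hf
  exact ⟨n, inferInstance, fun j => s (t j), p, hp⟩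

theorem biproduct_ι {n : Type} [Fintype n] (B : n → T) [Limits.HasBiproduct B] :
    Spanning (Limits.biproduct.ι B) :=
  ⟨n, inferInstance, _root_.id, Limits.biproduct.π B, Limits.biproduct.total⟩

end Spanning

/-- The functor `J` dominates its target if every object of the target is spanned by morphisms
from the image of `J`. -/
def Dominates {C : Type u₂} [Category.{v₂} C] (J : C ⥤ T) : Prop :=
  ∀ P : T, Spanning fun k : (Σ c, J.obj c ⟶ P) => k.2

end Spanning

/-! ### Transformations are determined on a dominating subcategory -/

section Extension

open Functor.LaxMonoidal Functor.OplaxMonoidal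

variable {C : Type u₁} [Category.{v₁} C] {D : Type u₂} [Category.{v₂} D] [Preadditive D]
  {T : Type u₃} [Category.{v₃} T] [Preadditive T] {J : C ⥤ D} {F G : D ⥤ T}

/-- The component at `P` of the extension of `σ` along `J`. It is a sum over a factorization of
the identity of `P`; since `J` is full and `σ` is natural, it is compatible with all morphisms from
the subcategory. -/
theorem Dominates.exists_app [J.Full] [G.Additive] (hJ : Dominates J) (σ : J ⋙ F ⟶ J ⋙ G) (P : D) :
    ∃ t : F.obj P ⟶ G.obj P, ∀ c (k : J.obj c ⟶ P), F.map k ≫ t = σ.app c ≫ G.map k := by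
  obtain ⟨n, _, s, p, hp⟩ := hJ P
  refine ⟨∑ j, F.map (p j) ≫ σ.app (s j).1 ≫ G.map (s j).2, fun c k => ?_⟩
  rw [Preadditive.comp_sum]
  have : ∀ j, F.map k ≫ F.map (p j) ≫ σ.app (s j).1 ≫ G.map (s j).2 =
      σ.app c ≫ G.map (k ≫ p j ≫ (s j).2) := fun j => by
    obtain ⟨g, hg⟩ := J.map_surjective (k ≫ p j)
    have := σ.naturality g
    dsimp at this
    rw [← F.map_comp_assoc, ← Category.assoc k, ← hg, reassoc_of% this, G.map_comp]
  simp only [this, ← Preadditive.comp_sum, ← G.map_sum, hp, Category.comp_id]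

theorem Dominates.hom_ext [F.Additive] (hJ : Dominates J) {P : D} {Z : T} {t t' : F.obj P ⟶ Z}
    (h : ∀ c (k : J.obj c ⟶ P), F.map k ≫ t = F.map k ≫ t') : t = t' :=
  ((hJ P).map F).hom_ext fun k => h k.1 k.2

theorem Dominates.exists_natTrans [J.Full] [F.Additive] [G.Additive] (hJ : Dominates J)
    (σ : J ⋙ F ⟶ J ⋙ G) :
    ∃ τ : F ⟶ G, Functor.whiskerLeft J τ = σ := by
  choose t ht using hJ.exists_app σ
  refine ⟨{ app := t, naturality := fun P Q f => hJ.hom_ext fun c k => ?_ }, ?_⟩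
  · rw [← F.map_comp_assoc, ht, reassoc_of% ht, G.map_comp]
  · ext c
    have := ht (J.obj c) c (𝟙 _)
    simpa using this

theorem Dominates.natTrans_ext [F.Additive] (hJ : Dominates J) {τ τ' : F ⟶ G}
    (h : ∀ c, τ.app (J.obj c) = τ'.app (J.obj c)) : τ = τ' := by
  ext P
  exact hJ.hom_ext fun c k => by rw [τ.naturality, τ'.naturality, h]

/-- A transformation whose restriction along `J` is monoidal is monoidal. -/
theorem Dominates.isMonoidal [MonoidalCategory C] [MonoidalCategory D] [MonoidalCategory T]
    [MonoidalPreadditive T] [J.Monoidal] [F.Monoidal] [G.Monoidal]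
    [F.Additive] (hJ : Dominates J) (τ : F ⟶ G)
    [hτ : NatTrans.IsMonoidal (Functor.whiskerLeft J τ)] : NatTrans.IsMonoidal τ where
  unit := by
    have h := hτ.unit
    simp only [Functor.LaxMonoidal.comp_ε, Functor.whiskerLeft_app, Category.assoc,
      NatTrans.naturality] at h
    rw [← cancel_mono (G.map (ε J)), Category.assoc, ← h]
  tensor P Q := by
    refine (((hJ P).map F).tensor ((hJ Q).map F)).hom_ext ?_
    rintro ⟨⟨c, k⟩, d, l⟩
    have h := hτ.tensor c d
    simp only [Functor.LaxMonoidal.comp_μ, Functor.whiskerLeft_app, Category.assoc,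
      NatTrans.naturality] at h
    have h' : μ F (J.obj c) (J.obj d) ≫ τ.app (J.obj c ⊗ J.obj d) =
        (τ.app (J.obj c) ⊗ₘ τ.app (J.obj d)) ≫ μ G (J.obj c) (J.obj d) := by
      rw [← cancel_mono (G.map (μ J c d)), Category.assoc, h, Category.assoc]
    rw [Functor.LaxMonoidal.μ_natural_assoc, τ.naturality, reassoc_of% h',
      MonoidalCategory.tensorHom_comp_tensorHom_assoc, τ.naturality, τ.naturality,
      ← MonoidalCategory.tensorHom_comp_tensorHom_assoc, Functor.LaxMonoidal.μ_natural]

end Extension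

/-! ### Restriction of tensor functors to a dominating subcategory -/

section Tensor

variable {K : Type u} [Field K] {C : Type u₁} [Category.{v₁} C] [Preadditive C]
  [Linear K C] [MonoidalCategory C] [SymmetricCategory C] {D : Type u₂} [Category.{v₂} D]
  [Preadditive D] [Linear K D] [MonoidalCategory D] [SymmetricCategory D]
  {T : Type u₃} [Category.{v₃} T] [Preadditive T] [Linear K T] [MonoidalCategory T]
  [SymmetricCategory T] (J : TensorFunctor K C D)

theorem Dominates.faithful_precomp (hJ : Dominates J.functor) :
    (J.precomp T).Faithful where
  map_injective h :=
    TensorFunctor.Hom.ext (hJ.natTrans_ext fun c =>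
      congrArg (fun s => (TensorFunctor.Hom.toNatTrans s).app c) h)

theorem Dominates.full_precomp [MonoidalPreadditive T] (hJ : Dominates J.functor) [J.functor.Full] :
    (J.precomp T).Full where
  map_surjective σ := by
    obtain ⟨τ, h⟩ := hJ.exists_natTrans σ.toNatTrans
    have hσ := σ.isMonoidal
    rw [← h] at hσ
    have := hJ.isMonoidal τ (hτ := hσ)
    exact ⟨⟨τ⟩, TensorFunctor.Hom.ext h⟩

end Tensor

/-! ### The embedding of the skeleton category -/

section RepGL

open Idempotents Limits

variable {K : Type u} [Field K] (δ : K)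

/-- An object of `RepGL δ` is a direct summand of a finite direct sum of words. -/
theorem RepGL.dominates_embedding : Dominates (RepGL.embedding δ).functor := by
  intro P
  let B := fun i => (Mat_.embedding (SkeletonCat δ)).obj (P.X.X i)
  let e : P.X ≅ ⨁ B := Mat_.isoBiproductEmbedding P.X
  have h : Spanning fun i => (toKaroubi _).map (biproduct.ι B i ≫ e.inv) :=
    ((Spanning.biproduct_ι B).retract e.hom_inv_id).map (toKaroubi _)
  exact .of_comp (fun i => ⟨P.X.X i, (toKaroubi _).map (biproduct.ι B i ≫ e.inv) ≫
    Karoubi.decompId_p P⟩) (h.retract (Karoubi.decompId P).symm)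

instance : (RepGL.embedding δ).functor.Full :=
  inferInstanceAs (Mat_.embedding (SkeletonCat δ) ⋙ toKaroubi (Mat_ (SkeletonCat δ))).Full

instance : (RepGL.embedding δ).functor.Faithful :=
  inferInstanceAs (Mat_.embedding (SkeletonCat δ) ⋙ toKaroubi (Mat_ (SkeletonCat δ))).Faithful

theorem RepGL.embedding_obj_injective : Function.Injective (RepGL.embedding δ).functor.obj := by
  intro a b h
  -- the summands of a formal direct sum are compared as sets, which do not mention the index type
  have h' : Set.range (fun _ : PUnit.{1} => a) = Set.range (fun _ : PUnit.{1} => b) :=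
    congrArg (fun P : RepGL δ => Set.range P.X.X) h
  rwa [Set.range_const, Set.range_const, Set.singleton_eq_singleton_iff] at h'

instance : MonoidalPreadditive (RepGL δ) where
  whiskerLeft_zero {_ _ _} := Karoubi.hom_ext _ _ (MonoidalPreadditive.tensor_zero _)
  zero_whiskerRight {_ _ _} := Karoubi.hom_ext _ _ (MonoidalPreadditive.zero_tensor _)
  whiskerLeft_add _ _ := Karoubi.hom_ext _ _ (MonoidalPreadditive.tensor_add _ _ _)
  add_whiskerRight _ _ := Karoubi.hom_ext _ _ (MonoidalPreadditive.add_tensor _ _ _)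

end RepGL

/-! ### Extension of a functor along a dominating embedding -/

section Realization

variable {K : Type u} [Field K] {C : Type u₁} [Category.{v₁} C] [Preadditive C] [Linear K C]
  {D : Type u₂} [Category.{v₂} D] [Preadditive D] [Linear K D] {T : Type u₃} [Category.{v₃} T]
  [Preadditive T] [Linear K T] (J : C ⥤ D) [J.Full] [J.Faithful] [J.Additive] [J.Linear K]
  (F : C ⥤ T) [F.Additive] [F.Linear K]

/-- The functor `F` on morphisms between objects of `C`, read in `D` through the full embedding
`J`. -/
noncomputable def mapPreimage (K : Type u) [Field K] [Linear K C] [Linear K D] [Linear K T]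
    [J.Linear K] [F.Linear K] {c d : C} : (J.obj c ⟶ J.obj d) →ₗ[K] (F.obj c ⟶ F.obj d) where
  toFun f := F.map (J.preimage f)
  map_add' f g := by
    rw [← F.map_add]; congr 1; apply J.map_injective; simp
  map_smul' r f := by
    rw [RingHom.id_apply, ← F.map_smul]; congr 1; apply J.map_injective; simp

variable {J F}

theorem mapPreimage_map {c d : C} (g : c ⟶ d) : mapPreimage J F K (J.map g) = F.map g := by
  simp [mapPreimage]

theorem mapPreimage_id (c : C) : mapPreimage J F K (𝟙 (J.obj c)) = 𝟙 _ := by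
  rw [← J.map_id, mapPreimage_map, F.map_id]

theorem mapPreimage_comp {b c d : C} (f : J.obj b ⟶ J.obj c) (g : J.obj c ⟶ J.obj d) :
    mapPreimage J F K (f ≫ g) = mapPreimage J F K f ≫ mapPreimage J F K g := by
  obtain ⟨f, rfl⟩ := J.map_surjective f
  obtain ⟨g, rfl⟩ := J.map_surjective g
  rw [← J.map_comp, mapPreimage_map, mapPreimage_map, mapPreimage_map, F.map_comp]

variable (K J F)

/-- A value at `P` of an extension of `F` along `J`: an object `obj` to which each morphism
`k : J c ⟶ P` induces a morphism `inn k` from `F c`, such that these morphisms span `obj`, and such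
that each morphism `P ⟶ J c` induces a morphism `obj ⟶ F c` with the expected composites. -/
structure Realization (P : D) where
  obj : T
  inn {c : C} : (J.obj c ⟶ P) →ₗ[K] (F.obj c ⟶ obj)
  comp_inn {c d : C} (f : J.obj c ⟶ J.obj d) (k : J.obj d ⟶ P) :
    mapPreimage J F K f ≫ inn k = inn (f ≫ k)
  exists_out {c : C} (k : P ⟶ J.obj c) : ∃ o : obj ⟶ F.obj c, ∀ (d : C) (l : J.obj d ⟶ P),
    inn l ≫ o = mapPreimage J F K (l ≫ k)
  spanning : Spanning fun k : (Σ c, J.obj c ⟶ P) => inn k.2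

variable {K J F}

namespace Realization

/-- The object `F c` realizes `J c`. -/
noncomputable def image (c : C) : Realization K J F (J.obj c) where
  obj := F.obj c
  inn := mapPreimage J F K
  comp_inn f k := (mapPreimage_comp f k).symm
  exists_out k := ⟨mapPreimage J F K k, fun _ l => (mapPreimage_comp l k).symm⟩
  spanning := ⟨Unit, inferInstance, fun _ => ⟨c, 𝟙 _⟩, fun _ => 𝟙 _, by simp [mapPreimage_id]⟩

/-- An object of `D` is realized by a direct summand of a finite direct sum of values of `F`. -/
theorem exists_of_spanning [Limits.HasFiniteBiproducts T] [IsIdempotentComplete T] {P : D}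
    (hP : Spanning fun k : (Σ c, J.obj c ⟶ P) => k.2) : Nonempty (Realization K J F P) := by
  obtain ⟨n, _, s, p, hp⟩ := hP
  have hp' : ∀ {X : D} (l : X ⟶ P), ∑ j, (l ≫ p j) ≫ (s j).2 = l := by
    intro X l
    simp only [Category.assoc, ← Preadditive.comp_sum, hp, Category.comp_id]
  let m : ∀ {c d : C}, (J.obj c ⟶ J.obj d) →ₗ[K] (F.obj c ⟶ F.obj d) := mapPreimage J F K
  let B : n → T := fun j => F.obj (s j).1
  -- in matrix notation, `u k` has the entries `F (k ≫ p j)` and `w k` the entries `F ((s j).2 ≫ k)`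
  let u : ∀ {c : C}, (J.obj c ⟶ P) →ₗ[K] (F.obj c ⟶ ⨁ B) := fun {c} =>
    ∑ j, Linear.rightComp K _ (Limits.biproduct.ι B j) ∘ₗ m ∘ₗ Linear.rightComp K _ (p j)
  have hu : ∀ {c : C} (k : J.obj c ⟶ P), u k = ∑ j, m (k ≫ p j) ≫ Limits.biproduct.ι B j := by
    intro c k; simp [u]
  let w : ∀ {c : C}, (P ⟶ J.obj c) → (⨁ B ⟶ F.obj c) := fun k =>
    ∑ j, Limits.biproduct.π B j ≫ m ((s j).2 ≫ k)
  have hιw : ∀ (j : n) {c : C} (k : P ⟶ J.obj c),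
      Limits.biproduct.ι B j ≫ w k = m ((s j).2 ≫ k) := by
    intro j c k
    rw [Preadditive.comp_sum, Finset.sum_eq_single j, Limits.biproduct.ι_π_self_assoc]
    · intro i _ hi
      rw [Limits.biproduct.ι_π_ne_assoc _ hi.symm, Limits.zero_comp]
    · exact fun h => (h (Finset.mem_univ j)).elim
  have huw : ∀ {c d : C} (k : J.obj c ⟶ P) (l : P ⟶ J.obj d), u k ≫ w l = m (k ≫ l) := by
    intro c d k l
    rw [hu, Preadditive.sum_comp]
    simp only [Category.assoc, hιw]
    conv_rhs => rw [← hp' k]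
    rw [Preadditive.sum_comp, map_sum]
    exact Finset.sum_congr rfl fun j _ => by
      rw [Category.assoc]; exact (mapPreimage_comp _ _).symm
  have hmu : ∀ {c d : C} (f : J.obj c ⟶ J.obj d) (k : J.obj d ⟶ P), m f ≫ u k = u (f ≫ k) := by
    intro c d f k
    rw [hu, hu, Preadditive.comp_sum]
    exact Finset.sum_congr rfl fun j _ => by
      rw [Category.assoc, ← Category.assoc (m f)]
      exact congrArg (· ≫ _) (mapPreimage_comp _ _).symm
  -- the image under `F` of the idempotent matrix with entries `(s i).2 ≫ p j`, whose image is `P`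
  let e : ⨁ B ⟶ ⨁ B := ∑ j, w (p j) ≫ Limits.biproduct.ι B j
  have hue : ∀ {c : C} (k : J.obj c ⟶ P), u k ≫ e = u k := by
    intro c k
    rw [Preadditive.comp_sum, hu]
    exact Finset.sum_congr rfl fun j _ => by rw [← hu, ← Category.assoc, huw]
  have hwu : ∑ j, w (p j) ≫ u (s j).2 = e := by
    refine (Spanning.biproduct_ι B).hom_ext fun i => ?_
    rw [Preadditive.comp_sum, Preadditive.comp_sum]
    simp only [← Category.assoc (Limits.biproduct.ι B i), hιw, hmu]
    rw [← map_sum, hp', hu]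
  have hee : e ≫ e = e := by
    conv_lhs => rw [← hwu]
    rw [Preadditive.sum_comp, ← hwu]
    simp only [Category.assoc, hwu, hue]
  obtain ⟨Y, i, r, hir, hri⟩ := IsIdempotentComplete.idempotents_split _ e hee
  have hur : ∀ {c : C} (k : J.obj c ⟶ P), (u k ≫ r) ≫ i = u k := by
    intro c k
    rw [Category.assoc, hri, hue]
  refine ⟨⟨Y, fun {c} => Linear.rightComp K _ r ∘ₗ u, fun f k => ?_, fun k => ⟨i ≫ w k, ?_⟩, ?_⟩⟩
  · exact (Category.assoc _ _ _).symm.trans (congrArg (· ≫ r) (hmu f k))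
  · intro d l
    exact (Category.assoc _ _ _).symm.trans ((congrArg (· ≫ w k) (hur l)).trans (huw l k))
  · refine ⟨n, inferInstance, s, fun j => i ≫ w (p j), ?_⟩
    have : ∀ j, (i ≫ w (p j)) ≫ u (s j).2 ≫ r = i ≫ (w (p j) ≫ u (s j).2) ≫ r := by simp
    refine (Finset.sum_congr rfl fun j _ => this j).trans ?_
    rw [← Preadditive.comp_sum, ← Preadditive.sum_comp, hwu, ← hri, Category.assoc, hir,
      Category.comp_id, hir]

section Lift

variable {P : D} (R : Realization K J F P)

/-- Morphisms out of a realization correspond to natural families. -/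
theorem exists_lift (hP : Spanning fun k : (Σ c, J.obj c ⟶ P) => k.2) {Z : T}
    (φ : ∀ c, (J.obj c ⟶ P) →+ (F.obj c ⟶ Z))
    (hφ : ∀ c d (f : J.obj c ⟶ J.obj d) (k : J.obj d ⟶ P),
      mapPreimage J F K f ≫ φ d k = φ c (f ≫ k)) :
    ∃ t : R.obj ⟶ Z, ∀ c (k : J.obj c ⟶ P), R.inn k ≫ t = φ c k := by
  obtain ⟨n, _, s, p, hp⟩ := hP
  choose o ho using fun j => R.exists_out (p j)
  refine ⟨∑ j, o j ≫ φ _ (s j).2, fun c k => ?_⟩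
  rw [Preadditive.comp_sum]
  simp only [← Category.assoc (R.inn k), ho, hφ]
  rw [← map_sum]
  simp only [Category.assoc, ← Preadditive.comp_sum, hp, Category.comp_id]

theorem hom_ext {Z : T} {t t' : R.obj ⟶ Z}
    (h : ∀ c (k : J.obj c ⟶ P), R.inn k ≫ t = R.inn k ≫ t') : t = t' :=
  R.spanning.hom_ext fun k => h k.1 k.2

end Lift

/-- The value chosen at each `J c` is `F c` itself, with the identity inducing the identity. -/
def IsStrict (R : ∀ P, Realization K J F P) : Prop :=
  ∀ c, ∃ h : F.obj c = (R (J.obj c)).obj, (R (J.obj c)).inn (𝟙 _) = eqToHom h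

/-- Values can be chosen for all objects such that the extension restricts to `F` exactly. -/
theorem exists_isStrict [Limits.HasFiniteBiproducts T] [IsIdempotentComplete T]
    (hJ : Dominates J) (hinj : Function.Injective J.obj) :
    ∃ R : ∀ P, Realization K J F P, IsStrict R := by
  have : ∀ P : D, ∃ R : Realization K J F P, ∀ c (e : J.obj c = P),
      ∃ h : F.obj c = R.obj, R.inn (eqToHom e) = eqToHom h := by
    intro P
    by_cases h : ∃ c, J.obj c = P
    · obtain ⟨c, rfl⟩ := h
      refine ⟨image c, fun d e => ?_⟩
      obtain rfl := hinj e
      exact ⟨rfl, mapPreimage_id _⟩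
    · obtain ⟨R⟩ := exists_of_spanning (K := K) (F := F) (hJ P)
      exact ⟨R, fun c e => (h ⟨c, e⟩).elim⟩
  choose R hR using this
  exact ⟨R, fun c => hR _ c rfl⟩

end Realization

end Realization

/-! ### The extended functor -/

section Extend

variable {K : Type u} [Field K] {C : Type u₁} [Category.{v₁} C] [Preadditive C] [Linear K C]
  {D : Type u₂} [Category.{v₂} D] [Preadditive D] [Linear K D] {T : Type u₃} [Category.{v₃} T]
  [Preadditive T] [Linear K T] {J : C ⥤ D} [J.Full] [J.Faithful] [J.Additive] [J.Linear K]
  {F : C ⥤ T} [F.Additive] [F.Linear K] (hJ : Dominates J) (R : ∀ P, Realization K J F P)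

theorem Realization.exists_map (hJ : Dominates J) (R : ∀ P, Realization K J F P) {P Q : D}
    (f : P ⟶ Q) : ∃ t : (R P).obj ⟶ (R Q).obj, ∀ c (k : J.obj c ⟶ P),
      (R P).inn k ≫ t = (R Q).inn (k ≫ f) :=
  (R P).exists_lift (hJ P)
    (fun c => ((R Q).inn ∘ₗ Linear.rightComp K _ f : (J.obj c ⟶ P) →ₗ[K] _).toAddMonoidHom)
    (fun _ _ g k => ((R Q).comp_inn g (k ≫ f)).trans
      (congrArg (R Q).inn (Category.assoc _ _ _).symm))

/-- The extension of `F` along `J` with given values on objects. -/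
noncomputable def extend : D ⥤ T where
  obj P := (R P).obj
  map f := (Realization.exists_map hJ R f).choose
  map_id P := (R P).hom_ext fun c k => by
    rw [(Realization.exists_map hJ R (𝟙 P)).choose_spec, Category.comp_id, Category.comp_id]
  map_comp {_ _ _} f g := (R _).hom_ext fun c k => by
    rw [(Realization.exists_map hJ R (f ≫ g)).choose_spec,
      reassoc_of% (Realization.exists_map hJ R f).choose_spec,
      (Realization.exists_map hJ R g).choose_spec, Category.assoc]

/-- The morphism from a value of `F` to a value of its extension induced by a morphism from an
object of the subcategory. -/
noncomputable def extInn {c : C} {P : D} : (J.obj c ⟶ P) →ₗ[K] (F.obj c ⟶ (extend hJ R).obj P) :=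
  (R P).inn

theorem extInn_map {c : C} {P Q : D} (k : J.obj c ⟶ P) (f : P ⟶ Q) :
    extInn hJ R k ≫ (extend hJ R).map f = extInn hJ R (k ≫ f) :=
  (Realization.exists_map hJ R f).choose_spec c k

theorem mapPreimage_extInn {c d : C} {P : D} (f : J.obj c ⟶ J.obj d) (k : J.obj d ⟶ P) :
    mapPreimage J F K f ≫ extInn hJ R k = extInn hJ R (f ≫ k) :=
  (R P).comp_inn f k

theorem map_extInn {c d : C} {P : D} (f : c ⟶ d) (k : J.obj d ⟶ P) :
    F.map f ≫ extInn hJ R k = extInn hJ R (J.map f ≫ k) := by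
  rw [← mapPreimage_extInn, mapPreimage_map]

theorem spanning_extInn (P : D) : Spanning fun k : (Σ c, J.obj c ⟶ P) => extInn hJ R k.2 :=
  (R P).spanning

/-- Morphisms from `P` to the subcategory induce morphisms from the value at `P` to values
of `F`. -/
theorem exists_extOut {c : C} {P : D} (k : P ⟶ J.obj c) :
    ∃ o : (extend hJ R).obj P ⟶ F.obj c, ∀ d (l : J.obj d ⟶ P),
      extInn hJ R l ≫ o = mapPreimage J F K (l ≫ k) :=
  (R P).exists_out k

theorem exists_lift_extend {P : D} {Z : T} (φ : ∀ c, (J.obj c ⟶ P) →+ (F.obj c ⟶ Z))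
    (hφ : ∀ c d (f : J.obj c ⟶ J.obj d) (k : J.obj d ⟶ P),
      mapPreimage J F K f ≫ φ d k = φ c (f ≫ k)) :
    ∃ t : (extend hJ R).obj P ⟶ Z, ∀ c (k : J.obj c ⟶ P), extInn hJ R k ≫ t = φ c k :=
  (R P).exists_lift (hJ P) φ hφ

variable {hJ R}

theorem extend_hom_ext {P : D} {Z : T} {t t' : (extend hJ R).obj P ⟶ Z}
    (h : ∀ c (k : J.obj c ⟶ P), extInn hJ R k ≫ t = extInn hJ R k ≫ t') : t = t' :=
  (spanning_extInn hJ R P).hom_ext fun k => h k.1 k.2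

instance : (extend hJ R).Additive where
  map_add {_ _ f g} := extend_hom_ext fun c k => by
    rw [extInn_map, Preadditive.comp_add, map_add, Preadditive.comp_add, extInn_map, extInn_map]

instance : (extend hJ R).Linear K where
  map_smul f r := extend_hom_ext fun c k => by
    rw [extInn_map, Linear.comp_smul, map_smul, Linear.comp_smul, extInn_map]

section Monoidal

open Functor.LaxMonoidal Functor.OplaxMonoidal

variable [MonoidalCategory T]

theorem extend_tensor_hom_ext [MonoidalPreadditive T] {P Q : D} {Z : T}
    {t t' : (extend hJ R).obj P ⊗ (extend hJ R).obj Q ⟶ Z}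
    (h : ∀ c d (k : J.obj c ⟶ P) (l : J.obj d ⟶ Q),
      (extInn hJ R k ⊗ₘ extInn hJ R l) ≫ t = (extInn hJ R k ⊗ₘ extInn hJ R l) ≫ t') : t = t' :=
  ((spanning_extInn hJ R P).tensor (spanning_extInn hJ R Q)).hom_ext fun k => h _ _ k.1.2 k.2.2

variable [MonoidalCategory C] [MonoidalCategory D] [J.Monoidal] [F.Monoidal]

theorem mapPreimage_tensor_comp_μ {a b c d : C} (f : J.obj a ⟶ J.obj b) (g : J.obj c ⟶ J.obj d) :
    (mapPreimage J F K f ⊗ₘ mapPreimage J F K g) ≫ μ F b d =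
      μ F a c ≫ mapPreimage J F K (δ J a c ≫ (f ⊗ₘ g) ≫ μ J b d) := by
  obtain ⟨f, rfl⟩ := J.map_surjective f
  obtain ⟨g, rfl⟩ := J.map_surjective g
  rw [mapPreimage_map, mapPreimage_map, Functor.LaxMonoidal.μ_natural,
    Functor.LaxMonoidal.μ_natural, Functor.Monoidal.δ_μ_assoc, mapPreimage_map]

variable [MonoidalPreadditive D]

/-- The family that determines the multiplication of the extended functor. -/
noncomputable def extPair (hJ : Dominates J) (R : ∀ P, Realization K J F P) {c d : C} {P Q : D}
    (k : J.obj c ⟶ P) (l : J.obj d ⟶ Q) : F.obj c ⊗ F.obj d ⟶ (extend hJ R).obj (P ⊗ Q) :=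
  μ F c d ≫ extInn hJ R (δ J c d ≫ (k ⊗ₘ l))

/-- The multiplication of the extended functor. It is a sum over factorizations of the identities of
`P` and `Q` through the subcategory, where the multiplication is that of `F`. -/
theorem exists_extend_μ (P Q : D) : ∃ t : (extend hJ R).obj P ⊗ (extend hJ R).obj Q ⟶
    (extend hJ R).obj (P ⊗ Q), ∀ c d (k : J.obj c ⟶ P) (l : J.obj d ⟶ Q),
      (extInn hJ R k ⊗ₘ extInn hJ R l) ≫ t = extPair hJ R k l := by
  obtain ⟨n, _, s, p, hp⟩ := hJ P
  obtain ⟨n', _, s', p', hp'⟩ := hJ Q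
  choose o ho using fun j => exists_extOut hJ R (p j)
  choose o' ho' using fun j => exists_extOut hJ R (p' j)
  refine ⟨∑ i, ∑ j, (o i ⊗ₘ o' j) ≫ extPair hJ R (s i).2 (s' j).2, fun c d k l => ?_⟩
  have h : ∀ i j, (extInn hJ R k ⊗ₘ extInn hJ R l) ≫ (o i ⊗ₘ o' j) ≫ extPair hJ R (s i).2 (s' j).2 =
      μ F c d ≫ extInn hJ R (δ J c d ≫ ((k ≫ p i ≫ (s i).2) ⊗ₘ (l ≫ p' j ≫ (s' j).2))) := by
    intro i j
    rw [MonoidalCategory.tensorHom_comp_tensorHom_assoc, ho, ho', extPair,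
      reassoc_of% mapPreimage_tensor_comp_μ, mapPreimage_extInn]
    congr 2
    simp [MonoidalCategory.tensorHom_comp_tensorHom]
  simp only [Preadditive.comp_sum, h]
  simp only [← Preadditive.comp_sum, ← map_sum, ← tensor_sum, ← sum_tensor, hp, hp',
    Category.comp_id]
  rfl

/-- The multiplication is invertible: the inverse is defined by the same factorizations, with the
comultiplication of `F` in place of its multiplication. -/
theorem isIso_of_extPair [MonoidalPreadditive T] (P Q : D)
    (t : (extend hJ R).obj P ⊗ (extend hJ R).obj Q ⟶ (extend hJ R).obj (P ⊗ Q))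
    (ht : ∀ c d (k : J.obj c ⟶ P) (l : J.obj d ⟶ Q),
      (extInn hJ R k ⊗ₘ extInn hJ R l) ≫ t = extPair hJ R k l) : IsIso t := by
  obtain ⟨n, _, s, p, hp⟩ := hJ P
  obtain ⟨n', _, s', p', hp'⟩ := hJ Q
  obtain ⟨t', ht'⟩ := exists_lift_extend hJ R (P := P ⊗ Q)
    (Z := (extend hJ R).obj P ⊗ (extend hJ R).obj Q)
    (fun c => AddMonoidHom.mk' (fun k => ∑ i, ∑ j, mapPreimage J F K (k ≫ (p i ⊗ₘ p' j) ≫ μ J _ _) ≫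
      δ F _ _ ≫ (extInn hJ R (s i).2 ⊗ₘ extInn hJ R (s' j).2)) (by
        intro k l
        simp only [Preadditive.add_comp, map_add, Finset.sum_add_distrib]))
    (by
      intro c d f k
      simp only [AddMonoidHom.mk'_apply, Preadditive.comp_sum]
      refine Finset.sum_congr rfl fun i _ => Finset.sum_congr rfl fun j _ => ?_
      rw [← Category.assoc, ← mapPreimage_comp, Category.assoc])
  refine ⟨t', extend_tensor_hom_ext fun c d k l => ?_, extend_hom_ext fun c k => ?_⟩
  · rw [reassoc_of% ht, extPair, Category.assoc, ht', AddMonoidHom.mk'_apply]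
    simp only [Preadditive.comp_sum]
    have h : ∀ i j, μ F c d ≫ mapPreimage J F K ((δ J c d ≫ (k ⊗ₘ l)) ≫ (p i ⊗ₘ p' j) ≫ μ J _ _) ≫
        δ F _ _ ≫ (extInn hJ R (s i).2 ⊗ₘ extInn hJ R (s' j).2) =
        extInn hJ R (k ≫ p i ≫ (s i).2) ⊗ₘ extInn hJ R (l ≫ p' j ≫ (s' j).2) := by
      intro i j
      rw [Category.assoc, MonoidalCategory.tensorHom_comp_tensorHom_assoc,
        ← reassoc_of% mapPreimage_tensor_comp_μ, Functor.Monoidal.μ_δ_assoc,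
        MonoidalCategory.tensorHom_comp_tensorHom, mapPreimage_extInn, mapPreimage_extInn,
        Category.assoc, Category.assoc]
    simp only [h]
    simp only [← Preadditive.comp_sum, ← map_sum, ← tensor_sum, ← sum_tensor, hp, hp',
      Category.comp_id]
  · rw [reassoc_of% ht', AddMonoidHom.mk'_apply]
    simp only [Preadditive.sum_comp]
    have h : ∀ i j, (mapPreimage J F K (k ≫ (p i ⊗ₘ p' j) ≫ μ J _ _) ≫
        δ F _ _ ≫ (extInn hJ R (s i).2 ⊗ₘ extInn hJ R (s' j).2)) ≫ t =
        extInn hJ R (k ≫ ((p i ≫ (s i).2) ⊗ₘ (p' j ≫ (s' j).2))) := by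
      intro i j
      rw [Category.assoc, Category.assoc, ht, extPair, Functor.Monoidal.δ_μ_assoc,
        mapPreimage_extInn, Category.assoc, Category.assoc, Functor.Monoidal.μ_δ_assoc,
        MonoidalCategory.tensorHom_comp_tensorHom]
    simp only [h]
    simp only [← Preadditive.comp_sum, ← map_sum, ← tensor_sum, ← sum_tensor, hp, hp',
      Category.comp_id, MonoidalCategory.id_tensorHom_id]

end Monoidal

end Extend

/-! ### The monoidal structure of the extended functor -/

section ExtendMonoidal

open Functor.LaxMonoidal Functor.OplaxMonoidal

variable {K : Type u} [Field K] {C : Type u₁} [Category.{v₁} C] [Preadditive C] [Linear K C]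
  {D : Type u₂} [Category.{v₂} D] [Preadditive D] [Linear K D] {T : Type u₃} [Category.{v₃} T]
  [Preadditive T] [Linear K T] {J : C ⥤ D} [J.Full] [J.Faithful] [J.Additive] [J.Linear K]
  {F : C ⥤ T} [F.Additive] [F.Linear K] (hJ : Dominates J) (R : ∀ P, Realization K J F P)
  [MonoidalCategory C] [MonoidalCategory D] [MonoidalCategory T] [MonoidalPreadditive D]
  [MonoidalPreadditive T] [J.Monoidal] [F.Monoidal]

/-- The multiplication of the extended functor. -/
noncomputable def extendμ (P Q : D) :
    (extend hJ R).obj P ⊗ (extend hJ R).obj Q ≅ (extend hJ R).obj (P ⊗ Q) :=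
  @asIso _ _ _ _ _ (isIso_of_extPair P Q _ (exists_extend_μ P Q).choose_spec)

/-- The formula that determines the multiplication of the extended functor. -/
theorem extInn_extendμ {P Q : D} {c d : C} (k : J.obj c ⟶ P) (l : J.obj d ⟶ Q) :
    (extInn hJ R k ⊗ₘ extInn hJ R l) ≫ (extendμ hJ R P Q).hom =
      μ F c d ≫ extInn hJ R (δ J c d ≫ (k ⊗ₘ l)) :=
  (exists_extend_μ P Q).choose_spec c d k l

/-- The unit of the extended functor. -/
noncomputable def extendε : 𝟙_ T ≅ (extend hJ R).obj (𝟙_ D) where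
  hom := ε F ≫ extInn hJ R (η J)
  inv := (exists_extOut hJ R (ε J)).choose ≫ η F
  hom_inv_id := by
    have h := (exists_extOut hJ R (ε J)).choose_spec _ (η J)
    rw [Category.assoc, reassoc_of% h, Functor.Monoidal.η_ε, mapPreimage_id]
    simp
  inv_hom_id := extend_hom_ext fun c k => by
    have h := (exists_extOut hJ R (ε J)).choose_spec _ k
    rw [Category.assoc, reassoc_of% h, Functor.Monoidal.η_ε_assoc, mapPreimage_extInn,
      Category.assoc, Functor.Monoidal.ε_η]
    simp

theorem extInn_whiskerRight_extendμ {P Q X : D} {c d : C} (k : J.obj c ⟶ P) (l : J.obj d ⟶ Q)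
    (f : P ⟶ X) :
    (extInn hJ R k ⊗ₘ extInn hJ R l) ≫ (extend hJ R).map f ▷ _ ≫ (extendμ hJ R X Q).hom =
      (extInn hJ R k ⊗ₘ extInn hJ R l) ≫ (extendμ hJ R P Q).hom ≫ (extend hJ R).map (f ▷ Q) := by
  rw [← Category.assoc, tensorHom_comp_whiskerRight, extInn_map, extInn_extendμ,
    reassoc_of% extInn_extendμ, extInn_map, Category.assoc, tensorHom_comp_whiskerRight]

theorem extInn_whiskerLeft_extendμ {P Q X : D} {c d : C} (k : J.obj c ⟶ P) (l : J.obj d ⟶ Q)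
    (f : Q ⟶ X) :
    (extInn hJ R k ⊗ₘ extInn hJ R l) ≫ _ ◁ (extend hJ R).map f ≫ (extendμ hJ R P X).hom =
      (extInn hJ R k ⊗ₘ extInn hJ R l) ≫ (extendμ hJ R P Q).hom ≫ (extend hJ R).map (P ◁ f) := by
  rw [← Category.assoc, tensorHom_comp_whiskerLeft, extInn_map, extInn_extendμ,
    reassoc_of% extInn_extendμ, extInn_map, Category.assoc, tensorHom_comp_whiskerLeft]

theorem extendμ_associativity (X Y Z : D) :
    (extendμ hJ R X Y).hom ▷ _ ≫ (extendμ hJ R (X ⊗ Y) Z).hom ≫ (extend hJ R).map (α_ X Y Z).hom =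
      (α_ _ _ _).hom ≫ _ ◁ (extendμ hJ R Y Z).hom ≫ (extendμ hJ R X (Y ⊗ Z)).hom := by
  refine (((spanning_extInn hJ R X).tensor (spanning_extInn hJ R Y)).tensor
    (spanning_extInn hJ R Z)).hom_ext ?_
  rintro ⟨⟨⟨a, k⟩, b, l⟩, c, m⟩
  dsimp only
  have h₁ : ((extInn hJ R k ⊗ₘ extInn hJ R l) ⊗ₘ extInn hJ R m) ≫ (extendμ hJ R X Y).hom ▷ _ ≫
      (extendμ hJ R (X ⊗ Y) Z).hom = μ F a b ▷ _ ≫ μ F (a ⊗ b) c ≫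
        extInn hJ R (δ J (a ⊗ b) c ≫ ((δ J a b ≫ (k ⊗ₘ l)) ⊗ₘ m)) := by
    rw [← Category.assoc, tensorHom_comp_whiskerRight, extInn_extendμ,
      ← whiskerRight_comp_tensorHom, Category.assoc, extInn_extendμ]
  have h₂ : (extInn hJ R k ⊗ₘ (extInn hJ R l ⊗ₘ extInn hJ R m)) ≫ _ ◁ (extendμ hJ R Y Z).hom ≫
      (extendμ hJ R X (Y ⊗ Z)).hom = _ ◁ μ F b c ≫ μ F a (b ⊗ c) ≫
        extInn hJ R (δ J a (b ⊗ c) ≫ (k ⊗ₘ (δ J b c ≫ (l ⊗ₘ m)))) := by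
    rw [← Category.assoc, tensorHom_comp_whiskerLeft, extInn_extendμ, ← whiskerLeft_comp_tensorHom,
      Category.assoc, extInn_extendμ]
  rw [associator_naturality_assoc, h₂, reassoc_of% h₁, extInn_map,
    ← Functor.LaxMonoidal.associativity_assoc, map_extInn]
  have h : (δ J (a ⊗ b) c ≫ ((δ J a b ≫ (k ⊗ₘ l)) ⊗ₘ m)) ≫ (α_ X Y Z).hom =
      J.map (α_ a b c).hom ≫ δ J a (b ⊗ c) ≫ (k ⊗ₘ (δ J b c ≫ (l ⊗ₘ m))) := by
    rw [← whiskerRight_comp_tensorHom, ← whiskerLeft_comp_tensorHom, Category.assoc, Category.assoc,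
      associator_naturality, Functor.OplaxMonoidal.associativity_assoc]
  rw [h]

theorem extendμ_left_unitality (X : D) : (λ_ ((extend hJ R).obj X)).hom =
    (extendε hJ R).hom ▷ _ ≫ (extendμ hJ R (𝟙_ D) X).hom ≫ (extend hJ R).map (λ_ X).hom := by
  rw [← cancel_epi (λ_ _).inv]
  refine extend_hom_ext fun c k => ?_
  have h₁ : (𝟙_ T ◁ extInn hJ R k) ≫ (extendε hJ R).hom ▷ _ ≫ (extendμ hJ R (𝟙_ D) X).hom =
      ε F ▷ F.obj c ≫ μ F (𝟙_ C) c ≫ extInn hJ R (δ J (𝟙_ C) c ≫ (η J ⊗ₘ k)) := by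
    rw [← extInn_extendμ, whisker_exchange_assoc, MonoidalCategory.tensorHom_def]
    simp [extendε]
  have h₂ : J.map (λ_ c).inv ≫ (δ J (𝟙_ C) c ≫ (η J ⊗ₘ k)) ≫ (λ_ X).hom = k := by
    rw [MonoidalCategory.tensorHom_def, Category.assoc, Category.assoc,
      ← Functor.OplaxMonoidal.left_unitality_assoc, leftUnitor_naturality, Iso.inv_hom_id_assoc]
  have h₃ : ε F ▷ F.obj c ≫ μ F (𝟙_ C) c = (λ_ (F.obj c)).hom ≫ F.map (λ_ c).inv := by
    rw [Functor.LaxMonoidal.left_unitality, Category.assoc, Category.assoc, ← F.map_comp,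
      Iso.hom_inv_id, F.map_id, Category.comp_id]
  rw [leftUnitor_inv_naturality_assoc, leftUnitor_inv_naturality_assoc, reassoc_of% h₁, extInn_map,
    reassoc_of% h₃, map_extInn, h₂, leftUnitor_naturality]

theorem extendμ_right_unitality (X : D) : (ρ_ ((extend hJ R).obj X)).hom =
    _ ◁ (extendε hJ R).hom ≫ (extendμ hJ R X (𝟙_ D)).hom ≫ (extend hJ R).map (ρ_ X).hom := by
  rw [← cancel_epi (ρ_ _).inv]
  refine extend_hom_ext fun c k => ?_
  have h₁ : (extInn hJ R k ▷ 𝟙_ T) ≫ _ ◁ (extendε hJ R).hom ≫ (extendμ hJ R X (𝟙_ D)).hom =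
      F.obj c ◁ ε F ≫ μ F c (𝟙_ C) ≫ extInn hJ R (δ J c (𝟙_ C) ≫ (k ⊗ₘ η J)) := by
    rw [← extInn_extendμ, ← whisker_exchange_assoc, MonoidalCategory.tensorHom_def']
    simp [extendε]
  have h₂ : J.map (ρ_ c).inv ≫ (δ J c (𝟙_ C) ≫ (k ⊗ₘ η J)) ≫ (ρ_ X).hom = k := by
    rw [MonoidalCategory.tensorHom_def', Category.assoc, Category.assoc,
      ← Functor.OplaxMonoidal.right_unitality_assoc, rightUnitor_naturality, Iso.inv_hom_id_assoc]
  have h₃ : F.obj c ◁ ε F ≫ μ F c (𝟙_ C) = (ρ_ (F.obj c)).hom ≫ F.map (ρ_ c).inv := by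
    rw [Functor.LaxMonoidal.right_unitality, Category.assoc, Category.assoc, ← F.map_comp,
      Iso.hom_inv_id, F.map_id, Category.comp_id]
  rw [rightUnitor_inv_naturality_assoc, rightUnitor_inv_naturality_assoc, reassoc_of% h₁,
    extInn_map, reassoc_of% h₃, map_extInn, h₂, rightUnitor_naturality]

noncomputable instance : (extend hJ R).Monoidal :=
  Functor.CoreMonoidal.toMonoidal
    { εIso := extendε hJ R
      μIso := extendμ hJ R
      μIso_hom_natural_left := fun f _ => extend_tensor_hom_ext fun _ _ k l =>
        extInn_whiskerRight_extendμ hJ R k l f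
      μIso_hom_natural_right := fun _ f => extend_tensor_hom_ext fun _ _ k l =>
        extInn_whiskerLeft_extendμ hJ R k l f
      associativity := extendμ_associativity hJ R
      left_unitality := extendμ_left_unitality hJ R
      right_unitality := extendμ_right_unitality hJ R }

theorem extInn_μ {P Q : D} {c d : C} (k : J.obj c ⟶ P) (l : J.obj d ⟶ Q) :
    (extInn hJ R k ⊗ₘ extInn hJ R l) ≫ μ (extend hJ R) P Q =
      μ F c d ≫ extInn hJ R (δ J c d ≫ (k ⊗ₘ l)) :=
  extInn_extendμ hJ R k l

theorem ε_extend : ε (extend hJ R) = ε F ≫ extInn hJ R (η J) := rfl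

end ExtendMonoidal

section Braided

noncomputable instance {K : Type u} [Field K] {C : Type u₁} [Category.{v₁} C] [Preadditive C]
    [Linear K C] {D : Type u₂} [Category.{v₂} D] [Preadditive D] [Linear K D] {T : Type u₃}
    [Category.{v₃} T] [Preadditive T] [Linear K T] {J : C ⥤ D} [J.Full] [J.Faithful] [J.Additive]
    [J.Linear K] {F : C ⥤ T} [F.Additive] [F.Linear K] (hJ : Dominates J)
    (R : ∀ P, Realization K J F P) [MonoidalCategory C] [MonoidalCategory D] [MonoidalCategory T]
    [MonoidalPreadditive D] [MonoidalPreadditive T] [BraidedCategory C] [BraidedCategory D]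
    [BraidedCategory T] [J.Braided] [F.Braided] : (extend hJ R).Braided where
  braided P Q := by
    refine extend_tensor_hom_ext fun c d k l => ?_
    rw [reassoc_of% extInn_μ, extInn_map, BraidedCategory.braiding_naturality_assoc, extInn_μ,
      ← Functor.LaxBraided.braided_assoc, map_extInn, Functor.map_braiding]
    simp

end Braided

/-! ### Strictness of the restriction of the extended functor -/

section Strict

variable {K : Type u} [Field K] {C : Type u₁} [Category.{v₁} C] [Preadditive C]
  [Linear K C] [MonoidalCategory C] [SymmetricCategory C] {D : Type u₂} [Category.{v₂} D]
  [Preadditive D] [Linear K D] [MonoidalCategory D] [SymmetricCategory D]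
  {T : Type u₃} [Category.{v₃} T] [Preadditive T] [Linear K T] [MonoidalCategory T]
  [SymmetricCategory T] [MonoidalPreadditive D] [MonoidalPreadditive T]
  {J : TensorFunctor K C D} [J.functor.Full] [J.functor.Faithful] {F : TensorFunctor K C T}

/-- The extended functor as a tensor functor. -/
noncomputable def TensorFunctor.extend (hJ : Dominates J.functor)
    (R : ∀ P, Realization K J.functor F.functor P) : TensorFunctor K D T where
  functor := _root_.extend hJ R

open Functor.LaxMonoidal Functor.OplaxMonoidal

/-- If the extension takes the values of `F` on the subcategory, its structure morphisms restrict to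
those of `F`, so that the restriction is strict if `F` is. -/
theorem TensorFunctor.isStrict_comp_extend (hJ : Dominates J.functor)
    {R : ∀ P, Realization K J.functor F.functor P} (hR : Realization.IsStrict R) (hF : F.IsStrict) :
    (J.comp (TensorFunctor.extend hJ R)).IsStrict := by
  have hR' : ∀ X : C, ∃ h : F.functor.obj X = (_root_.extend hJ R).obj (J.functor.obj X),
      extInn hJ R (𝟙 (J.functor.obj X)) = eqToHom h := hR
  choose h hι using hR'
  have hinv : ∀ {A B : T} (i : A ≅ B) (e : A = B), i.hom = eqToHom e → i.inv = eqToHom e.symm := by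
    rintro A _ i rfl hi
    rw [← cancel_epi i.hom, i.hom_inv_id, hi]; simp
  have ht : ∀ X Y : C, (_root_.extend hJ R).obj (J.functor.obj X) ⊗
      (_root_.extend hJ R).obj (J.functor.obj Y) =
        (_root_.extend hJ R).obj (J.functor.obj (X ⊗ Y)) := fun X Y =>
    (congrArg₂ (· ⊗ ·) (h X) (h Y)).symm.trans ((hF.obj_tensor X Y).symm.trans (h (X ⊗ Y)))
  have hu : 𝟙_ T = (_root_.extend hJ R).obj (J.functor.obj (𝟙_ C)) :=
    hF.obj_unit.symm.trans (h (𝟙_ C))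
  have hμ : ∀ X Y : C, μ (_root_.extend hJ R) (J.functor.obj X) (J.functor.obj Y) ≫
      (_root_.extend hJ R).map (μ J.functor X Y) = eqToHom (ht X Y) := by
    intro X Y
    have h₁ : extInn hJ R (𝟙 (J.functor.obj X)) ⊗ₘ extInn hJ R (𝟙 (J.functor.obj Y)) =
        eqToHom (congrArg₂ (· ⊗ ·) (h X) (h Y)) := by
      rw [hι, hι, MonoidalCategory.tensorHom_def, eqToHom_whiskerRight, whiskerLeft_eqToHom,
        eqToHom_trans]
    have h₂ : μ F.functor X Y = eqToHom (hF.obj_tensor X Y).symm :=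
      hinv (Functor.Monoidal.μIso F.functor X Y).symm _ (hF.δ_eq X Y)
    have h₃ := extInn_μ hJ R (𝟙 (J.functor.obj X)) (𝟙 (J.functor.obj Y))
    rw [← cancel_epi (eqToHom (congrArg₂ (· ⊗ ·) (h X) (h Y))), ← h₁, reassoc_of% h₃, extInn_map,
      MonoidalCategory.id_tensorHom_id, Category.comp_id, Functor.Monoidal.δ_μ, hι, h₁, h₂,
      eqToHom_trans, eqToHom_trans]
  have hε : ε (_root_.extend hJ R) ≫ (_root_.extend hJ R).map (ε J.functor) = eqToHom hu := by
    have h₂ : ε F.functor = eqToHom hF.obj_unit.symm :=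
      hinv (Functor.Monoidal.εIso F.functor).symm _ hF.η_eq
    rw [ε_extend, Category.assoc, extInn_map, Functor.Monoidal.η_ε, hι, h₂, eqToHom_trans]
  exact
    { obj_tensor := fun X Y => (ht X Y).symm
      obj_unit := hu.symm
      δ_eq := fun X Y =>
        hinv (Functor.Monoidal.μIso (J.functor ⋙ _root_.extend hJ R) X Y) _ (hμ X Y)
      η_eq := hinv (Functor.Monoidal.εIso (J.functor ⋙ _root_.extend hJ R)) _ hε }

end Strict

/-! ### The universal property of `RepGL` -/

section Universal

variable {K : Type u} [Field K] (δ : K) (T : Type u₁) [Category.{v₁} T] [Preadditive T] [Linear K T]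
  [MonoidalCategory T] [SymmetricCategory T] [IsTensorCategory K T]

/-- An object of dimension `δ` is the value at `•` of a tensor functor on `RepGL δ` with strict
restriction: the extension of a strict functor on words. -/
theorem RepGL.exists_of_hasDimension [Limits.HasFiniteBiproducts T] [IsIdempotentComplete T]
    {X : T} (h : HasDimension δ X) : ∃ F : TensorFunctor K (RepGL δ) T,
      ((RepGL.embedding δ).comp F).IsStrict ∧
        F.functor.obj ((RepGL.embedding δ).functor.obj (SkeletonCat.bullet δ)) = X := by
  obtain ⟨F, hF, hX⟩ := SkeletonCat.exists_strict_of_hasDimension h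
  have hJ := RepGL.dominates_embedding δ
  obtain ⟨R, hR⟩ := Realization.exists_isStrict (K := K) (F := F.functor) hJ
    (RepGL.embedding_obj_injective δ)
  exact ⟨TensorFunctor.extend hJ R, TensorFunctor.isStrict_comp_extend hJ hR hF,
    (hR (SkeletonCat.bullet δ)).choose.symm.trans hX⟩

end Universal

/-- The condition `Θ ⋙ inclusion = evalBullet` says that `Θ` is the functor `F ↦ F(•)`, `η ↦ η_•`
with values in the category of `δ`-dimensional objects and their isomorphisms; it determines `Θ`. -/
theorem mainTheorem9 {K : Type u} [Field K] [CharZero K] (δ : K)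
    {T : Type u₁} [Category.{v₁} T] [Preadditive T] [Linear K T] [MonoidalCategory T]
    [SymmetricCategory T] [IsTensorCategory K T] :
    (∃ Θ : StrictTensorFunctor K (SkeletonCat δ) T ⥤ DimensionalObjects δ T,
      Θ ⋙ DimensionalObjects.inclusion δ T = SkeletonCat.evalBullet δ T ∧ Θ.IsEquivalence) ∧
    (∃ Θ' : RepGL.StrictRestrictionFunctor δ T ⥤ DimensionalObjects δ T,
      Θ' ⋙ DimensionalObjects.inclusion δ T = RepGL.evalBullet δ T ∧ Θ'.Full ∧ Θ'.Faithful ∧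
      (Limits.HasFiniteBiproducts T → IsIdempotentComplete T → Θ'.IsEquivalence)) := by
  constructor
  · let Θ : StrictTensorFunctor K (SkeletonCat δ) T ⥤ DimensionalObjects δ T :=
      ObjectProperty.ι _ ⋙ SkeletonCat.evalDimensional δ T
    have : Θ.EssSurj := ⟨fun Y => by
      obtain ⟨F, hF, hX⟩ := SkeletonCat.exists_strict_of_hasDimension Y.of.property
      exact ⟨⟨F, hF⟩, ⟨eqToIso (congrArg Core.mk (ObjectProperty.FullSubcategory.ext hX))⟩⟩⟩
    exact ⟨Θ, rfl, { }⟩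
  · let J := RepGL.embedding δ
    have := Dominates.full_precomp (T := T) J (RepGL.dominates_embedding δ)
    have := Dominates.faithful_precomp (T := T) J (RepGL.dominates_embedding δ)
    let Θ : RepGL.StrictRestrictionFunctor δ T ⥤ DimensionalObjects δ T :=
      ObjectProperty.ι _ ⋙ J.precomp T ⋙ SkeletonCat.evalDimensional δ T
    refine ⟨Θ, rfl, inferInstance, inferInstance, fun _ _ => ?_⟩
    have : Θ.EssSurj := ⟨fun Y => by
      obtain ⟨F, hF, hX⟩ := RepGL.exists_of_hasDimension δ T Y.of.property
      exact ⟨⟨F, hF⟩, ⟨eqToIso (congrArg Core.mk (ObjectProperty.FullSubcategory.ext hX))⟩⟩⟩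
    exact { }
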